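/- Let $(N,h)$ be a closed (compact, without boundary) smooth Riemannian manifold of dimension two. Let $H$ be a torus, i.e. a compact connected abelian Lie group, with Lie algebra $\mathfrak h=T_eH$, equipped with an invariant Riemannian metric, and denote by $\langle\cdot,\cdot\rangle$ its restriction to $\mathfrak h$. For a smooth $\mathfrak h$-valued $1$-form $\lambda$ on $N$ and $Z\in\mathfrak h$, let $\lambda_Z:=\langle\lambda(\cdot),Z\rangle$, a real-valued $1$-form on $N$. Identify $T_{(p,z)}(N\times H)$ with $T_pN\times\mathfrak h$ by translation in $H$, and let $g_\lambda$ be the Riemannian metric on $N\times H$ given by $$g_\lambda\big((X,V),(Y,W)\big)=h(X,Y)+\langle\lambda(X)+V,\lambda(Y)+W\rangle ;$$ equivalently, $g_\lambda$ induces the given invariant metric on each fiber $\{p\}\times H$, the projection $(N\times H,g_\lambda)\to(N,h)$ is a Riemannian submersion, and the vectors $(X,-\lambda(X))$ are horizontal. Let $\lambda,\lambda'$ be two smooth $\mathfrak h$-valued $1$-forms on $N$ such that for each $Z\in\mathfrak h$ there is an isometry $f_Z$ of $(N,h)$ with $\lambda'_Z=f_Z^*\lambda_Z$. Write $M=N\times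 H$, and denote by $\mathrm{scal}^g$ and $\mathrm{dvol}_g$ the scalar curvature function and the Riemannian measure of a metric $g$ on $M$. Then: (i) $\displaystyle\int_M(\mathrm{scal}^{g_\lambda})^k\,\mathrm{dvol}_{g_\lambda}=\int_M(\mathrm{scal}^{g_{\lambda'}})^k\,\mathrm{dvol}_{g_{\lambda'}}$ for all $k\in\mathbb N$ (both integrals being finite); (ii) the functions $\mathrm{scal}^{g_\lambda}$ and $\mathrm{scal}^{g_{\lambda'}}$ have the same range. -/

import Mathlib

open MeasureTheory Set Bundle
open scoped Manifold ContDiff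

/-! ## Fields of bilinear forms, curvature and volume -/

section Curvature

variable {V : Type*} [NormedAddCommGroup V] [NormedSpace ℝ V] [FiniteDimensional ℝ V]

/-- The Levi-Civita connection of a field `G` of nondegenerate symmetric bilinear forms on a
vector space `V`: the Christoffel map `Γ_y : V × V → V`, determined by
`G_y(Γ_y(u,v), w) = (∂_u G(v,w) + ∂_v G(u,w) - ∂_w G(u,v)) / 2`
(`inverse` is the inverse of the musical map `V → V*`, `v ↦ G_y(v, ·)`). -/
noncomputable def christoffel (G : V → V →L[ℝ] V →L[ℝ] ℝ) (y u v : V) : V :=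
  ContinuousLinearMap.inverse (G y)
    ((1 / 2 : ℝ) • (fderiv ℝ (fun x => G x v) y u + fderiv ℝ (fun x => G x u) y v
      - fderiv ℝ (fun x => G x u v) y))

/-- The curvature tensor
`R(u,v)w = ∂_u(Γ(v,w)) - ∂_v(Γ(u,w)) + Γ(u,Γ(v,w)) - Γ(v,Γ(u,w))`. -/
noncomputable def curvatureTensor (G : V → V →L[ℝ] V →L[ℝ] ℝ) (y u v w : V) : V :=
  fderiv ℝ (fun x => christoffel G x v w) y u - fderiv ℝ (fun x => christoffel G x u w) y v
    + christoffel G y u (christoffel G y v w) - christoffel G y v (christoffel G y u w)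

/-- The Ricci tensor: `Ric_y(v,w)` is the trace of `u ↦ R_y(u,v)w`. -/
noncomputable def ricci (G : V → V →L[ℝ] V →L[ℝ] ℝ) (y v w : V) : ℝ :=
  ∑ i, (Module.finBasis ℝ V).coord i (curvatureTensor G y (Module.finBasis ℝ V i) v w)

/-- The scalar curvature `∑ᵢⱼ gⁱʲ Ric(bᵢ, bⱼ)`, written as `∑ᵢ Ric(bᵢ, (bⁱ)♯)` with `bⁱ` the
dual basis and `♯` the inverse of the musical map. -/
noncomputable def scalarCurvatureOn (G : V → V →L[ℝ] V →L[ℝ] ℝ) (y : V) : ℝ :=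
  ∑ i, ricci G y (Module.finBasis ℝ V i)
    (ContinuousLinearMap.inverse (G y)
      (LinearMap.toContinuousLinearMap ((Module.finBasis ℝ V).coord i)))

/-- The Riemannian density `√|det (G_y(bᵢ,bⱼ))|`, relative to the basis `b = Module.finBasis ℝ V`. -/
noncomputable def volumeDensity (G : V → V →L[ℝ] V →L[ℝ] ℝ) (y : V) : ℝ :=
  √|(Matrix.of fun i j => G y (Module.finBasis ℝ V i) (Module.finBasis ℝ V j)).det|

end Curvature

section Manifold

variable {V : Type*} [NormedAddCommGroup V] [NormedSpace ℝ V]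
  {B : Type*} [TopologicalSpace B] (I : ModelWithCorners ℝ V B)
  {M : Type*} [TopologicalSpace M] [ChartedSpace B M]

/-- The expression of a field `g` of bilinear forms on the tangent spaces of `M` in the preferred
chart `φ` at `x`: `y ↦ g(dφ⁻¹_y ·, dφ⁻¹_y ·)`. -/
noncomputable def inChart (g : ∀ p : M, TangentSpace I p →L[ℝ] TangentSpace I p →L[ℝ] ℝ)
    (x : M) (y : V) : V →L[ℝ] V →L[ℝ] ℝ :=
  let A : V →L[ℝ] V := mfderiv 𝓘(ℝ, V) I (extChartAt I x).symm y
  let b : V →L[ℝ] V →L[ℝ] ℝ := g ((extChartAt I x).symm y)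
  b.bilinearComp A A

theorem inChart_apply (g : ∀ p : M, TangentSpace I p →L[ℝ] TangentSpace I p →L[ℝ] ℝ)
    (x : M) (y u v : V) :
    inChart I g x y u v = g ((extChartAt I x).symm y)
      (mfderiv 𝓘(ℝ, V) I (extChartAt I x).symm y u)
      (mfderiv 𝓘(ℝ, V) I (extChartAt I x).symm y v) := rfl

/-- The scalar curvature of a Riemannian metric on a manifold without boundary, computed at `x` in
the preferred chart at `x`. -/
noncomputable def scalarCurvature [FiniteDimensional ℝ V]
    (g : ∀ p : M, TangentSpace I p →L[ℝ] TangentSpace I p →L[ℝ] ℝ) (x : M) : ℝ :=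
  scalarCurvatureOn (inChart I g x) (extChartAt I x x)

/-- The Riemannian measure of `g` on the domain of the preferred chart `φ` at `x`, extended by zero:
the image under `φ⁻¹` of `√(det gᵢⱼ) dy` on the target of `φ`. -/
noncomputable def chartVolume [FiniteDimensional ℝ V] [MeasurableSpace V] [BorelSpace V]
    [MeasurableSpace M]
    (g : ∀ p : M, TangentSpace I p →L[ℝ] TangentSpace I p →L[ℝ] ℝ) (x : M) : Measure M :=
  (((Module.finBasis ℝ V).addHaar.restrict (extChartAt I x).target).withDensity
    (fun y => ENNReal.ofReal (volumeDensity (inChart I g x) y))).map (extChartAt I x).symm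

/-- The Riemannian measure `dvol_g`. Its restrictions to the chart domains are the measures
`chartVolume`, and it is the least measure which dominates all of them. -/
noncomputable def riemannianVolume [FiniteDimensional ℝ V] [MeasurableSpace V] [BorelSpace V]
    [MeasurableSpace M]
    (g : ∀ p : M, TangentSpace I p →L[ℝ] TangentSpace I p →L[ℝ] ℝ) : Measure M :=
  ⨆ x : M, chartVolume I g x

/-- `f` is an isometry of the Riemannian manifold `(M, h)`: a diffeomorphism with `f^* h = h`. -/
def IsRiemannianIsometry (h : ∀ p : M, TangentSpace I p →L[ℝ] TangentSpace I p →L[ℝ] ℝ)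
    (f : M ≃ₘ^∞⟮I, I⟯ M) : Prop :=
  ∀ (p : M) (X Y : TangentSpace I p),
    h (f p) (mfderiv I I f p X) (mfderiv I I f p Y) = h p X Y

/-- A Riemannian metric on a Lie group is (left) invariant. -/
def IsLeftInvariantMetric [Group M]
    (k : ∀ z : M, TangentSpace I z →L[ℝ] TangentSpace I z →L[ℝ] ℝ) : Prop :=
  ∀ (a z : M) (v w : TangentSpace I z),
    k (a * z) (mfderiv I I (fun x => a * x) z v) (mfderiv I I (fun x => a * x) z w) = k z v w

/-- The 1-form `α` on `M` with values in the normed space `F` is smooth, as a section of the bundle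
with fibers `Hom(T_pM, F)`. -/
def IsSmoothOneForm {F : Type*} [NormedAddCommGroup F] [NormedSpace ℝ F] [IsManifold I ∞ M]
    (α : ∀ p : M, TangentSpace I p →L[ℝ] F) : Prop :=
  ContMDiff I (I.prod 𝓘(ℝ, V →L[ℝ] F)) ∞
    (fun p => TotalSpace.mk' (V →L[ℝ] F)
      (E := fun p : M => TangentSpace I p →L[ℝ] Bundle.Trivial M F p) p (α p))

end Manifold

/-! ## The metrics `g_λ` on `N × H` -/

section Bundle

variable {n r : ℕ}
  {N : Type*} [TopologicalSpace N] [ChartedSpace (EuclideanSpace ℝ (Fin n)) N]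
  {H : Type*} [TopologicalSpace H] [ChartedSpace (EuclideanSpace ℝ (Fin r)) H] [CommGroup H]

/-- The connection form on the trivial bundle `N × H` extending `lam`: the tangent vector `(X, W)`
at `(p, z)` is mapped to `lam(X) + d(z⁻¹ ·)W`, an element of the Lie algebra of `H`. -/
noncomputable def connectionForm
    (lam : ∀ p : N, TangentSpace (𝓡 n) p →L[ℝ] GroupLieAlgebra (𝓡 r) H) (q : N × H) :
    TangentSpace ((𝓡 n).prod (𝓡 r)) q →L[ℝ] GroupLieAlgebra (𝓡 r) H :=
  let trivializeLeft : TangentSpace (𝓡 r) q.2 →L[ℝ] GroupLieAlgebra (𝓡 r) H :=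
    mfderiv (𝓡 r) (𝓡 r) (fun x : H => q.2⁻¹ * x) q.2
  lam q.1 ∘L mfderiv ((𝓡 n).prod (𝓡 r)) (𝓡 n) (Prod.fst : N × H → N) q +
    trivializeLeft ∘L mfderiv ((𝓡 n).prod (𝓡 r)) (𝓡 r) (Prod.snd : N × H → H) q

/-- The metric `g_λ` on `N × H`: the Riemannian metric which induces the invariant metric `k` on the
fibers, for which the projection to `(N, h)` is a Riemannian submersion, and whose horizontal
distribution is the kernel of the connection form `ω` extending `lam`. In formulas,
`g_λ(ξ, η) = h(dπ ξ, dπ η) + ⟨ω(ξ), ω(η)⟩`, with `⟨·,·⟩` the restriction of `k` to the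
Lie algebra. -/
noncomputable def bundleMetric
    (h : ∀ p : N, TangentSpace (𝓡 n) p →L[ℝ] TangentSpace (𝓡 n) p →L[ℝ] ℝ)
    (k : ∀ z : H, TangentSpace (𝓡 r) z →L[ℝ] TangentSpace (𝓡 r) z →L[ℝ] ℝ)
    (lam : ∀ p : N, TangentSpace (𝓡 n) p →L[ℝ] GroupLieAlgebra (𝓡 r) H) (q : N × H) :
    TangentSpace ((𝓡 n).prod (𝓡 r)) q →L[ℝ] TangentSpace ((𝓡 n).prod (𝓡 r)) q →L[ℝ] ℝ :=
  let dπ : EuclideanSpace ℝ (Fin n) × EuclideanSpace ℝ (Fin r) →L[ℝ] EuclideanSpace ℝ (Fin n) :=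
    mfderiv ((𝓡 n).prod (𝓡 r)) (𝓡 n) (Prod.fst : N × H → N) q
  let om : EuclideanSpace ℝ (Fin n) × EuclideanSpace ℝ (Fin r) →L[ℝ] EuclideanSpace ℝ (Fin r) :=
    connectionForm lam q
  let hq : EuclideanSpace ℝ (Fin n) →L[ℝ] EuclideanSpace ℝ (Fin n) →L[ℝ] ℝ := h q.1
  let k1 : EuclideanSpace ℝ (Fin r) →L[ℝ] EuclideanSpace ℝ (Fin r) →L[ℝ] ℝ := k 1
  hq.bilinearComp dπ dπ + k1.bilinearComp om om

theorem bundleMetric_apply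
    (h : ∀ p : N, TangentSpace (𝓡 n) p →L[ℝ] TangentSpace (𝓡 n) p →L[ℝ] ℝ)
    (k : ∀ z : H, TangentSpace (𝓡 r) z →L[ℝ] TangentSpace (𝓡 r) z →L[ℝ] ℝ)
    (lam : ∀ p : N, TangentSpace (𝓡 n) p →L[ℝ] GroupLieAlgebra (𝓡 r) H) (q : N × H)
    (ξ η : TangentSpace ((𝓡 n).prod (𝓡 r)) q) :
    bundleMetric h k lam q ξ η =
      h q.1 (mfderiv ((𝓡 n).prod (𝓡 r)) (𝓡 n) (Prod.fst : N × H → N) q ξ)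
          (mfderiv ((𝓡 n).prod (𝓡 r)) (𝓡 n) (Prod.fst : N × H → N) q η) +
        k 1 (connectionForm lam q ξ) (connectionForm lam q η) := rfl

end Bundle

/-! On a surface, `dλ` at a point amounts to a single vector: for an `h`-orthonormal basis `(e₁,
e₂)` put `v = dλ(e₁, e₂)` in the Lie algebra, well defined up to sign. The fibers are flat and
totally geodesic, so O'Neill's formula gives `scal = K - |v|²/2` with `K` the scalar curvature of
the base (`IsBundlePoint.scalarCurvatureOn_bundle`, `exists_fieldStrength`). The volume of `g_λ`
does not depend on `λ`, since changing `λ` composes the coframe with a shear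
(`riemannianVolume_bundleMetric_eq`).

An isometry `f` with `λ'_Z = f^*λ_Z` preserves `K` and the volume and satisfies `⟨v', Z⟩² = ⟨v, Z⟩²
∘ f`. Hence `∫ K^a ⟨v, Z⟩^(2b)` equals the same integral for `v'`, for every `Z`, although `f`
varies with `Z`. Against a radial weight in `Z`, the function `⟨w, Z⟩^(2b)` integrates to a positive
constant times `|w|^(2b)`; so all mixed moments of `K` and `|v|²` agree
(`integral_pow_mul_norm_pow_eq`), and the binomial formula gives (i). For (ii), Weierstrass
approximation extends the equality of moments to integrals of continuous functions of the scalar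
curvature, and these detect the range because the volume charges open sets
(`range_eq_of_integral_pow_eq`).

The curvature formula is Cartan's moving frame method in a chart: `g_λ` is the pullback of `h ⊕ k`
by the coframe `P = (dπ, ω)`, and the curvature is read off from the connection form in this frame
(`apply_connectionCurvature_of_gauge`). Applied with `P` the differential of a map, the same lemma
shows that scalar curvature is invariant under isometries and chart changes
(`scalarCurvatureOn_comp`). -/

/-! ### Levi-Civita connection and scalar curvature on a vector space -/

section LocalGeometry

open scoped Topology

set_option maxSynthPendingDepth 3

/-- An operator on a finite-dimensional space is the tuple of its values on a basis, so smoothness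
may be tested one vector at a time. -/
theorem contDiffAt_clm_apply {D E F : Type*} [NormedAddCommGroup D] [NormedSpace ℝ D]
    [NormedAddCommGroup E] [NormedSpace ℝ E] [NormedAddCommGroup F] [NormedSpace ℝ F]
    [FiniteDimensional ℝ E] {n : WithTop ℕ∞} {f : D → E →L[ℝ] F} {x : D}
    (h : ∀ e, ContDiffAt ℝ n (fun y => f y e) x) : ContDiffAt ℝ n f x := by
  let d := Module.finrank ℝ E
  have hd : d = Module.finrank ℝ (Fin d → ℝ) := (Module.finrank_fin_fun ℝ).symm
  let e₁ := ContinuousLinearEquiv.ofFinrankEq hd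
  let e₂ := (e₁.arrowCongr (1 : F ≃L[ℝ] F)).trans (ContinuousLinearEquiv.piRing (Fin d))
  rw [← Function.id_comp f, ← e₂.symm_comp_self]
  exact e₂.symm.contDiff.contDiffAt.comp x (contDiffAt_pi.mpr fun i => h _)

variable {V : Type*} [NormedAddCommGroup V] [NormedSpace ℝ V]

/-- The Koszul expression `(D(u,v,w) + D(v,u,w) - D(w,u,v)) / 2`. -/
noncomputable def koszul : (V →L[ℝ] V →L[ℝ] V →L[ℝ] ℝ) →L[ℝ] (V →L[ℝ] V →L[ℝ] V →L[ℝ] ℝ) :=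
  -- `σ` swaps the first two slots and `τ` the last two; `τ ∘ σ` yields the term `D(w,u,v)`.
  let σ := (ContinuousLinearMap.flipₗᵢ ℝ V V (V →L[ℝ] ℝ)).toContinuousLinearEquiv.toContinuousLinearMap
  let τ := ContinuousLinearMap.compL ℝ V (V →L[ℝ] V →L[ℝ] ℝ) (V →L[ℝ] V →L[ℝ] ℝ)
    (ContinuousLinearMap.flipₗᵢ ℝ V V ℝ).toContinuousLinearEquiv.toContinuousLinearMap
  (1 / 2 : ℝ) • (ContinuousLinearMap.id ℝ _ + σ - τ ∘L σ)

theorem koszul_apply (D : V →L[ℝ] V →L[ℝ] V →L[ℝ] ℝ) (u v w : V) :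
    koszul D u v w = 1 / 2 * (D u v w + D v u w - D w u v) := by
  simp [koszul]

/-- The Christoffel map, bundled as a field of bilinear maps. -/
noncomputable def christoffelMap (G : V → V →L[ℝ] V →L[ℝ] ℝ) (y : V) : V →L[ℝ] V →L[ℝ] V :=
  ContinuousLinearMap.compL ℝ V (V →L[ℝ] ℝ) V (ContinuousLinearMap.inverse (G y)) ∘L
    koszul (fderiv ℝ G y)

/-- `G` is smooth at `y`, and `G y` is a scalar product. -/
structure IsMetricPoint (G : V → V →L[ℝ] V →L[ℝ] ℝ) (y : V) : Prop where
  smooth : ContDiffAt ℝ ∞ G y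
  symm : ∀ u v, G y u v = G y v u
  pos : ∀ v, v ≠ 0 → 0 < G y v v

/-- `ContinuousLinearMap.inverse` has the default value zero on non-invertible maps; positivity
makes the musical map injective, and equality of dimensions excludes the default. -/
theorem isInvertible_of_pos [FiniteDimensional ℝ V] {b : V →L[ℝ] V →L[ℝ] ℝ}
    (h : ∀ v, v ≠ 0 → 0 < b v v) : b.IsInvertible := by
  have hinj : Function.Injective (b : V →ₗ[ℝ] (V →L[ℝ] ℝ)) := by
    rw [← LinearMap.ker_eq_bot, LinearMap.ker_eq_bot']
    intro v hv
    by_contra hne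
    have := h v hne
    have h0 : b v = 0 := hv
    simp [h0] at this
  have hdim : Module.finrank ℝ V = Module.finrank ℝ (V →L[ℝ] ℝ) := by
    rw [← LinearEquiv.finrank_eq (LinearMap.toContinuousLinearMap (𝕜 := ℝ) (E := V) (F' := ℝ))]
    exact (Subspace.dual_finrank_eq (K := ℝ) (V := V)).symm
  exact ⟨(LinearMap.linearEquivOfInjective _ hinj hdim).toContinuousLinearEquiv, by ext; rfl⟩

namespace IsMetricPoint

variable {G : V → V →L[ℝ] V →L[ℝ] ℝ} {y : V}

theorem differentiableAt (hG : IsMetricPoint G y) : DifferentiableAt ℝ G y :=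
  hG.smooth.differentiableAt (by simp)

theorem ext_of_apply (hG : IsMetricPoint G y) {a b : V} (h : ∀ w, G y a w = G y b w) : a = b := by
  by_contra hne
  have := hG.pos (a - b) (sub_ne_zero.2 hne)
  simp [h] at this

/-- Differentiating `G` with frozen arguments is evaluating its derivative. The bundled form makes
bilinearity automatic and smoothness in the point easy to state. -/
theorem christoffelMap_apply (hG : IsMetricPoint G y) (u v : V) :
    christoffelMap G y u v = christoffel G y u v := by
  have hd := hG.differentiableAt
  unfold christoffel christoffelMap
  simp only [ContinuousLinearMap.comp_apply, ContinuousLinearMap.compL_apply]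
  congr 1
  ext w
  have e1 : ∀ v, fderiv ℝ (fun x => G x v) y = (fderiv ℝ G y).flip v := by
    intro v
    rw [fderiv_clm_apply hd (by fun_prop)]
    ext; simp
  have e2 : fderiv ℝ (fun x => G x u v) y = ((fderiv ℝ G y).flip u).flip v := by
    rw [fderiv_clm_apply (by fun_prop) (by fun_prop), e1]
    ext; simp
  rw [koszul_apply, e1, e1, e2]
  simp

variable [FiniteDimensional ℝ V]

theorem isInvertible (hG : IsMetricPoint G y) : (G y).IsInvertible := isInvertible_of_pos hG.pos

theorem apply_inverse (hG : IsMetricPoint G y) (l : V →L[ℝ] ℝ) (w : V) :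
    G y (ContinuousLinearMap.inverse (G y) l) w = l w := by
  obtain ⟨e, he⟩ := hG.isInvertible
  rw [← he]
  simp

theorem contDiffAt_inverse (hG : IsMetricPoint G y) :
    ContDiffAt ℝ ∞ (fun x => ContinuousLinearMap.inverse (G x)) y := by
  obtain ⟨e, he⟩ := hG.isInvertible
  have := contDiffAt_map_inverse (n := ∞) e
  rw [he] at this
  exact this.comp y hG.smooth

theorem contDiffAt_christoffelMap (hG : IsMetricPoint G y) :
    ContDiffAt ℝ ∞ (christoffelMap G) y := by
  unfold christoffelMap
  have h1 := hG.contDiffAt_inverse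
  have h2 : ContDiffAt ℝ ∞ (fderiv ℝ G) y := hG.smooth.fderiv_right (by simp)
  have h3 : ContDiffAt ℝ ∞ (fun x => koszul (fderiv ℝ G x)) y :=
    (koszul (V := V)).contDiff.contDiffAt.comp y h2
  exact ((ContinuousLinearMap.compL ℝ V (V →L[ℝ] ℝ) V).contDiff.contDiffAt.comp y h1).clm_comp h3

theorem apply_christoffelMap (hG : IsMetricPoint G y) (u v w : V) :
    G y (christoffelMap G y u v) w =
      1 / 2 * (fderiv ℝ G y u v w + fderiv ℝ G y v u w - fderiv ℝ G y w u v) := by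
  rw [← koszul_apply]
  exact hG.apply_inverse _ _

end IsMetricPoint

theorem DifferentiableAt.fderiv_clm_apply_const {E F D : Type*} [NormedAddCommGroup D]
    [NormedSpace ℝ D] [NormedAddCommGroup E] [NormedSpace ℝ E] [NormedAddCommGroup F]
    [NormedSpace ℝ F] {f : D → E →L[ℝ] F} {y : D} (hf : DifferentiableAt ℝ f y) (e : E) (u : D) :
    fderiv ℝ (fun x => f x e) y u = fderiv ℝ f y u e := by
  rw [fderiv_clm_apply hf (by fun_prop)]
  simp

/-- The curvature tensor of the connection `Γ`. -/
noncomputable def connectionCurvature (Γ : V → V →L[ℝ] V →L[ℝ] V) (y u v : V) : V →L[ℝ] V :=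
  fderiv ℝ Γ y u v - fderiv ℝ Γ y v u + (Γ y u) ∘L (Γ y v) - (Γ y v) ∘L (Γ y u)

variable [FiniteDimensional ℝ V]

/-- Curvature differentiates the Christoffel map, so the two versions of that map must agree on a
neighbourhood and not only at `y`. -/
theorem curvatureTensor_eq {G : V → V →L[ℝ] V →L[ℝ] ℝ} {y : V}
    (hG : ∀ᶠ x in 𝓝 y, IsMetricPoint G x) (u v w : V) :
    curvatureTensor G y u v w = connectionCurvature (christoffelMap G) y u v w := by
  have h0 := hG.self_of_nhds
  have hd : DifferentiableAt ℝ (christoffelMap G) y :=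
    h0.contDiffAt_christoffelMap.differentiableAt (by simp)
  have key : ∀ v w, fderiv ℝ (fun x => christoffel G x v w) y
      = fderiv ℝ (fun x => christoffelMap G x v w) y := by
    intro v w
    apply Filter.EventuallyEq.fderiv_eq
    filter_upwards [hG] with x hx using (hx.christoffelMap_apply v w).symm
  unfold curvatureTensor connectionCurvature
  rw [key, key]
  simp only [← h0.christoffelMap_apply]
  rw [(hd.clm_apply (differentiableAt_const v)).fderiv_clm_apply_const w u, hd.fderiv_clm_apply_const,
    (hd.clm_apply (differentiableAt_const u)).fderiv_clm_apply_const w v, hd.fderiv_clm_apply_const]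
  simp

/-- Both sides are the trace of `T`. This frees the Ricci and scalar curvatures from the basis in
their definitions. -/
theorem LinearMap.sum_coord_apply_eq {V : Type*} [AddCommGroup V] [Module ℝ V] {ι κ : Type*} [Fintype ι] [Fintype κ]
    (b : Module.Basis ι ℝ V) (e : Module.Basis κ ℝ V) (T : V →ₗ[ℝ] V) :
    ∑ i, b.coord i (T (b i)) = ∑ k, e.coord k (T (e k)) := by
  classical
  have h1 := LinearMap.trace_eq_matrix_trace ℝ b T
  have h2 := LinearMap.trace_eq_matrix_trace ℝ e T
  rw [h1] at h2
  simpa [Matrix.trace, LinearMap.toMatrix_apply] using h2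

/-- The scalar curvature is the sum of the sectional curvatures of an orthonormal basis. -/
theorem scalarCurvatureOn_eq_sum {G : V → V →L[ℝ] V →L[ℝ] ℝ} {y : V}
    (hG : ∀ᶠ x in 𝓝 y, IsMetricPoint G x) {κ : Type*} [Fintype κ] [DecidableEq κ]
    (e : Module.Basis κ ℝ V) (he : ∀ i j, G y (e i) (e j) = if i = j then 1 else 0) :
    scalarCurvatureOn G y =
      ∑ j, ∑ i, G y (connectionCurvature (christoffelMap G) y (e i) (e j) (e j)) (e i) := by
  have h0 := hG.self_of_nhds
  set R := connectionCurvature (christoffelMap G) y with hR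
  have hcoord : ∀ k x, e.coord k x = G y x (e k) := by
    intro k x
    conv_rhs => rw [← e.sum_repr x]
    simp [he, -Module.Basis.sum_repr]
  have hRadd : ∀ a b v, R (a + b) v = R a v + R b v := by
    intro a b v; ext w; simp [hR, connectionCurvature]; abel
  have hRsmul : ∀ (c : ℝ) a v, R (c • a) v = c • R a v := by
    intro c a v; ext w
    simp [hR, connectionCurvature, smul_sub, smul_add]
  have hRadd' : ∀ a b v, R v (a + b) = R v a + R v b := by
    intro a b v; ext w; simp [hR, connectionCurvature]; abel
  have hRsmul' : ∀ (c : ℝ) a v, R v (c • a) = c • R v a := by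
    intro c a v; ext w
    simp [hR, connectionCurvature, smul_sub, smul_add]
  have hric : ∀ v w, ricci G y v w = ∑ k, G y (R (e k) v w) (e k) := by
    intro v w
    let T : V →ₗ[ℝ] V :=
      { toFun := fun u => R u v w
        map_add' := fun a b => by rw [hRadd]; rfl
        map_smul' := fun c a => by rw [hRsmul]; rfl }
    have := LinearMap.sum_coord_apply_eq (Module.finBasis ℝ V) e T
    simp only [hcoord] at this
    unfold ricci
    simp only [curvatureTensor_eq hG]
    exact this
  let Q : V → V → ℝ := fun v w => ∑ k, G y (R (e k) v w) (e k)
  -- The Ricci endomorphism: raising the second slot of `Q` turns the scalar curvature into the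
  -- trace of `S`, which can be taken in the basis `e`.
  let S : V →ₗ[ℝ] V :=
    { toFun := fun v => ∑ c, Q v (e c) • e c
      map_add' := fun a b => by
        simp [Q, hRadd', Finset.sum_add_distrib, add_smul]
      map_smul' := fun a b => by
        simp [Q, hRsmul', Finset.smul_sum, ← Finset.mul_sum, mul_smul] }
  have hS : ∀ v (l : V →L[ℝ] ℝ), Q v (ContinuousLinearMap.inverse (G y) l) = l (S v) := by
    intro v l
    have : ContinuousLinearMap.inverse (G y) l = ∑ c, l (e c) • e c := by
      conv_lhs => rw [← e.sum_repr (ContinuousLinearMap.inverse (G y) l)]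
      refine Finset.sum_congr rfl fun c _ => ?_
      congr 1
      have := hcoord c (ContinuousLinearMap.inverse (G y) l)
      rw [h0.apply_inverse] at this
      exact this
    rw [this]
    simp only [Q, S, map_sum, map_smul, LinearMap.coe_mk, AddHom.coe_mk, smul_eq_mul,
      sum_apply, smul_apply, Finset.sum_mul]
    rw [Finset.sum_comm]
    exact Finset.sum_congr rfl fun c _ => Finset.sum_congr rfl fun i _ => by ring
  unfold scalarCurvatureOn
  have h1 : ∀ i, ricci G y (Module.finBasis ℝ V i) (ContinuousLinearMap.inverse (G y)
      (LinearMap.toContinuousLinearMap ((Module.finBasis ℝ V).coord i)))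
      = (Module.finBasis ℝ V).coord i (S (Module.finBasis ℝ V i)) := by
    intro i
    rw [hric]
    exact hS _ _
  rw [Finset.sum_congr rfl fun i _ => h1 i, LinearMap.sum_coord_apply_eq _ e S]
  refine Finset.sum_congr rfl fun j _ => ?_
  rw [hcoord]
  simp [S, he, Q]

/-- Every scalar product has an orthonormal basis. -/
theorem LinearMap.exists_orthonormal_basis {V : Type*} [AddCommGroup V] [Module ℝ V]
    [FiniteDimensional ℝ V] {b : V →ₗ[ℝ] V →ₗ[ℝ] ℝ} (hs : ∀ u v, b u v = b v u)
    (hp : ∀ v, v ≠ 0 → 0 < b v v) {n : ℕ} (hn : Module.finrank ℝ V = n) :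
    ∃ e : Module.Basis (Fin n) ℝ V, ∀ i j, b (e i) (e j) = if i = j then 1 else 0 := by
  let core : InnerProductSpace.Core ℝ V :=
    { inner := fun u v => b u v
      conj_inner_symm := fun u v => by simp [hs u v]
      re_inner_nonneg := fun u => by
        by_cases h : u = 0
        · simp [h]
        · exact (hp u h).le
      add_left := fun u v w => by simp
      smul_left := fun u v r => by simp
      definite := fun u hu => by
        by_contra h
        exact (hp u h).ne' hu }
  -- Here `V` has only its algebraic structure, so the norm coming from `b` competes with no other.
  let _ : NormedAddCommGroup V := core.toNormedAddCommGroup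
  let _ : InnerProductSpace ℝ V := InnerProductSpace.ofCore core.toCore
  let o := (stdOrthonormalBasis ℝ V).reindex (finCongr hn)
  refine ⟨o.toBasis, fun i j => ?_⟩
  have := orthonormal_iff_ite.1 o.orthonormal i j
  rw [OrthonormalBasis.coe_toBasis]
  exact this

theorem exists_orthonormal_basis {b : V →L[ℝ] V →L[ℝ] ℝ} (hs : ∀ u v, b u v = b v u)
    (hp : ∀ v, v ≠ 0 → 0 < b v v) {n : ℕ} (hn : Module.finrank ℝ V = n) :
    ∃ e : Module.Basis (Fin n) ℝ V, ∀ i j, b (e i) (e j) = if i = j then 1 else 0 :=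
  LinearMap.exists_orthonormal_basis (b := ContinuousLinearMap.toLinearMap₁₂ b) hs hp hn

end LocalGeometry

/-! ### Moving frames and invariance under local isometries -/

section GaugeChange

open scoped Topology

set_option maxSynthPendingDepth 3

theorem minSmoothness_two_le_infty : minSmoothness ℝ 2 ≤ (∞ : WithTop ℕ∞) := by
  rw [minSmoothness_of_isRCLikeNormedField]
  exact WithTop.coe_le_coe.2 le_top

variable {V S : Type*} [NormedAddCommGroup V] [NormedSpace ℝ V]
  [NormedAddCommGroup S] [NormedSpace ℝ S]

/-- Curvature in a moving frame `P`, in which the connection `Γ` has the connection form `A`. -/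
theorem apply_connectionCurvature_of_gauge {Γ : V → V →L[ℝ] V →L[ℝ] V} {P : V → V →L[ℝ] S}
    {A : V → V → S →L[ℝ] S} {y : V} (hΓ : DifferentiableAt ℝ Γ y) (hP : ContDiffAt ℝ ∞ P y)
    (hA : ∀ v, DifferentiableAt ℝ (fun x => A x v) y)
    (h : ∀ᶠ x in 𝓝 y, ∀ v w, P x (Γ x v w) = fderiv ℝ P x v w + A x v (P x w)) (u v w : V) :
    P y (connectionCurvature Γ y u v w) =
      fderiv ℝ (fun x => A x v) y u (P y w) - fderiv ℝ (fun x => A x u) y v (P y w)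
        + A y u (A y v (P y w)) - A y v (A y u (P y w)) := by
  have hPd : DifferentiableAt ℝ P y := hP.differentiableAt (by simp)
  have hP2 : DifferentiableAt ℝ (fderiv ℝ P) y :=
    (hP.fderiv_right (m := ∞) (by simp)).differentiableAt (by simp)
  have hsymm : IsSymmSndFDerivAt ℝ P y := hP.isSymmSndFDerivAt minSmoothness_two_le_infty
  -- The gauge relation differentiated in the direction `u` and solved for the derivative of `Γ`.
  have key : ∀ u v, P y (fderiv ℝ Γ y u v w) = fderiv ℝ (fderiv ℝ P) y u v w
      + fderiv ℝ (fun x => A x v) y u (P y w) + A y v (fderiv ℝ P y u w)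
      - fderiv ℝ P y u (Γ y v w) := by
    intro u v
    have e : fderiv ℝ (fun x => P x (Γ x v w)) y u
        = fderiv ℝ (fun x => fderiv ℝ P x v w + A x v (P x w)) y u := by
      rw [Filter.EventuallyEq.fderiv_eq]
      filter_upwards [h] with x hx using hx v w
    have h1 : DifferentiableAt ℝ (fun x => Γ x v w) y := by fun_prop
    have h2 : DifferentiableAt ℝ (fun x => fderiv ℝ P x v w) y := by fun_prop
    have h3 : DifferentiableAt ℝ (fun x => P x w) y := by fun_prop
    have h4 : DifferentiableAt ℝ (fun x => A x v (P x w)) y := (hA v).clm_apply h3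
    rw [fderiv_clm_apply hPd h1, fderiv_fun_add h2 h4, fderiv_clm_apply (hA v) h3] at e
    simp only [add_apply, ContinuousLinearMap.comp_apply, ContinuousLinearMap.flip_apply] at e
    rw [hPd.fderiv_clm_apply_const, (hΓ.clm_apply (differentiableAt_const v)).fderiv_clm_apply_const,
      hΓ.fderiv_clm_apply_const, (hP2.clm_apply (differentiableAt_const v)).fderiv_clm_apply_const,
      hP2.fderiv_clm_apply_const] at e
    rw [eq_sub_iff_add_eq, e]
    abel
  have h0 := h.self_of_nhds
  simp only [connectionCurvature, add_apply, sub_apply, ContinuousLinearMap.comp_apply, map_add,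
    map_sub]
  -- Antisymmetrizing in `u, v` removes the second derivative of `P`; what remains is `dA + A ∧ A`.
  rw [key, key, h0, h0, h0, h0, hsymm.eq u v]
  simp only [map_add]
  abel

theorem fderiv_bilinearComp {g : V → S →L[ℝ] S →L[ℝ] ℝ} {P : V → V →L[ℝ] S} {y : V}
    [FiniteDimensional ℝ V]
    (hg : ContDiffAt ℝ ∞ g y) (hP : ContDiffAt ℝ ∞ P y) (u a b : V) :
    fderiv ℝ (fun x => (g x).bilinearComp (P x) (P x)) y u a b =
      fderiv ℝ g y u (P y a) (P y b) + g y (fderiv ℝ P y u a) (P y b)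
        + g y (P y a) (fderiv ℝ P y u b) := by
  have hs : ContDiffAt ℝ ∞ (fun x => (g x).bilinearComp (P x) (P x)) y := by
    refine contDiffAt_clm_apply fun a => contDiffAt_clm_apply fun b => ?_
    simp only [ContinuousLinearMap.bilinearComp_apply]
    fun_prop
  have hd := hs.differentiableAt (by simp)
  have hgd := hg.differentiableAt (by simp)
  have hPd := hP.differentiableAt (by simp)
  rw [← hd.fderiv_clm_apply_const,
    ← (hd.clm_apply (differentiableAt_const a)).fderiv_clm_apply_const]
  simp only [ContinuousLinearMap.bilinearComp_apply]
  rw [fderiv_clm_apply (by fun_prop) (by fun_prop), fderiv_clm_apply (by fun_prop) (by fun_prop)]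
  simp only [add_apply, ContinuousLinearMap.comp_apply, ContinuousLinearMap.flip_apply]
  rw [fderiv_clm_apply (c := g) (u := fun x => P x a) (by fun_prop) (by fun_prop)]
  simp only [add_apply, ContinuousLinearMap.comp_apply, ContinuousLinearMap.flip_apply,
    hPd.fderiv_clm_apply_const, fderiv_fun_const, Pi.zero_apply, zero_apply, map_zero, zero_add]
  ring

theorem IsMetricPoint.bilinearComp [FiniteDimensional ℝ V] {g : V → S →L[ℝ] S →L[ℝ] ℝ}
    {P : V → V →L[ℝ] S} {y : V} (hg : ContDiffAt ℝ ∞ g y) (hP : ContDiffAt ℝ ∞ P y)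
    (hs : ∀ a b, g y a b = g y b a) (hp : ∀ a, a ≠ 0 → 0 < g y a a)
    (hinj : Function.Injective (P y)) :
    IsMetricPoint (fun x => (g x).bilinearComp (P x) (P x)) y where
  smooth := by
    refine contDiffAt_clm_apply fun a => contDiffAt_clm_apply fun b => ?_
    simp only [ContinuousLinearMap.bilinearComp_apply]
    fun_prop
  symm u v := by simp [hs (P y u)]
  pos v hv := by
    simp only [ContinuousLinearMap.bilinearComp_apply]
    exact hp _ fun h0 => hv (hinj (by simpa using h0))

/-- The Levi-Civita connection of the metric `P^* g`. -/
theorem apply_christoffelMap_bilinearComp [FiniteDimensional ℝ V] {g : V → S →L[ℝ] S →L[ℝ] ℝ}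
    {P : V → V →L[ℝ] S} {y : V} (hg : ContDiffAt ℝ ∞ g y) (hP : ContDiffAt ℝ ∞ P y)
    (hs : ∀ a b, g y a b = g y b a) (hp : ∀ a, a ≠ 0 → 0 < g y a a)
    (hinj : Function.Injective (P y)) (u v w : V) :
    g y (P y (christoffelMap (fun x => (g x).bilinearComp (P x) (P x)) y u v)) (P y w) =
      1 / 2 * (fderiv ℝ g y u (P y v) (P y w) + fderiv ℝ g y v (P y u) (P y w)
          - fderiv ℝ g y w (P y u) (P y v))
        + 1 / 2 * (g y (fderiv ℝ P y u v + fderiv ℝ P y v u) (P y w)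
          + g y (P y v) (fderiv ℝ P y u w - fderiv ℝ P y w u)
          + g y (P y u) (fderiv ℝ P y v w - fderiv ℝ P y w v)) := by
  have hm := IsMetricPoint.bilinearComp hg hP hs hp hinj
  -- Koszul's formula for `P^* g`; the product rule separates the derivative of `g` from that of the
  -- frame, whose antisymmetric part is the exterior derivative of the coframe.
  have := hm.apply_christoffelMap u v w
  rw [fderiv_bilinearComp hg hP, fderiv_bilinearComp hg hP, fderiv_bilinearComp hg hP] at this
  simp only [ContinuousLinearMap.bilinearComp_apply] at this
  rw [this]
  simp only [map_add, map_sub, add_apply]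
  rw [hs (fderiv ℝ P y w u) (P y v)]
  ring

theorem Filter.EventuallyEq.christoffelMap {G G' : V → V →L[ℝ] V →L[ℝ] ℝ} {y : V}
    (h : G =ᶠ[𝓝 y] G') : christoffelMap G =ᶠ[𝓝 y] christoffelMap G' := by
  filter_upwards [h.eventuallyEq_nhds] with x hx
  unfold _root_.christoffelMap
  rw [hx.fderiv_eq, hx.self_of_nhds]

theorem IsMetricPoint.congr {G G' : V → V →L[ℝ] V →L[ℝ] ℝ} {y : V} (hG : IsMetricPoint G y)
    (h : G' =ᶠ[𝓝 y] G) : IsMetricPoint G' y where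
  smooth := hG.smooth.congr_of_eventuallyEq h
  symm u v := by rw [h.self_of_nhds]; exact hG.symm u v
  pos v hv := by rw [h.self_of_nhds]; exact hG.pos v hv

variable [FiniteDimensional ℝ V]

theorem scalarCurvatureOn_congr {G G' : V → V →L[ℝ] V →L[ℝ] ℝ} {y : V}
    (h : G =ᶠ[𝓝 y] G') (hG : ∀ᶠ x in 𝓝 y, IsMetricPoint G x) :
    scalarCurvatureOn G y = scalarCurvatureOn G' y := by
  have hG' : ∀ᶠ x in 𝓝 y, IsMetricPoint G' x := by
    filter_upwards [hG, h.symm.eventuallyEq_nhds] with x hx hx' using hx.congr hx'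
  obtain ⟨e, he⟩ := exists_orthonormal_basis hG.self_of_nhds.symm hG.self_of_nhds.pos rfl
  rw [scalarCurvatureOn_eq_sum hG e he,
    scalarCurvatureOn_eq_sum hG' e (by rw [← h.self_of_nhds]; exact he)]
  unfold connectionCurvature
  rw [h.christoffelMap.fderiv_eq, h.christoffelMap.self_of_nhds, h.self_of_nhds]

/-- The scalar curvature is invariant under local isometries. -/
theorem scalarCurvatureOn_comp {G G' : V → V →L[ℝ] V →L[ℝ] ℝ} {Φ : V → V} {y : V}
    (hG : ∀ᶠ x in 𝓝 (Φ y), IsMetricPoint G x) (hΦ : ∀ᶠ x in 𝓝 y, ContDiffAt ℝ ∞ Φ x)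
    (hinj : ∀ᶠ x in 𝓝 y, Function.Injective (fderiv ℝ Φ x))
    (h : G' =ᶠ[𝓝 y] fun x => (G (Φ x)).bilinearComp (fderiv ℝ Φ x) (fderiv ℝ Φ x)) :
    scalarCurvatureOn G' y = scalarCurvatureOn G (Φ y) := by
  set P := fderiv ℝ Φ with hPdef
  set g := fun x => G (Φ x) with hgdef
  have hΦc : ContinuousAt Φ y := hΦ.self_of_nhds.continuousAt
  have hGe : ∀ᶠ x in 𝓝 y, IsMetricPoint G (Φ x) := hΦc.eventually hG
  have hP : ∀ᶠ x in 𝓝 y, ContDiffAt ℝ ∞ P x := by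
    filter_upwards [hΦ] with x hx using hx.fderiv_right (by simp)
  have hg : ∀ᶠ x in 𝓝 y, ContDiffAt ℝ ∞ g x := by
    filter_upwards [hΦ, hGe] with x hx hx' using hx'.smooth.comp x hx
  set G'' := fun x => (g x).bilinearComp (P x) (P x) with hG''def
  have hG'' : ∀ᶠ x in 𝓝 y, IsMetricPoint G'' x := by
    filter_upwards [hP, hg, hGe, hinj] with x h1 h2 h3 h4
    exact IsMetricPoint.bilinearComp h2 h1 h3.symm h3.pos h4
  have hG' : ∀ᶠ x in 𝓝 y, IsMetricPoint G' x := by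
    filter_upwards [hG'', h.eventuallyEq_nhds] with x hx hx' using hx.congr hx'
  rw [scalarCurvatureOn_congr h hG']
  -- The frame `P = dΦ` has a symmetric derivative, so its curl terms vanish and the connection form
  -- is the pulled-back Christoffel map of `G`.
  have hgauge : ∀ᶠ x in 𝓝 y, ∀ v w, P x (christoffelMap G'' x v w) =
      fderiv ℝ P x v w + christoffelMap G (Φ x) (P x v) (P x w) := by
    filter_upwards [hP, hg, hGe, hinj, hΦ] with x h1 h2 h3 h4 h5 v w
    have hsurj : Function.Surjective (P x) :=
      LinearMap.injective_iff_surjective (f := (P x : V →ₗ[ℝ] V)).1 h4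
    refine h3.ext_of_apply fun z' => ?_
    obtain ⟨z, rfl⟩ := hsurj z'
    have hsym : ∀ a b, fderiv ℝ P x a b = fderiv ℝ P x b a :=
      fun a b => (h5.isSymmSndFDerivAt minSmoothness_two_le_infty).eq a b
    have hd : ∀ a, fderiv ℝ g x a = fderiv ℝ G (Φ x) (P x a) := by
      intro a
      rw [hgdef, fderiv_fun_comp x h3.differentiableAt (h5.differentiableAt (by simp))]
      rfl
    have := apply_christoffelMap_bilinearComp h2 h1 h3.symm h3.pos h4 v w z
    rw [show g x = G (Φ x) from rfl] at this
    rw [this, map_add, map_add, add_apply, add_apply, h3.apply_christoffelMap, hsym w v, hsym z v,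
      hsym z w, hd, hd, hd, sub_self, sub_self, map_zero, map_zero]
    ring
  have hΓ'' : DifferentiableAt ℝ (christoffelMap G'') y :=
    hG''.self_of_nhds.contDiffAt_christoffelMap.differentiableAt (by simp)
  have hΓ : DifferentiableAt ℝ (christoffelMap G) (Φ y) :=
    hG.self_of_nhds.contDiffAt_christoffelMap.differentiableAt (by simp)
  have hΦd : DifferentiableAt ℝ Φ y := hΦ.self_of_nhds.differentiableAt (by simp)
  have hPd : DifferentiableAt ℝ P y := hP.self_of_nhds.differentiableAt (by simp)
  have hΓΦ : DifferentiableAt ℝ (fun x => christoffelMap G (Φ x)) y := hΓ.comp y hΦd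
  have hA : ∀ v, DifferentiableAt ℝ (fun x => christoffelMap G (Φ x) (P x v)) y := fun v =>
    hΓΦ.clm_apply (hPd.clm_apply (differentiableAt_const v))
  have hR := apply_connectionCurvature_of_gauge (A := fun x u => christoffelMap G (Φ x) (P x u))
    hΓ'' hP.self_of_nhds hA hgauge
  have hR' : ∀ u v w, P y (connectionCurvature (christoffelMap G'') y u v w) =
      connectionCurvature (christoffelMap G) (Φ y) (P y u) (P y v) (P y w) := by
    intro u v w
    have hsym : fderiv ℝ P y u v = fderiv ℝ P y v u := (hΦ.self_of_nhds.isSymmSndFDerivAt minSmoothness_two_le_infty).eq u v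
    -- The summand containing the second derivative of `Φ` is symmetric in `u, v` and drops out of
    -- the curvature.
    have hder : ∀ u v, fderiv ℝ (fun x => christoffelMap G (Φ x) (P x v)) y u =
        fderiv ℝ (christoffelMap G) (Φ y) (P y u) (P y v)
          + christoffelMap G (Φ y) (fderiv ℝ P y u v) := by
      intro u v
      rw [fderiv_clm_apply hΓΦ (hPd.clm_apply (differentiableAt_const v)),
        fderiv_fun_comp y hΓ hΦd]
      simp only [add_apply, ContinuousLinearMap.comp_apply, ContinuousLinearMap.flip_apply,
        hPd.fderiv_clm_apply_const]
      rw [add_comm]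
    rw [hR, hder, hder, hsym]
    simp only [connectionCurvature, add_apply, sub_apply, ContinuousLinearMap.comp_apply]
    abel
  obtain ⟨e, he⟩ := exists_orthonormal_basis hG''.self_of_nhds.symm hG''.self_of_nhds.pos rfl
  let L : V ≃ₗ[ℝ] V := LinearEquiv.ofInjectiveEndo (P y : V →ₗ[ℝ] V) hinj.self_of_nhds
  have hL : ∀ v, L v = P y v := fun v => rfl
  rw [scalarCurvatureOn_eq_sum hG'' e he, scalarCurvatureOn_eq_sum hG (e.map L) fun i j => by
    simp only [Module.Basis.map_apply, hL]; exact he i j]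
  simp only [Module.Basis.map_apply, hL, ← hR']
  rfl

end GaugeChange

/-! ### Curvature of a bundle metric in a chart -/

section KaluzaKlein

open scoped Topology
open ContinuousLinearMap (fst snd compL)

set_option maxSynthPendingDepth 3

variable {E W : Type*} [NormedAddCommGroup E] [NormedSpace ℝ E]
  [NormedAddCommGroup W] [NormedSpace ℝ W]

/-- The exterior derivative of a vector-valued 1-form on a vector space. -/
noncomputable def oneFormCurl (α : E → E →L[ℝ] W) (x : E) : E →L[ℝ] E →L[ℝ] W :=
  fderiv ℝ α x - (fderiv ℝ α x).flip

theorem oneFormCurl_apply (α : E → E →L[ℝ] W) (x u v : E) :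
    oneFormCurl α x u v = fderiv ℝ α x u v - fderiv ℝ α x v u := by
  simp [oneFormCurl]

theorem contDiffAt_oneFormCurl {α : E → E →L[ℝ] W} {x : E} (hα : ContDiffAt ℝ ∞ α x) :
    ContDiffAt ℝ ∞ (oneFormCurl α) x := by
  have h : ContDiffAt ℝ ∞ (fderiv ℝ α) x := hα.fderiv_right (by simp)
  exact h.sub ((ContinuousLinearMap.flipₗᵢ ℝ E E W).contDiff.contDiffAt.comp x h)

/-- The field of endomorphisms dual to the curvature `dα`: `h(B(a, w), b) = k(w, dα(a, b))`. -/
noncomputable def curlDual (h : E → E →L[ℝ] E →L[ℝ] ℝ) (k : W →L[ℝ] W →L[ℝ] ℝ)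
    (α : E → E →L[ℝ] W) (x : E) : E →L[ℝ] W →L[ℝ] E :=
  (compL ℝ W (E →L[ℝ] ℝ) E (ContinuousLinearMap.inverse (h x))) ∘L
    ((compL ℝ W (W →L[ℝ] ℝ) (E →L[ℝ] ℝ)).flip k) ∘L (compL ℝ E W ℝ).flip ∘L oneFormCurl α x

theorem curlDual_apply (h : E → E →L[ℝ] E →L[ℝ] ℝ) (k : W →L[ℝ] W →L[ℝ] ℝ)
    (α : E → E →L[ℝ] W) (x a : E) (w : W) :
    curlDual h k α x a w = ContinuousLinearMap.inverse (h x) (k w ∘L oneFormCurl α x a) := rfl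

/-- The coframe `ξ ↦ (dπ ξ, ω ξ)` of the bundle metric. -/
noncomputable def bundleFrame (α : E → E →L[ℝ] W) (θ : W → W →L[ℝ] W) (x : E × W) :
    E × W →L[ℝ] E × W :=
  (fst ℝ E W).prod (α x.1 ∘L fst ℝ E W + θ x.2 ∘L snd ℝ E W)

theorem bundleFrame_apply (α : E → E →L[ℝ] W) (θ : W → W →L[ℝ] W) (x v : E × W) :
    bundleFrame α θ x v = (v.1, α x.1 v.1 + θ x.2 v.2) := rfl

/-- The direct sum of the scalar products `h x` and `k`. -/
noncomputable def sumMetric (h : E → E →L[ℝ] E →L[ℝ] ℝ) (k : W →L[ℝ] W →L[ℝ] ℝ) (x : E × W) :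
    E × W →L[ℝ] E × W →L[ℝ] ℝ :=
  (h x.1).bilinearComp (fst ℝ E W) (fst ℝ E W) + k.bilinearComp (snd ℝ E W) (snd ℝ E W)

theorem sumMetric_apply (h : E → E →L[ℝ] E →L[ℝ] ℝ) (k : W →L[ℝ] W →L[ℝ] ℝ) (x u v : E × W) :
    sumMetric h k x u v = h x.1 u.1 v.1 + k u.2 v.2 := rfl

/-- The connection form of the bundle metric in the frame `bundleFrame`. -/
noncomputable def bundleConnection (h : E → E →L[ℝ] E →L[ℝ] ℝ) (k : W →L[ℝ] W →L[ℝ] ℝ)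
    (α : E → E →L[ℝ] W) (θ : W → W →L[ℝ] W) (x v : E × W) : E × W →L[ℝ] E × W :=
  (christoffelMap h x.1 v.1 ∘L fst ℝ E W + (1 / 2 : ℝ) • (curlDual h k α x.1 v.1 ∘L snd ℝ E W)
    + (1 / 2 : ℝ) • ((curlDual h k α x.1).flip (bundleFrame α θ x v).2 ∘L fst ℝ E W)).prod
  (-(1 / 2 : ℝ) • (oneFormCurl α x.1 v.1 ∘L fst ℝ E W))

theorem bundleConnection_apply (h : E → E →L[ℝ] E →L[ℝ] ℝ) (k : W →L[ℝ] W →L[ℝ] ℝ)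
    (α : E → E →L[ℝ] W) (θ : W → W →L[ℝ] W) (x v s : E × W) :
    bundleConnection h k α θ x v s =
      (christoffelMap h x.1 v.1 s.1 + (1 / 2 : ℝ) • curlDual h k α x.1 v.1 s.2
        + (1 / 2 : ℝ) • curlDual h k α x.1 s.1 (bundleFrame α θ x v).2,
      -(1 / 2 : ℝ) • oneFormCurl α x.1 v.1 s.1) := rfl

theorem sum_sq_of_orthonormal {κ : Type*} [Fintype κ] [DecidableEq κ] {b : E →L[ℝ] E →L[ℝ] ℝ}
    (e : Module.Basis κ ℝ E) (he : ∀ i j, b (e i) (e j) = if i = j then 1 else 0) (x : E) :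
    ∑ i, b x (e i) ^ 2 = b x x := by
  have hx : ∀ i, b x (e i) = e.repr x i := by
    intro i
    conv_lhs => rw [← e.sum_repr x]
    simp [he, -Module.Basis.sum_repr]
  have : b x x = ∑ i, e.repr x i * b x (e i) := by
    calc b x x = b x (∑ i, e.repr x i • e i) := by rw [e.sum_repr]
      _ = _ := by simp only [map_sum, map_smul, smul_eq_mul]
  rw [this]
  exact Finset.sum_congr rfl fun i _ => by rw [hx, sq]

/-- The local data of a bundle metric at the point `x`. -/
structure IsBundlePoint (h : E → E →L[ℝ] E →L[ℝ] ℝ) (k : W →L[ℝ] W →L[ℝ] ℝ)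
    (α : E → E →L[ℝ] W) (θ : W → W →L[ℝ] W) (x : E × W) : Prop where
  base : IsMetricPoint h x.1
  symm : ∀ a b, k a b = k b a
  pos : ∀ a, a ≠ 0 → 0 < k a a
  smooth_form : ContDiffAt ℝ ∞ α x.1
  smooth_fiber : ContDiffAt ℝ ∞ θ x.2
  injective_fiber : Function.Injective (θ x.2)
  closed_fiber : ∀ a b, fderiv ℝ θ x.2 a b = fderiv ℝ θ x.2 b a

namespace IsBundlePoint

variable {h : E → E →L[ℝ] E →L[ℝ] ℝ} {k : W →L[ℝ] W →L[ℝ] ℝ}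
  {α : E → E →L[ℝ] W} {θ : W → W →L[ℝ] W} {x : E × W}

theorem sumMetric_symm (hx : IsBundlePoint h k α θ x) (a b : E × W) :
    sumMetric h k x a b = sumMetric h k x b a := by
  rw [sumMetric_apply, sumMetric_apply, hx.base.symm, hx.symm]

theorem sumMetric_pos (hx : IsBundlePoint h k α θ x) (a : E × W) (ha : a ≠ 0) :
    0 < sumMetric h k x a a := by
  rw [sumMetric_apply]
  by_cases h1 : a.1 = 0
  · have h2 : a.2 ≠ 0 := fun h2 => ha (Prod.ext h1 h2)
    simpa [h1] using hx.pos _ h2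
  · have h3 := hx.base.pos _ h1
    by_cases h2 : a.2 = 0
    · simpa [h2] using h3
    · exact add_pos h3 (hx.pos _ h2)

theorem injective_bundleFrame (hx : IsBundlePoint h k α θ x) :
    Function.Injective (bundleFrame α θ x) := by
  intro u v huv
  rw [bundleFrame_apply, bundleFrame_apply, Prod.mk.injEq] at huv
  obtain ⟨h1, h2⟩ := huv
  rw [h1, add_right_inj] at h2
  exact Prod.ext h1 (hx.injective_fiber h2)

theorem hasFDerivAt_bundleFrame_apply (hx : IsBundlePoint h k α θ x) (v : E × W) :
    HasFDerivAt (fun y => bundleFrame α θ y v)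
      ((0 : E × W →L[ℝ] E).prod
        ((fderiv ℝ α x.1).flip v.1 ∘L fst ℝ E W + (fderiv ℝ θ x.2).flip v.2 ∘L snd ℝ E W)) x := by
  have hα := (hx.smooth_form.differentiableAt (by simp)).hasFDerivAt.comp x
    (hasFDerivAt_fst (𝕜 := ℝ) (E := E) (F := W) (p := x))
  have hθ := (hx.smooth_fiber.differentiableAt (by simp)).hasFDerivAt.comp x
    (hasFDerivAt_snd (𝕜 := ℝ) (E := E) (F := W) (p := x))
  refine ((hasFDerivAt_const v.1 x).prodMk ((hα.clm_apply (hasFDerivAt_const v.1 x)).add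
    (hθ.clm_apply (hasFDerivAt_const v.2 x)))).congr_fderiv ?_
  ext <;> simp

variable [FiniteDimensional ℝ E]

theorem apply_curlDual (hx : IsBundlePoint h k α θ x) (a b : E) (w : W) :
    h x.1 (curlDual h k α x.1 a w) b = k w (oneFormCurl α x.1 a b) := by
  rw [curlDual_apply, hx.base.apply_inverse]
  rfl

variable [FiniteDimensional ℝ W]

theorem contDiffAt_curlDual (hx : IsBundlePoint h k α θ x) :
    ContDiffAt ℝ ∞ (curlDual h k α) x.1 := by
  refine contDiffAt_clm_apply fun a => contDiffAt_clm_apply fun w => ?_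
  simp only [curlDual_apply]
  have h1 := hx.base.contDiffAt_inverse
  have h2 := contDiffAt_oneFormCurl hx.smooth_form
  exact h1.clm_apply (contDiffAt_const.clm_comp (h2.clm_apply contDiffAt_const))

theorem contDiffAt_sumMetric (hx : IsBundlePoint h k α θ x) :
    ContDiffAt ℝ ∞ (sumMetric h k) x := by
  refine contDiffAt_clm_apply fun a => contDiffAt_clm_apply fun w => ?_
  simp only [sumMetric_apply]
  have h1 : ContDiffAt ℝ ∞ (fun y : E × W => h y.1) x := hx.base.smooth.comp x contDiffAt_fst
  exact ((h1.clm_apply contDiffAt_const).clm_apply contDiffAt_const).add contDiffAt_const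

theorem contDiffAt_bundleFrame (hx : IsBundlePoint h k α θ x) :
    ContDiffAt ℝ ∞ (bundleFrame α θ) x := by
  refine contDiffAt_clm_apply fun v => ?_
  simp only [bundleFrame_apply]
  have h1 : ContDiffAt ℝ ∞ (fun y : E × W => α y.1) x := hx.smooth_form.comp x contDiffAt_fst
  have h2 : ContDiffAt ℝ ∞ (fun y : E × W => θ y.2) x := hx.smooth_fiber.comp x contDiffAt_snd
  exact contDiffAt_const.prodMk ((h1.clm_apply contDiffAt_const).add (h2.clm_apply contDiffAt_const))

theorem fderiv_bundleFrame (hx : IsBundlePoint h k α θ x) (u v : E × W) :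
    fderiv ℝ (bundleFrame α θ) x u v = (0, fderiv ℝ α x.1 u.1 v.1 + fderiv ℝ θ x.2 u.2 v.2) := by
  rw [← (hx.contDiffAt_bundleFrame.differentiableAt (by simp)).fderiv_clm_apply_const,
    (hx.hasFDerivAt_bundleFrame_apply v).fderiv]
  simp

/-- The fiber form `θ` is closed and `dπ` is constant, so the exterior derivative of the coframe is
just the curvature `dα` of the bundle. -/
theorem fderiv_bundleFrame_sub (hx : IsBundlePoint h k α θ x) (u v : E × W) :
    fderiv ℝ (bundleFrame α θ) x u v - fderiv ℝ (bundleFrame α θ) x v u =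
      (0, oneFormCurl α x.1 u.1 v.1) := by
  rw [hx.fderiv_bundleFrame, hx.fderiv_bundleFrame, hx.closed_fiber u.2, oneFormCurl_apply]
  simp

theorem fderiv_sumMetric (hx : IsBundlePoint h k α θ x) (u a b : E × W) :
    fderiv ℝ (sumMetric h k) x u a b = fderiv ℝ h x.1 u.1 a.1 b.1 := by
  have hd := hx.contDiffAt_sumMetric.differentiableAt (by simp)
  rw [← hd.fderiv_clm_apply_const,
    ← (hd.clm_apply (differentiableAt_const a)).fderiv_clm_apply_const]
  have hh := hx.base.differentiableAt.hasFDerivAt.comp x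
    (hasFDerivAt_fst (𝕜 := ℝ) (E := E) (F := W) (p := x))
  have := (((hh.clm_apply (hasFDerivAt_const a.1 x)).clm_apply (hasFDerivAt_const b.1 x)).add_const
    (k a.2 b.2)).fderiv
  simp only [sumMetric_apply]
  simp only [Function.comp_apply] at this
  rw [this]
  simp

/-- Everything in `bundleConnection` is pulled back from the base except the factor `bundleFrame`,
whose derivative is the last term of the first component. -/
theorem fderiv_bundleConnection_apply (hx : IsBundlePoint h k α θ x) (u v s : E × W) :
    fderiv ℝ (fun y => bundleConnection h k α θ y v s) x u =
      (fderiv ℝ (christoffelMap h) x.1 u.1 v.1 s.1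
        + (1 / 2 : ℝ) • fderiv ℝ (curlDual h k α) x.1 u.1 v.1 s.2
        + (1 / 2 : ℝ) • (fderiv ℝ (curlDual h k α) x.1 u.1 s.1 (bundleFrame α θ x v).2
          + curlDual h k α x.1 s.1 (fderiv ℝ (bundleFrame α θ) x u v).2),
      -(1 / 2 : ℝ) • fderiv ℝ (oneFormCurl α) x.1 u.1 v.1 s.1) := by
  have hf := hasFDerivAt_fst (𝕜 := ℝ) (E := E) (F := W) (p := x)
  have hC := (hx.base.contDiffAt_christoffelMap.differentiableAt (by simp)).hasFDerivAt.comp x hf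
  have hB := (hx.contDiffAt_curlDual.differentiableAt (by simp)).hasFDerivAt.comp x hf
  have hΩ := ((contDiffAt_oneFormCurl hx.smooth_form).differentiableAt (by simp)).hasFDerivAt.comp
    x hf
  have hP := (hx.hasFDerivAt_bundleFrame_apply v).snd
  have key := (((hC.clm_apply (hasFDerivAt_const v.1 x)).clm_apply (hasFDerivAt_const s.1 x)).add
    (((hB.clm_apply (hasFDerivAt_const v.1 x)).clm_apply
      (hasFDerivAt_const s.2 x)).const_smul (1 / 2 : ℝ))).add
    (((hB.clm_apply (hasFDerivAt_const s.1 x)).clm_apply hP).const_smul (1 / 2 : ℝ)) |>.prodMk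
    (((hΩ.clm_apply (hasFDerivAt_const v.1 x)).clm_apply
      (hasFDerivAt_const s.1 x)).const_smul (-(1 / 2) : ℝ))
  have e := key.fderiv
  simp only [bundleConnection_apply]
  refine (DFunLike.congr_fun e u).trans ?_
  rw [hx.fderiv_bundleFrame]
  ext <;> simp [add_comm]

theorem differentiableAt_bundleConnection (hx : IsBundlePoint h k α θ x) (v : E × W) :
    DifferentiableAt ℝ (fun y => bundleConnection h k α θ y v) x := by
  refine (contDiffAt_clm_apply fun s => ?_ : ContDiffAt ℝ ∞ _ x).differentiableAt (by simp)
  simp only [bundleConnection_apply]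
  have hC : ContDiffAt ℝ ∞ (fun y : E × W => christoffelMap h y.1) x :=
    hx.base.contDiffAt_christoffelMap.comp x contDiffAt_fst
  have hB : ContDiffAt ℝ ∞ (fun y : E × W => curlDual h k α y.1) x :=
    hx.contDiffAt_curlDual.comp x contDiffAt_fst
  have hΩ : ContDiffAt ℝ ∞ (fun y : E × W => oneFormCurl α y.1) x :=
    (contDiffAt_oneFormCurl hx.smooth_form).comp x contDiffAt_fst
  have hP := (hx.contDiffAt_bundleFrame.clm_apply (contDiffAt_const (c := v))).snd
  exact (((hC.clm_apply contDiffAt_const).clm_apply contDiffAt_const).add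
    (((hB.clm_apply contDiffAt_const).clm_apply contDiffAt_const).const_smul _)).add
    (((hB.clm_apply contDiffAt_const).clm_apply hP).const_smul _) |>.prodMk
    (((hΩ.clm_apply contDiffAt_const).clm_apply contDiffAt_const).const_smul _)

/-- Koszul's formula only gives scalar products with the Christoffel vector, so the connection form
is verified by pairing with frame vectors. The derivative of `h` yields the Levi-Civita connection
of the base, and each curl term is converted by duality into a `curlDual` or `oneFormCurl` term. -/
theorem bundleFrame_christoffelMap (hx : IsBundlePoint h k α θ x) (u v : E × W) :
    bundleFrame α θ x (christoffelMap (fun y => (sumMetric h k y).bilinearComp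
      (bundleFrame α θ y) (bundleFrame α θ y)) x u v) =
      fderiv ℝ (bundleFrame α θ) x u v + bundleConnection h k α θ x u (bundleFrame α θ x v) := by
  have hsurj : Function.Surjective (bundleFrame α θ x) :=
    LinearMap.injective_iff_surjective (f := (bundleFrame α θ x : E × W →ₗ[ℝ] E × W)).1
      hx.injective_bundleFrame
  by_contra hne
  -- The difference of the two sides is a frame vector by surjectivity; its scalar product with
  -- itself turns out to be zero.
  have hpos := hx.sumMetric_pos _ (sub_ne_zero.2 hne)
  obtain ⟨w, hw⟩ := hsurj (bundleFrame α θ x (christoffelMap (fun y => (sumMetric h k y).bilinearComp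
      (bundleFrame α θ y) (bundleFrame α θ y)) x u v) - (fderiv ℝ (bundleFrame α θ) x u v +
        bundleConnection h k α θ x u (bundleFrame α θ x v)))
  rw [← hw] at hpos
  refine hpos.ne' ?_
  conv_lhs => enter [1]; rw [hw]
  rw [map_sub, sub_apply, sub_eq_zero, apply_christoffelMap_bilinearComp hx.contDiffAt_sumMetric
    hx.contDiffAt_bundleFrame hx.sumMetric_symm hx.sumMetric_pos hx.injective_bundleFrame]
  rw [hx.fderiv_bundleFrame_sub, hx.fderiv_bundleFrame_sub, hx.fderiv_sumMetric,
    hx.fderiv_sumMetric, hx.fderiv_sumMetric, hx.fderiv_bundleFrame, hx.fderiv_bundleFrame]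
  simp only [sumMetric_apply, bundleConnection_apply, map_add, map_smul,
    add_apply, smul_apply, smul_eq_mul, hx.base.apply_christoffelMap, hx.apply_curlDual, map_zero,
    zero_apply]
  have hfst : ∀ a, (bundleFrame α θ x a).1 = a.1 := fun a => rfl
  simp only [hfst]
  rw [oneFormCurl_apply α x.1 u.1 v.1, hx.closed_fiber u.2, map_sub, sub_apply]
  ring

theorem isMetricPoint (hx : IsBundlePoint h k α θ x) :
    IsMetricPoint (fun y => (sumMetric h k y).bilinearComp
      (bundleFrame α θ y) (bundleFrame α θ y)) x :=
  IsMetricPoint.bilinearComp hx.contDiffAt_sumMetric hx.contDiffAt_bundleFrame hx.sumMetric_symm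
    hx.sumMetric_pos hx.injective_bundleFrame

theorem bundleFrame_connectionCurvature (hx : ∀ᶠ y in 𝓝 x, IsBundlePoint h k α θ y)
    (u v w : E × W) :
    bundleFrame α θ x (connectionCurvature (christoffelMap (fun y =>
      (sumMetric h k y).bilinearComp (bundleFrame α θ y) (bundleFrame α θ y))) x u v w) =
      fderiv ℝ (fun y => bundleConnection h k α θ y v (bundleFrame α θ x w)) x u
        - fderiv ℝ (fun y => bundleConnection h k α θ y u (bundleFrame α θ x w)) x v
        + bundleConnection h k α θ x u (bundleConnection h k α θ x v (bundleFrame α θ x w))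
        - bundleConnection h k α θ x v (bundleConnection h k α θ x u (bundleFrame α θ x w)) := by
  have h0 := hx.self_of_nhds
  rw [apply_connectionCurvature_of_gauge (A := bundleConnection h k α θ)
    (h0.isMetricPoint.contDiffAt_christoffelMap.differentiableAt (by simp))
    h0.contDiffAt_bundleFrame h0.differentiableAt_bundleConnection
    (hx.mono fun y hy => hy.bundleFrame_christoffelMap),
    (h0.differentiableAt_bundleConnection v).fderiv_clm_apply_const,
    (h0.differentiableAt_bundleConnection u).fderiv_clm_apply_const]

/-- The scalar curvature of a bundle metric with flat totally geodesic fibers. -/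
theorem scalarCurvatureOn_bundle (hx : ∀ᶠ y in 𝓝 x, IsBundlePoint h k α θ y)
    {ι : Type*} [Fintype ι] [DecidableEq ι] (f : Module.Basis ι ℝ E)
    (hf : ∀ i j, h x.1 (f i) (f j) = if i = j then 1 else 0) :
    scalarCurvatureOn (fun y =>
      (sumMetric h k y).bilinearComp (bundleFrame α θ y) (bundleFrame α θ y)) x =
      scalarCurvatureOn h x.1 - 1 / 4 * ∑ i, ∑ j,
        k (oneFormCurl α x.1 (f i) (f j)) (oneFormCurl α x.1 (f i) (f j)) := by
  have h0 := hx.self_of_nhds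
  have hbase : ∀ᶠ y in 𝓝 x.1, IsMetricPoint h y := by
    have hc : ContinuousAt (fun a : E => (a, x.2)) x.1 := by fun_prop
    exact (hc.eventually hx).mono fun y hy => hy.base
  obtain ⟨w, hw⟩ := exists_orthonormal_basis h0.symm h0.pos rfl
  let L : (E × W) ≃ₗ[ℝ] (E × W) := LinearEquiv.ofInjectiveEndo
    (bundleFrame α θ x : E × W →ₗ[ℝ] E × W) h0.injective_bundleFrame
  -- Chosen so that the coframe maps `e` to the product basis; the gauge formula for the curvature
  -- sees mostly these images.
  let e := (f.prod w).map L.symm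
  have hPe : ∀ i, bundleFrame α θ x (e i) = f.prod w i := fun i => L.apply_symm_apply _
  have hl : ∀ i, f.prod w (Sum.inl i) = (f i, 0) := fun i => by simp [Module.Basis.prod_apply]
  have hr : ∀ i, f.prod w (Sum.inr i) = (0, w i) := fun i => by simp [Module.Basis.prod_apply]
  have he : ∀ i j, (sumMetric h k x).bilinearComp (bundleFrame α θ x) (bundleFrame α θ x)
      (e i) (e j) = if i = j then 1 else 0 := by
    intro i j
    rw [ContinuousLinearMap.bilinearComp_apply, hPe, hPe, sumMetric_apply]
    rcases i with i | i <;> rcases j with j | j <;> simp [hl, hr, hf, hw]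
  have hfst : ∀ a, (bundleFrame α θ x a).1 = a.1 := fun a => rfl
  have hcurl : ∀ a, oneFormCurl α x.1 a a = 0 := fun a => by simp [oneFormCurl_apply]
  have hneg : ∀ a b, oneFormCurl α x.1 a b = - oneFormCurl α x.1 b a := fun a b => by
    simp [oneFormCurl_apply]
  have he1 : ∀ i, (e i).1 = (f.prod w i).1 := fun i => by rw [← hfst, hPe]
  have hsub : ∀ u v, (fderiv ℝ (bundleFrame α θ) x u v).2 - (fderiv ℝ (bundleFrame α θ) x v u).2 =
      oneFormCurl α x.1 u.1 v.1 := fun u v => by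
    rw [← Prod.snd_sub, h0.fderiv_bundleFrame_sub]
  rw [scalarCurvatureOn_eq_sum (hx.mono fun y hy => hy.isMetricPoint) e he,
    scalarCurvatureOn_eq_sum hbase f hf]
  simp only [ContinuousLinearMap.bilinearComp_apply, bundleFrame_connectionCurvature hx, hPe,
    h0.fderiv_bundleConnection_apply, Fintype.sum_sum_type]
  simp only [he1, hl, hr, bundleConnection_apply, hPe, sumMetric_apply]
  set F : ι → ι → W := fun i j => (fderiv ℝ (bundleFrame α θ) x (e (Sum.inl i)) (e (Sum.inl j))).2
    with hF
  have hFij : ∀ i j, (fderiv ℝ (bundleFrame α θ) x (e (Sum.inl i)) (e (Sum.inl j))).2 = F i j :=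
    fun _ _ => rfl
  set Q : ι → Fin (Module.finrank ℝ W) → ℝ := fun i m =>
    h x.1 (curlDual h k α x.1 (f i) (w m)) (curlDual h k α x.1 (f i) (w m)) with hQ
  set q : ι → ι → ℝ := fun i j =>
    k (oneFormCurl α x.1 (f i) (f j)) (oneFormCurl α x.1 (f i) (f j)) with hq
  -- By Parseval in each factor, both sides are the sum of `k(w_m, dα(f_i, f_j))²` over `j` and `m`.
  have hQsum : ∀ i, ∑ m, Q i m = ∑ j, q i j := by
    intro i
    simp only [hQ, hq, ← sum_sq_of_orthonormal f hf, ← sum_sq_of_orthonormal w hw,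
      h0.apply_curlDual]
    rw [Finset.sum_comm]
    simp only [h0.symm (w _)]
  have hq1 : ∀ i j, k (oneFormCurl α x.1 (f i) (f j)) (oneFormCurl α x.1 (f j) (f i)) = - q i j :=
    fun i j => by rw [hneg (f j), map_neg]
  have hQ1 : ∀ i m, k (oneFormCurl α x.1 (f i) (curlDual h k α x.1 (f i) (w m))) (w m) = Q i m :=
    fun i m => by rw [h0.symm, ← h0.apply_curlDual]
  have hQ2 : ∀ i m, k (w m) (oneFormCurl α x.1 (curlDual h k α x.1 (f i) (w m)) (f i)) = - Q i m :=
    fun i m => by rw [hneg, map_neg, ← h0.apply_curlDual]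
  -- `F` depends on the coframe and not only on `dα`, but it enters the sum only through its
  -- antisymmetric part, which is `dα`.
  have hEE : ∑ j, ∑ i, k (F i j) (oneFormCurl α x.1 (f j) (f i)) -
      ∑ j, ∑ i, k (F j i) (oneFormCurl α x.1 (f j) (f i)) = - ∑ j, ∑ i, q i j := by
    simp only [← Finset.sum_sub_distrib, ← Finset.sum_neg_distrib]
    refine Finset.sum_congr rfl fun j _ => Finset.sum_congr rfl fun i _ => ?_
    rw [← sub_apply, ← map_sub, hsub, he1, he1, hl, hl, hq1]
  have hsum : ∑ m, ∑ i, Q i m = ∑ i, ∑ j, q i j := by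
    rw [Finset.sum_comm]; exact Finset.sum_congr rfl fun i _ => hQsum i
  have hqc : ∑ j, ∑ i, q i j = ∑ i, ∑ j, q i j := Finset.sum_comm
  -- In units of the sum of all `|dα(f_i, f_j)|²`, horizontal pairs contribute `-3/4`, the two
  -- orders of mixed pairs `1/4` each, and vertical pairs nothing: in total `-1/4`.
  simp [hcurl, h0.apply_curlDual, hFij, hq1, hQ1, hQ2, connectionCurvature,
    Finset.sum_add_distrib, Finset.sum_sub_distrib, ← Finset.mul_sum, hQsum, hsum, hqc]
  linarith

end IsBundlePoint

end KaluzaKlein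

/-! ### Metrics and 1-forms in charts -/

section Charts

open scoped Topology

set_option maxSynthPendingDepth 3

set_option linter.unusedSectionVars false

variable {V : Type*} [NormedAddCommGroup V] [NormedSpace ℝ V]
  {B : Type*} [TopologicalSpace B] {I : ModelWithCorners ℝ V B} [I.Boundaryless]
  {M : Type*} [TopologicalSpace M] [ChartedSpace B M] [IsManifold I ∞ M]

theorem contMDiffAt_extChartAt_symm {x : M} {y : V} (hy : y ∈ (extChartAt I x).target) :
    ContMDiffAt 𝓘(ℝ, V) I ∞ (extChartAt I x).symm y :=
  (contMDiffOn_extChartAt_symm x).contMDiffAt ((isOpen_extChartAt_target x).mem_nhds hy)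

theorem mdifferentiableAt_extChartAt_symm {x : M} {y : V} (hy : y ∈ (extChartAt I x).target) :
    MDifferentiableAt 𝓘(ℝ, V) I (extChartAt I x).symm y :=
  (contMDiffAt_extChartAt_symm hy).mdifferentiableAt (by simp)

theorem injective_mfderiv_extChartAt_symm {x : M} {y : V} (hy : y ∈ (extChartAt I x).target) :
    Function.Injective (mfderiv 𝓘(ℝ, V) I (extChartAt I x).symm y) := by
  have h := isInvertible_mfderivWithin_extChartAt_symm (I := I) (x := x) hy
  rw [I.range_eq_univ, mfderivWithin_univ] at h
  obtain ⟨e, he⟩ := h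
  rw [← he]
  exact e.injective

/-- The coordinate vector fields are smooth. -/
theorem contMDiffOn_mfderiv_extChartAt_symm (x : M) (u : V) :
    ContMDiffOn 𝓘(ℝ, V) I.tangent ∞
      (fun y => TotalSpace.mk' V (E := fun p : M => TangentSpace I p) ((extChartAt I x).symm y)
        (mfderiv 𝓘(ℝ, V) I (extChartAt I x).symm y u)) (extChartAt I x).target := by
  have h := (contMDiffOn_extChartAt_symm (I := I) (n := ∞) x).contMDiffOn_tangentMapWithin (m := ∞)
    (by simp) (isOpen_extChartAt_target x).uniqueMDiffOn
  have hs : ContMDiff 𝓘(ℝ, V) 𝓘(ℝ, V).tangent ∞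
      (fun y : V => TotalSpace.mk' V (E := fun p : V => TangentSpace 𝓘(ℝ, V) p) y u) := by
    intro y
    rw [contMDiffAt_totalSpace]
    refine ⟨contMDiffAt_id, ?_⟩
    simpa using contMDiffAt_const
  have hc := h.comp hs.contMDiffOn (s := (extChartAt I x).target) fun y hy => hy
  refine hc.congr fun y hy => ?_
  simp only [Function.comp_apply, tangentMapWithin]
  rw [mfderivWithin_of_isOpen (isOpen_extChartAt_target x) hy]

/-- The expression of a 1-form in the preferred chart at `x`. -/
noncomputable def oneFormInChart (I : ModelWithCorners ℝ V B) {F : Type*} [NormedAddCommGroup F]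
    [NormedSpace ℝ F] (α : ∀ p : M, TangentSpace I p →L[ℝ] F) (x : M) (y : V) : V →L[ℝ] F :=
  let A : V →L[ℝ] V := mfderiv 𝓘(ℝ, V) I (extChartAt I x).symm y
  let a : V →L[ℝ] F := α ((extChartAt I x).symm y)
  a ∘L A

theorem oneFormInChart_apply {F : Type*} [NormedAddCommGroup F]
    [NormedSpace ℝ F] (α : ∀ p : M, TangentSpace I p →L[ℝ] F) (x : M) (y u : V) :
    oneFormInChart I α x y u = α ((extChartAt I x).symm y)
      (mfderiv 𝓘(ℝ, V) I (extChartAt I x).symm y u) := rfl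

/-- The metric `g` is smooth and positive definite in every preferred chart. -/
def IsMetricInCharts (I : ModelWithCorners ℝ V B)
    (g : ∀ p : M, TangentSpace I p →L[ℝ] TangentSpace I p →L[ℝ] ℝ) : Prop :=
  ∀ x : M, ∀ y ∈ (extChartAt I x).target, IsMetricPoint (inChart I g x) y

variable [FiniteDimensional ℝ V]

/-- A smooth section evaluated on the smooth coordinate vector fields gives smooth functions, and
testing on fixed vectors suffices. -/
theorem IsSmoothOneForm.contDiffAt_oneFormInChart {F : Type*} [NormedAddCommGroup F]
    [NormedSpace ℝ F] {α : ∀ p : M, TangentSpace I p →L[ℝ] F} (hα : IsSmoothOneForm I α) {x : M}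
    {y : V} (hy : y ∈ (extChartAt I x).target) :
    ContDiffAt ℝ ∞ (oneFormInChart I α x) y := by
  refine contDiffAt_clm_apply fun u => ?_
  have h1 : ContMDiffOn 𝓘(ℝ, V) (I.prod 𝓘(ℝ, F)) ∞
      (fun y => TotalSpace.mk' F (E := Bundle.Trivial M F) ((extChartAt I x).symm y)
        (α ((extChartAt I x).symm y) (mfderiv 𝓘(ℝ, V) I (extChartAt I x).symm y u)))
      (extChartAt I x).target :=
    ContMDiffOn.clm_bundle_apply (E₁ := fun p : M => TangentSpace I p) (F₁ := V)
      (hα.comp_contMDiffOn (contMDiffOn_extChartAt_symm x))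
      (contMDiffOn_mfderiv_extChartAt_symm x u)
  have h2 := (h1 y hy).contMDiffAt ((isOpen_extChartAt_target x).mem_nhds hy)
  rw [contMDiffAt_totalSpace] at h2
  exact h2.2.contDiffAt

theorem Bundle.ContMDiffRiemannianMetric.contDiffAt_inChart
    (h : ContMDiffRiemannianMetric I ∞ V (fun p : M => TangentSpace I p)) {x : M} {y : V}
    (hy : y ∈ (extChartAt I x).target) : ContDiffAt ℝ ∞ (inChart I h.inner x) y := by
  refine contDiffAt_clm_apply fun u => contDiffAt_clm_apply fun v => ?_
  have h1 := ContMDiffOn.clm_bundle_apply₂ (E₁ := fun p : M => TangentSpace I p) (F₁ := V)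
      (E₂ := fun p : M => TangentSpace I p) (F₂ := V) (E₃ := Bundle.Trivial M ℝ)
      (h.contMDiff.comp_contMDiffOn (contMDiffOn_extChartAt_symm x))
      (contMDiffOn_mfderiv_extChartAt_symm x u) (contMDiffOn_mfderiv_extChartAt_symm x v)
  have h2 := (h1 y hy).contMDiffAt ((isOpen_extChartAt_target x).mem_nhds hy)
  rw [contMDiffAt_totalSpace] at h2
  exact h2.2.contDiffAt

/-- From here on only the chart condition is used: `bundleMetric` is a bare field of forms, whose
smoothness is checked in charts. -/
theorem Bundle.ContMDiffRiemannianMetric.isMetricInCharts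
    (h : ContMDiffRiemannianMetric I ∞ V (fun p : M => TangentSpace I p)) :
    IsMetricInCharts I h.inner := by
  intro x y hy
  constructor
  · exact h.contDiffAt_inChart hy
  · intro u v
    rw [inChart_apply, inChart_apply]
    exact h.symm ((extChartAt I x).symm y) (mfderiv 𝓘(ℝ, V) I (extChartAt I x).symm y u)
      (mfderiv 𝓘(ℝ, V) I (extChartAt I x).symm y v)
  · intro v hv
    rw [inChart_apply]
    refine h.pos ((extChartAt I x).symm y) (mfderiv 𝓘(ℝ, V) I (extChartAt I x).symm y v) ?_
    intro h0
    exact hv (injective_mfderiv_extChartAt_symm hy (h0.trans (map_zero _).symm))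

end Charts

/-! ### Isometries in charts, chart independence of the scalar curvature -/

section Transition

open scoped Topology

set_option maxSynthPendingDepth 3

set_option linter.unusedSectionVars false

variable {V : Type*} [NormedAddCommGroup V] [NormedSpace ℝ V]
  {B : Type*} [TopologicalSpace B] {I : ModelWithCorners ℝ V B} [I.Boundaryless]
  {M : Type*} [TopologicalSpace M] [ChartedSpace B M] [IsManifold I ∞ M]
  {f : M ≃ₘ^∞⟮I, I⟯ M} {x x' : M} {y : V}

/-- The expression of a map in the preferred charts at `x` and `x'`. -/
noncomputable def mapInCharts (I : ModelWithCorners ℝ V B) (f : M → M) (x x' : M) : V → V :=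
  extChartAt I x' ∘ f ∘ (extChartAt I x).symm

theorem eventually_mapInCharts (hy : y ∈ (extChartAt I x).target)
    (hy' : f ((extChartAt I x).symm y) ∈ (extChartAt I x').source) :
    ∀ᶠ z in 𝓝 y, z ∈ (extChartAt I x).target ∧
      f ((extChartAt I x).symm z) ∈ (extChartAt I x').source := by
  have h1 : ContinuousAt (fun z => f ((extChartAt I x).symm z)) y :=
    f.continuous.continuousAt.comp (contMDiffAt_extChartAt_symm hy).continuousAt
  exact Filter.Eventually.and ((isOpen_extChartAt_target x).mem_nhds hy) <|
    h1.eventually ((isOpen_extChartAt_source x').mem_nhds hy')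

theorem contDiffAt_mapInCharts (hy : y ∈ (extChartAt I x).target)
    (hy' : f ((extChartAt I x).symm y) ∈ (extChartAt I x').source) :
    ContDiffAt ℝ ∞ (mapInCharts I f x x') y := by
  rw [extChartAt_source] at hy'
  have h := (contMDiffAt_extChartAt' (I := I) (n := ∞) hy').comp y
    ((f.contMDiff _).comp y (contMDiffAt_extChartAt_symm hy))
  exact h.contDiffAt

theorem extChartAt_symm_mapInCharts
    (hy' : f ((extChartAt I x).symm y) ∈ (extChartAt I x').source) :
    (extChartAt I x').symm (mapInCharts I f x x' y) = f ((extChartAt I x).symm y) :=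
  (extChartAt I x').left_inv hy'

theorem mapInCharts_mem_target
    (hy' : f ((extChartAt I x).symm y) ∈ (extChartAt I x').source) :
    mapInCharts I f x x' y ∈ (extChartAt I x').target :=
  (extChartAt I x').map_source hy'

/-- The chain rule applied to both sides of `φ'⁻¹ ∘ Φ = f ∘ φ⁻¹`, an identity valid near `y`. -/
theorem mfderiv_extChartAt_symm_mapInCharts (hy : y ∈ (extChartAt I x).target)
    (hy' : f ((extChartAt I x).symm y) ∈ (extChartAt I x').source) (u : V) :
    (mfderiv 𝓘(ℝ, V) I (extChartAt I x').symm (mapInCharts I f x x' y)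
      (fderiv ℝ (mapInCharts I f x x') y u) : V) =
    mfderiv I I f ((extChartAt I x).symm y) (mfderiv 𝓘(ℝ, V) I (extChartAt I x).symm y u) := by
  have hd : MDifferentiableAt 𝓘(ℝ, V) 𝓘(ℝ, V) (mapInCharts I f x x') y :=
    ((contDiffAt_mapInCharts hy hy').differentiableAt (by simp)).mdifferentiableAt
  have h1 := mfderiv_comp_apply y
    (mdifferentiableAt_extChartAt_symm (mapInCharts_mem_target hy')) hd u
  have h2 := mfderiv_comp_apply y ((f.contMDiff _).mdifferentiableAt (by simp) :
    MDifferentiableAt I I f ((extChartAt I x).symm y)) (mdifferentiableAt_extChartAt_symm hy) u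
  rw [mfderiv_eq_fderiv] at h1
  refine (h1.symm.trans ?_).trans h2
  have he : ((extChartAt I x').symm ∘ mapInCharts I f x x') =ᶠ[𝓝 y] (f ∘ (extChartAt I x).symm) := by
    filter_upwards [eventually_mapInCharts hy hy'] with z hz using extChartAt_symm_mapInCharts hz.2
  exact DFunLike.congr_fun (he.mfderiv_eq : (mfderiv 𝓘(ℝ, V) I _ y : V →L[ℝ] V) = _) u

theorem injective_fderiv_mapInCharts (hy : y ∈ (extChartAt I x).target)
    (hy' : f ((extChartAt I x).symm y) ∈ (extChartAt I x').source) :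
    Function.Injective (fderiv ℝ (mapInCharts I f x x') y) := by
  intro u v huv
  have hu := mfderiv_extChartAt_symm_mapInCharts hy hy' u
  have hv := mfderiv_extChartAt_symm_mapInCharts hy hy' v
  rw [huv, hv] at hu
  exact (injective_mfderiv_extChartAt_symm hy
    ((f.mfderivToContinuousLinearEquiv (by simp) ((extChartAt I x).symm y)).injective hu)).symm

theorem IsRiemannianIsometry.inChart_eq
    {g : ∀ p : M, TangentSpace I p →L[ℝ] TangentSpace I p →L[ℝ] ℝ}
    (hf : IsRiemannianIsometry I g f) (hy : y ∈ (extChartAt I x).target)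
    (hy' : f ((extChartAt I x).symm y) ∈ (extChartAt I x').source) :
    inChart I g x y = (inChart I g x' (mapInCharts I f x x' y)).bilinearComp
      (fderiv ℝ (mapInCharts I f x x') y) (fderiv ℝ (mapInCharts I f x x') y) := by
  -- With the dependence of the tangent space on the point forgotten, base point and vectors can be
  -- replaced independently.
  let b : M → V →L[ℝ] V →L[ℝ] ℝ := g
  ext u v
  have h1 := hf ((extChartAt I x).symm y) (mfderiv 𝓘(ℝ, V) I (extChartAt I x).symm y u)
    (mfderiv 𝓘(ℝ, V) I (extChartAt I x).symm y v)
  rw [inChart_apply, ← h1, ContinuousLinearMap.bilinearComp_apply, inChart_apply]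
  have key : ∀ (p q : M) (a a' c c' : V), p = q → a = a' → c = c' → b p a c = b q a' c' := by
    rintro p q a a' c c' rfl rfl rfl; rfl
  exact (key _ _ _ _ _ _ (extChartAt_symm_mapInCharts hy')
    (mfderiv_extChartAt_symm_mapInCharts hy hy' u)
    (mfderiv_extChartAt_symm_mapInCharts hy hy' v)).symm

theorem oneFormInChart_comp {F : Type*} [NormedAddCommGroup F]
    [NormedSpace ℝ F] {α α' : ∀ p : M, TangentSpace I p →L[ℝ] F}
    (hf : ∀ p X, α' p X = α (f p) (mfderiv I I f p X)) (hy : y ∈ (extChartAt I x).target)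
    (hy' : f ((extChartAt I x).symm y) ∈ (extChartAt I x').source) :
    oneFormInChart I α' x y = (oneFormInChart I α x' (mapInCharts I f x x' y)) ∘L
      (fderiv ℝ (mapInCharts I f x x') y) := by
  let b : M → V →L[ℝ] F := α
  ext u
  rw [oneFormInChart_apply, hf, ContinuousLinearMap.comp_apply, oneFormInChart_apply]
  have key : ∀ (p q : M) (a a' : V), p = q → a = a' → b p a = b q a' := by
    rintro p q a a' rfl rfl; rfl
  exact (key _ _ _ _ (extChartAt_symm_mapInCharts hy')
    (mfderiv_extChartAt_symm_mapInCharts hy hy' u)).symm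

/-- A change of charts is the identity map read in two charts; so each statement about an isometry
in arbitrary charts contains independence of the chart. -/
theorem isRiemannianIsometry_refl (g : ∀ p : M, TangentSpace I p →L[ℝ] TangentSpace I p →L[ℝ] ℝ) :
    IsRiemannianIsometry I g (Diffeomorph.refl I M ∞) := by
  intro p X Y
  have h : mfderiv I I (Diffeomorph.refl I M ∞) p = ContinuousLinearMap.id ℝ _ := mfderiv_id
  rw [h]
  rfl

theorem IsMetricInCharts.eventually
    {g : ∀ p : M, TangentSpace I p →L[ℝ] TangentSpace I p →L[ℝ] ℝ}
    (hg : IsMetricInCharts I g) (hy : y ∈ (extChartAt I x).target) :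
    ∀ᶠ z in 𝓝 y, IsMetricPoint (inChart I g x) z :=
  Filter.mem_of_superset ((isOpen_extChartAt_target x).mem_nhds hy) (hg x)

variable [FiniteDimensional ℝ V]

theorem IsRiemannianIsometry.scalarCurvatureOn_inChart
    {g : ∀ p : M, TangentSpace I p →L[ℝ] TangentSpace I p →L[ℝ] ℝ}
    (hf : IsRiemannianIsometry I g f) (hg : IsMetricInCharts I g)
    (hy : y ∈ (extChartAt I x).target)
    (hy' : f ((extChartAt I x).symm y) ∈ (extChartAt I x').source) :
    scalarCurvatureOn (inChart I g x) y =
      scalarCurvatureOn (inChart I g x') (mapInCharts I f x x' y) := by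
  have he := eventually_mapInCharts hy hy'
  exact scalarCurvatureOn_comp (hg.eventually (mapInCharts_mem_target hy'))
    (he.mono fun z hz => contDiffAt_mapInCharts hz.1 hz.2)
    (he.mono fun z hz => injective_fderiv_mapInCharts hz.1 hz.2)
    (he.mono fun z hz => hf.inChart_eq hz.1 hz.2)

theorem IsRiemannianIsometry.scalarCurvature_eq
    {g : ∀ p : M, TangentSpace I p →L[ℝ] TangentSpace I p →L[ℝ] ℝ}
    (hf : IsRiemannianIsometry I g f) (hg : IsMetricInCharts I g) {p : M}
    (hp : f p ∈ (extChartAt I x').source) :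
    scalarCurvature I g p = scalarCurvatureOn (inChart I g x') (extChartAt I x' (f p)) := by
  have hl : (extChartAt I p).symm (extChartAt I p p) = p := extChartAt_to_inv p
  have := hf.scalarCurvatureOn_inChart hg (mem_extChartAt_target p) (x' := x') (by rwa [hl])
  rw [mapInCharts, Function.comp_apply, Function.comp_apply, hl] at this
  exact this

theorem scalarCurvature_eq_scalarCurvatureOn
    {g : ∀ p : M, TangentSpace I p →L[ℝ] TangentSpace I p →L[ℝ] ℝ}
    (hg : IsMetricInCharts I g) {p : M} (hp : p ∈ (extChartAt I x').source) :
    scalarCurvature I g p = scalarCurvatureOn (inChart I g x') (extChartAt I x' p) :=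
  (isRiemannianIsometry_refl g).scalarCurvature_eq hg hp

theorem IsRiemannianIsometry.scalarCurvature_comp
    {g : ∀ p : M, TangentSpace I p →L[ℝ] TangentSpace I p →L[ℝ] ℝ}
    (hf : IsRiemannianIsometry I g f) (hg : IsMetricInCharts I g) (p : M) :
    scalarCurvature I g (f p) = scalarCurvature I g p :=
  (hf.scalarCurvature_eq hg (mem_extChartAt_source (f p))).symm

theorem continuousAt_scalarCurvatureOn {G : V → V →L[ℝ] V →L[ℝ] ℝ}
    (hG : ∀ᶠ z in 𝓝 y, IsMetricPoint G z) : ContinuousAt (scalarCurvatureOn G) y := by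
  have h0 := hG.self_of_nhds
  have hC := h0.contDiffAt_christoffelMap
  have hC' : ContinuousAt (fderiv ℝ (christoffelMap G)) y :=
    (hC.fderiv_right (m := ∞) (by simp)).continuousAt
  have hc := hC.continuousAt
  have hinv := h0.contDiffAt_inverse.continuousAt
  have key : ∀ u v (l : V →L[ℝ] ℝ), ContinuousAt (fun z =>
      connectionCurvature (christoffelMap G) z u v (ContinuousLinearMap.inverse (G z) l)) y := by
    intro u v l
    refine ContinuousAt.clm_apply ?_ (hinv.clm_apply continuousAt_const)
    exact ((((hC'.clm_apply continuousAt_const).clm_apply continuousAt_const).sub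
      ((hC'.clm_apply continuousAt_const).clm_apply continuousAt_const)).add
      ((hc.clm_apply continuousAt_const).clm_comp (hc.clm_apply continuousAt_const))).sub
      ((hc.clm_apply continuousAt_const).clm_comp (hc.clm_apply continuousAt_const))
  have : ContinuousAt (fun z => ∑ i, ∑ j, (Module.finBasis ℝ V).coord j
      (connectionCurvature (christoffelMap G) z (Module.finBasis ℝ V j) (Module.finBasis ℝ V i)
      (ContinuousLinearMap.inverse (G z)
      (LinearMap.toContinuousLinearMap ((Module.finBasis ℝ V).coord i))))) y := by
    refine tendsto_finsetSum _ fun i _ => tendsto_finsetSum _ fun j _ => ?_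
    exact (LinearMap.continuous_of_finiteDimensional _).continuousAt.comp (key _ _ _)
  refine this.congr ?_
  filter_upwards [hG.eventually_nhds] with z hz
  unfold scalarCurvatureOn ricci
  simp only [curvatureTensor_eq hz]

/-- The definition uses a chart that moves with the point; near `p` the chart at `p` may be used
throughout. -/
theorem continuous_scalarCurvature
    {g : ∀ p : M, TangentSpace I p →L[ℝ] TangentSpace I p →L[ℝ] ℝ}
    (hg : IsMetricInCharts I g) : Continuous (scalarCurvature I g) := by
  rw [continuous_iff_continuousAt]
  intro p
  have h1 : ContinuousAt (fun q => scalarCurvatureOn (inChart I g p) (extChartAt I p q)) p :=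
    (continuousAt_scalarCurvatureOn (hg.eventually (mem_extChartAt_target p))).comp
      (continuousAt_extChartAt p)
  refine h1.congr ?_
  filter_upwards [extChartAt_source_mem_nhds (I := I) p] with q hq
  exact (scalarCurvature_eq_scalarCurvatureOn hg hq).symm

end Transition

/-! ### Exterior derivative and its norm on the plane -/

section Curl

open scoped Topology

set_option maxSynthPendingDepth 3

variable {E W : Type*} [NormedAddCommGroup E] [NormedSpace ℝ E]
  [NormedAddCommGroup W] [NormedSpace ℝ W]

/-- The exterior derivative commutes with pullbacks. -/
theorem oneFormCurl_comp {β β' : E → E →L[ℝ] W} {Φ : E → E} {y : E}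
    (hβ : DifferentiableAt ℝ β (Φ y)) (hΦ : ContDiffAt ℝ ∞ Φ y)
    (h : β' =ᶠ[𝓝 y] fun x => (β (Φ x)) ∘L (fderiv ℝ Φ x)) (u v : E) :
    oneFormCurl β' y u v = oneFormCurl β (Φ y) (fderiv ℝ Φ y u) (fderiv ℝ Φ y v) := by
  have hΦd : DifferentiableAt ℝ Φ y := hΦ.differentiableAt (by simp)
  have hΦ2 : DifferentiableAt ℝ (fderiv ℝ Φ) y :=
    (hΦ.fderiv_right (m := ∞) (by simp)).differentiableAt (by simp)
  have hβΦ : DifferentiableAt ℝ (fun x => β (Φ x)) y := hβ.comp y hΦd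
  have hsym := hΦ.isSymmSndFDerivAt minSmoothness_two_le_infty
  rw [oneFormCurl_apply, oneFormCurl_apply, h.fderiv_eq, fderiv_clm_comp hβΦ hΦ2,
    fderiv_fun_comp y hβ hΦd]
  simp [hsym.eq u v]

theorem oneFormCurl_clm_comp {F : Type*} [NormedAddCommGroup F] [NormedSpace ℝ F]
    {β : E → E →L[ℝ] W} {y : E} (hβ : DifferentiableAt ℝ β y) (l : W →L[ℝ] F) (u v : E) :
    oneFormCurl (fun x => l ∘L β x) y u v = l (oneFormCurl β y u v) := by
  rw [oneFormCurl_apply, oneFormCurl_apply, fderiv_clm_comp (by fun_prop) hβ]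
  simp

/-- The squared norm of an alternating bilinear form `c` with respect to the scalar product `b`
on the plane. -/
noncomputable def planeFormNormSq
    (b c : EuclideanSpace ℝ (Fin 2) →L[ℝ] EuclideanSpace ℝ (Fin 2) →L[ℝ] ℝ) : ℝ :=
  let e := (EuclideanSpace.basisFun (Fin 2) ℝ).toBasis
  c (e 0) (e 1) ^ 2 / (b (e 0) (e 0) * b (e 1) (e 1) - b (e 0) (e 1) ^ 2)

/-- A change of basis multiplies `c (e 0) (e 1)` by its determinant and the Gram determinant by the
square of it. Squaring also removes the choice of orientation. The explicit quotient is suited to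
continuity, for which the non-vanishing denominator is recorded, and the orthonormal value to
invariance. -/
theorem planeFormNormSq_eq
    {b c : EuclideanSpace ℝ (Fin 2) →L[ℝ] EuclideanSpace ℝ (Fin 2) →L[ℝ] ℝ}
    (hc : ∀ u v, c u v = - c v u) {f : Module.Basis (Fin 2) ℝ (EuclideanSpace ℝ (Fin 2))}
    (hf : ∀ i j, b (f i) (f j) = if i = j then 1 else 0) :
    b ((EuclideanSpace.basisFun (Fin 2) ℝ).toBasis 0) ((EuclideanSpace.basisFun (Fin 2) ℝ).toBasis 0)
        * b ((EuclideanSpace.basisFun (Fin 2) ℝ).toBasis 1)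
          ((EuclideanSpace.basisFun (Fin 2) ℝ).toBasis 1)
        - b ((EuclideanSpace.basisFun (Fin 2) ℝ).toBasis 0)
          ((EuclideanSpace.basisFun (Fin 2) ℝ).toBasis 1) ^ 2 ≠ 0 ∧
      planeFormNormSq b c = c (f 0) (f 1) ^ 2 := by
  unfold planeFormNormSq
  set e := (EuclideanSpace.basisFun (Fin 2) ℝ).toBasis with he
  have hcc : ∀ u, c u u = 0 := fun u => by have := hc u u; linarith
  have hexp : ∀ i, e i = f.repr (e i) 0 • f 0 + f.repr (e i) 1 • f 1 := fun i => by
    conv_lhs => rw [← f.sum_repr (e i), Fin.sum_univ_two]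
  have hdet : f.repr (e 0) 0 * f.repr (e 1) 1 - f.repr (e 0) 1 * f.repr (e 1) 0 ≠ 0 := by
    have hm : f.toMatrix e * e.toMatrix f = 1 := f.toMatrix_mul_toMatrix_flip e
    have hu := congrArg Matrix.det hm
    rw [Matrix.det_mul, Matrix.det_one, Matrix.det_fin_two] at hu
    simp only [Module.Basis.toMatrix_apply] at hu
    intro h0
    rw [show f.repr (e 0) 0 * f.repr (e 1) 1 - f.repr (e 1) 0 * f.repr (e 0) 1 = 0 by linarith,
      zero_mul] at hu
    exact zero_ne_one hu
  set p := f.repr (e 0) 0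
  set q := f.repr (e 0) 1
  set s := f.repr (e 1) 0
  set t := f.repr (e 1) 1
  have hgram : b (e 0) (e 0) * b (e 1) (e 1) - b (e 0) (e 1) ^ 2 = (p * t - q * s) ^ 2 := by
    rw [hexp 0, hexp 1]
    simp [hf]
    ring
  have hform : c (e 0) (e 1) = (p * t - q * s) * c (f 0) (f 1) := by
    rw [hexp 0, hexp 1]
    simp [hcc, hc (f 1) (f 0)]
    ring
  refine ⟨?_, ?_⟩
  · rw [hgram]
    exact pow_ne_zero 2 hdet
  · simp only [hgram, hform, mul_pow]
    field_simp

end Curl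

/-! ### The Maurer-Cartan form of an abelian Lie group is smooth and closed -/

section MaurerCartan

open scoped Topology

set_option maxSynthPendingDepth 3
set_option linter.unusedSectionVars false

variable {V : Type*} [NormedAddCommGroup V] [NormedSpace ℝ V]
  {B : Type*} [TopologicalSpace B] {I : ModelWithCorners ℝ V B} [I.Boundaryless]
  {H : Type*} [TopologicalSpace H] [ChartedSpace B H] [CommGroup H] [LieGroup I ∞ H]

/-- The Maurer-Cartan form of a Lie group. -/
noncomputable def maurerCartan (I : ModelWithCorners ℝ V B) (z : H) : TangentSpace I z →L[ℝ] V :=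
  (mfderiv I I (fun x : H => z⁻¹ * x) z : V →L[ℝ] V)

theorem maurerCartan_apply (z : H) (v : TangentSpace I z) :
    maurerCartan I z v = mfderiv I I (fun x : H => z⁻¹ * x) z v := rfl

theorem mdifferentiableAt_leftMul (a z : H) : MDifferentiableAt I I (fun x => a * x) z :=
  (contMDiff_mul_left (I := I) (n := ∞)).mdifferentiableAt (by simp)

theorem mdifferentiableAt_inv (z : H) : MDifferentiableAt I I (fun x : H => x⁻¹) z :=
  (contMDiff_inv I ∞).mdifferentiableAt (by simp)

theorem maurerCartan_injective (z : H) : Function.Injective (maurerCartan I z) := by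
  intro u v huv
  have key : ∀ w : TangentSpace I z, (mfderiv I I (fun x : H => z * x) (z⁻¹ * z)
      (mfderiv I I (fun x : H => z⁻¹ * x) z w) : V) = w := by
    intro w
    have h := mfderiv_comp_apply z (mdifferentiableAt_leftMul (I := I) z (z⁻¹ * z))
      (mdifferentiableAt_leftMul (I := I) z⁻¹ z) w
    have h' : (fun x : H => z * x) ∘ (fun x => z⁻¹ * x) = id := by ext x; simp
    rw [h', mfderiv_id] at h
    exact h.symm
  have h1 := key u
  have h2 := key v
  rw [← maurerCartan_apply] at h1 h2
  rw [← h1, ← h2, huv]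

/-- Differentiate `x * x⁻¹ = 1` at the identity. -/
theorem mfderiv_inv_one (v : TangentSpace I (1 : H)) :
    (mfderiv I I (fun x : H => x⁻¹) 1 v : V) = -v := by
  have hm : MDifferentiableAt (I.prod I) I (fun p : H × H => p.1 * p.2) (1, (1 : H)⁻¹) :=
    (contMDiff_mul I ∞).mdifferentiableAt (by simp)
  have hi : MDifferentiableAt I (I.prod I) (fun x : H => (x, x⁻¹)) 1 :=
    mdifferentiableAt_id.prodMk (mdifferentiableAt_inv 1)
  have h := mfderiv_comp_apply (1 : H) hm hi v
  have hc : (fun p : H × H => p.1 * p.2) ∘ (fun x : H => (x, x⁻¹)) = fun _ => 1 := by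
    ext x; simp
  rw [hc, mfderiv_const] at h
  have hi' : MDifferentiableAt I I (fun x : H => x) 1 := mdifferentiableAt_id
  have h1 := DFunLike.congr_fun (mfderiv_prodMk hi' (mdifferentiableAt_inv (I := I) (1 : H))) v
  have h2 := mfderiv_prod_eq_add_apply hm (v := mfderiv I (I.prod I) (fun x : H => (x, x⁻¹)) 1 v)
  have e1 : ∀ a : V, (mfderiv I I (fun z : H => z * (1 : H)⁻¹) 1 a : V) = a := fun a => by
    have : (fun z : H => z * (1 : H)⁻¹) = id := by ext; simp
    rw [this, mfderiv_id]; rfl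
  have e2 : ∀ a : V, (mfderiv I I (fun z : H => (1 : H) * z) (1 : H)⁻¹ a : V) = a := fun a => by
    have : (fun z : H => (1 : H) * z) = id := by ext; simp
    rw [this, mfderiv_id]; rfl
  have e3 : (mfderiv I I (fun x : H => x) (1 : H) v : V) = v :=
    DFunLike.congr_fun (mfderiv_id : mfderiv I I (id : H → H) 1 = _) v
  let v' : V := v
  let w : V × V := mfderiv I (I.prod I) (fun x : H => (x, x⁻¹)) 1 v
  let d : V := mfderiv I I (fun x : H => x⁻¹) 1 v
  have hw : w = (v', d) := by
    refine h1.trans (Prod.ext e3 rfl)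
  have h3 : (0 : V) = v' + d := by
    refine (h.trans h2).trans ((congrArg₂ (· + ·) (e1 w.1) (e2 w.2)).trans ?_)
    rw [hw]
    rfl
  exact (neg_eq_of_add_eq_zero_right h3.symm).symm

/-- The map `z ↦ a z⁻¹` of a commutative Lie group. -/
noncomputable def divLeftDiffeomorph (I : ModelWithCorners ℝ V B) [LieGroup I ∞ H] (a : H) :
    H ≃ₘ^∞⟮I, I⟯ H where
  toEquiv := Equiv.divLeft a
  contMDiff_toFun := by
    have : ContMDiff I I ∞ (fun x : H => a / x) := contMDiff_const.div contMDiff_id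
    exact this
  contMDiff_invFun := by
    have : ContMDiff I I ∞ (fun x : H => x⁻¹ * a) := (contMDiff_inv I ∞).mul contMDiff_const
    exact this

theorem divLeftDiffeomorph_apply (a z : H) : divLeftDiffeomorph I a z = a / z := rfl

/-- By commutativity `(a / z)⁻¹ * (a / x)` is the inverse of `z⁻¹ * x`, and inversion has
differential `-1` at the identity. -/
theorem maurerCartan_divLeft (a z : H) (v : TangentSpace I z) :
    maurerCartan I (divLeftDiffeomorph I a z)
      (mfderiv I I (divLeftDiffeomorph I a) z v) = -maurerCartan I z v := by
  rw [maurerCartan_apply]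
  have h1 := mfderiv_comp_apply z (mdifferentiableAt_leftMul (I := I)
    (divLeftDiffeomorph I a z)⁻¹ (divLeftDiffeomorph I a z))
    ((divLeftDiffeomorph I a).contMDiff.mdifferentiableAt (by simp)) v
  have h2 := mfderiv_comp_apply_of_eq z (mdifferentiableAt_inv (I := I) (1 : H))
    (mdifferentiableAt_leftMul (I := I) z⁻¹ z) (by simp) v
  have he : (fun x => (divLeftDiffeomorph I a z)⁻¹ * x) ∘ (divLeftDiffeomorph I a) =
      (fun x : H => x⁻¹) ∘ (fun x => z⁻¹ * x) := by
    ext x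
    simp only [Function.comp_apply, divLeftDiffeomorph_apply, inv_div, mul_inv_rev, inv_inv]
    rw [div_mul_div_cancel, div_eq_mul_inv, mul_comm]
  rw [he] at h1
  refine (h1.symm.trans h2).trans ?_
  exact mfderiv_inv_one _

theorem contDiffAt_oneFormInChart_maurerCartan [FiniteDimensional ℝ V] {x : H} {y : V}
    (hy : y ∈ (extChartAt I x).target) :
    ContDiffAt ℝ ∞ (oneFormInChart I (maurerCartan I (H := H)) x) y := by
  have : IsManifold I ∞ H := LieGroup.toContMDiffMul.toIsManifold
  set φ := extChartAt I x with hφ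
  -- The left quotient in charts, as a smooth map of two variables. Its partial derivative in the
  -- second variable on the diagonal is the Maurer-Cartan form, because the preferred chart at `1`
  -- has identity differential there.
  let a : V × V → V := fun p => extChartAt I (1 : H) ((φ.symm p.1)⁻¹ * φ.symm p.2)
  have ha : ∀ z ∈ φ.target, ContDiffAt ℝ ∞ a (z, z) := by
    intro z hz
    have h1 := contMDiffAt_extChartAt_symm (I := I) hz
    have h2 : ContMDiffAt 𝓘(ℝ, V × V) I ∞ (fun p : V × V => (φ.symm p.1)⁻¹ * φ.symm p.2) (z, z) := by
      refine ContMDiffAt.mul (ContMDiffAt.inv ?_) ?_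
      · exact ContMDiffAt.comp (z, z) (g := φ.symm) (f := Prod.fst) h1 contDiffAt_fst.contMDiffAt
      · exact ContMDiffAt.comp (z, z) (g := φ.symm) (f := Prod.snd) h1 contDiffAt_snd.contMDiffAt
    have h3 : ContMDiffAt I 𝓘(ℝ, V) ∞ (extChartAt I (1 : H)) ((φ.symm z)⁻¹ * φ.symm z) := by
      rw [inv_mul_cancel]
      exact contMDiffAt_extChartAt
    exact (h3.comp (z, z) h2).contDiffAt
  have key : ∀ z ∈ φ.target, oneFormInChart I (maurerCartan I (H := H)) x z =
      (fderiv ℝ a (z, z)) ∘L ContinuousLinearMap.inr ℝ V V := by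
    intro z hz
    ext u
    have hd : DifferentiableAt ℝ a (z, z) := (ha z hz).differentiableAt (by simp)
    have h1 : fderiv ℝ (fun w => a (z, w)) z u = fderiv ℝ a (z, z) (0, u) := by
      have := hd.hasFDerivAt.comp z ((hasFDerivAt_const z z).prodMk (hasFDerivAt_id z))
      have e := DFunLike.congr_fun this.fderiv u
      exact e.trans (by simp)
    have hsymm := mdifferentiableAt_extChartAt_symm (I := I) hz
    have hmul : MDifferentiableAt I I (fun w : H => (φ.symm z)⁻¹ * w) (φ.symm z) :=
      mdifferentiableAt_leftMul _ _
    have hchart : MDifferentiableAt I 𝓘(ℝ, V) (extChartAt I (1 : H)) 1 :=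
      mdifferentiableAt_extChartAt (mem_chart_source _ _)
    have h2 := mfderiv_comp_apply_of_eq z (hchart)
      (hmul.comp z hsymm) (inv_mul_cancel (φ.symm z)) u
    have h3 := mfderiv_comp_apply z hmul hsymm u
    rw [mfderiv_extChartAt_self, mfderiv_eq_fderiv] at h2
    exact (h3.symm.trans h2.symm).trans h1
  have hs : ContDiffAt ℝ ∞ (fun z => (fderiv ℝ a (z, z)) ∘L ContinuousLinearMap.inr ℝ V V) y := by
    have h1 : ContDiffAt ℝ ∞ (fderiv ℝ a) (y, y) := (ha y hy).fderiv_right (by simp)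
    have h2 : ContDiffAt ℝ ∞ (fun z => fderiv ℝ a (z, z)) y :=
      ContDiffAt.comp y (g := fderiv ℝ a) (f := fun z => (z, z)) h1
        (contDiffAt_id.prodMk contDiffAt_id)
    exact h2.clm_comp contDiffAt_const
  exact hs.congr_of_eventuallyEq
    (Filter.mem_of_superset ((isOpen_extChartAt_target x).mem_nhds hy) key)

theorem oneFormInChart_maurerCartan_injective {x : H} {y : V}
    (hy : y ∈ (extChartAt I x).target) :
    Function.Injective (oneFormInChart I (maurerCartan I (H := H)) x y) := by
  have : IsManifold I ∞ H := LieGroup.toContMDiffMul.toIsManifold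
  exact (maurerCartan_injective _).comp (injective_mfderiv_extChartAt_symm hy)

/-- The Maurer-Cartan form of a commutative Lie group is closed. -/
theorem fderiv_oneFormInChart_maurerCartan_symm [FiniteDimensional ℝ V] {x : H} {y : V}
    (hy : y ∈ (extChartAt I x).target) (u v : V) :
    fderiv ℝ (oneFormInChart I (maurerCartan I (H := H)) x) y u v =
      fderiv ℝ (oneFormInChart I (maurerCartan I (H := H)) x) y v u := by
  have : IsManifold I ∞ H := LieGroup.toContMDiffMul.toIsManifold
  set L := oneFormInChart I (maurerCartan I (H := H)) x with hL
  set p := (extChartAt I x).symm y with hp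
  -- This map fixes `p`, where its differential is `-1`, and pulls the Maurer-Cartan form `L` back
  -- to `-L`. A 2-form is unchanged by `-1`, so at `p` the exterior derivative of `L` equals its own
  -- negative.
  set f := divLeftDiffeomorph I (p * p) with hf
  have hfp : f p = p := by simp [hf, divLeftDiffeomorph_apply]
  have hy' : f p ∈ (extChartAt I x).source := by
    rw [hfp]; exact (extChartAt I x).map_target hy
  have hΨy : mapInCharts I f x x y = y := by
    rw [mapInCharts, Function.comp_apply, Function.comp_apply, ← hp, hfp, hp]
    exact (extChartAt I x).right_inv hy
  have hcomp : ∀ {z}, z ∈ (extChartAt I x).target → f ((extChartAt I x).symm z) ∈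
      (extChartAt I x).source → -L z = (L (mapInCharts I f x x z)) ∘L
      fderiv ℝ (mapInCharts I f x x) z := by
    intro z hz hz'
    exact oneFormInChart_comp (α := maurerCartan I) (α' := fun q => -maurerCartan I q)
      (fun q X => (maurerCartan_divLeft (p * p) q X).symm) hz hz'
  have hD : ∀ w, fderiv ℝ (mapInCharts I f x x) y w = -w := by
    intro w
    apply oneFormInChart_maurerCartan_injective hy
    have := DFunLike.congr_fun (hcomp hy hy') w
    rw [hΨy] at this
    rw [map_neg]
    exact this.symm
  have hLd : DifferentiableAt ℝ L y :=
    (contDiffAt_oneFormInChart_maurerCartan hy).differentiableAt (by simp)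
  have hcurl := oneFormCurl_comp (β := L) (β' := -L) (by rw [hΨy]; exact hLd)
    (contDiffAt_mapInCharts hy hy')
    ((eventually_mapInCharts hy hy').mono fun z hz => hcomp hz.1 hz.2) u v
  rw [hΨy, hD, hD, oneFormCurl_apply, oneFormCurl_apply, fderiv_neg] at hcurl
  simp only [neg_apply, map_neg, neg_neg] at hcurl
  have h2 : (2 : ℝ) • (fderiv ℝ L y u v - fderiv ℝ L y v u) = 0 := by
    rw [two_smul]
    nth_rewrite 1 [← hcurl]
    abel
  rw [smul_eq_zero, sub_eq_zero] at h2
  exact h2.resolve_left two_ne_zero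

end MaurerCartan

/-! ### The bundle metric in a product chart -/

section ProductChart

open scoped Topology

set_option maxSynthPendingDepth 3
set_option linter.unusedSectionVars false

variable {n r : ℕ}
  {N : Type*} [TopologicalSpace N] [ChartedSpace (EuclideanSpace ℝ (Fin n)) N]
  [IsManifold (𝓡 n) ∞ N]
  {H : Type*} [TopologicalSpace H] [ChartedSpace (EuclideanSpace ℝ (Fin r)) H] [CommGroup H]
  [LieGroup (𝓡 r) ∞ H]

theorem mem_extChartAt_target_prod {x : N × H}
    {y : EuclideanSpace ℝ (Fin n) × EuclideanSpace ℝ (Fin r)} :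
    y ∈ (extChartAt ((𝓡 n).prod (𝓡 r)) x).target ↔
      y.1 ∈ (extChartAt (𝓡 n) x.1).target ∧ y.2 ∈ (extChartAt (𝓡 r) x.2).target := by
  rw [extChartAt_prod]
  rfl

theorem mfderiv_extChartAt_symm_prod {x : N × H}
    {y : EuclideanSpace ℝ (Fin n) × EuclideanSpace ℝ (Fin r)}
    (hy : y ∈ (extChartAt ((𝓡 n).prod (𝓡 r)) x).target)
    (u : EuclideanSpace ℝ (Fin n) × EuclideanSpace ℝ (Fin r)) :
    (mfderiv 𝓘(ℝ, EuclideanSpace ℝ (Fin n) × EuclideanSpace ℝ (Fin r)) ((𝓡 n).prod (𝓡 r))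
      (extChartAt ((𝓡 n).prod (𝓡 r)) x).symm y u :
        EuclideanSpace ℝ (Fin n) × EuclideanSpace ℝ (Fin r)) =
      (mfderiv 𝓘(ℝ, EuclideanSpace ℝ (Fin n)) (𝓡 n) (extChartAt (𝓡 n) x.1).symm y.1 u.1,
       mfderiv 𝓘(ℝ, EuclideanSpace ℝ (Fin r)) (𝓡 r) (extChartAt (𝓡 r) x.2).symm y.2 u.2) := by
  have : IsManifold (𝓡 r) ∞ H := LieGroup.toContMDiffMul.toIsManifold
  rw [mem_extChartAt_target_prod] at hy
  have hf : MDifferentiableAt 𝓘(ℝ, EuclideanSpace ℝ (Fin n) × EuclideanSpace ℝ (Fin r))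
      𝓘(ℝ, EuclideanSpace ℝ (Fin n)) Prod.fst y := differentiableAt_fst.mdifferentiableAt
  have hs : MDifferentiableAt 𝓘(ℝ, EuclideanSpace ℝ (Fin n) × EuclideanSpace ℝ (Fin r))
      𝓘(ℝ, EuclideanSpace ℝ (Fin r)) Prod.snd y := differentiableAt_snd.mdifferentiableAt
  have h1 := mdifferentiableAt_extChartAt_symm (I := 𝓡 n) hy.1
  have h2 := mdifferentiableAt_extChartAt_symm (I := 𝓡 r) hy.2
  have e1 := mfderiv_comp_apply y h1 hf u
  have e2 := mfderiv_comp_apply y h2 hs u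
  rw [mfderiv_eq_fderiv, fderiv_fst] at e1
  rw [mfderiv_eq_fderiv, fderiv_snd] at e2
  have e := DFunLike.congr_fun (mfderiv_prodMk (h1.comp y hf) (h2.comp y hs)) u
  exact e.trans (Prod.ext e1 e2)

/-- In a product chart the connection form is the local expression of `lam` plus that of the
Maurer-Cartan form. This is the link between `g_λ` and the local model computed above. -/
theorem inChart_bundleMetric
    (h : ∀ p : N, TangentSpace (𝓡 n) p →L[ℝ] TangentSpace (𝓡 n) p →L[ℝ] ℝ)
    (k : ∀ z : H, TangentSpace (𝓡 r) z →L[ℝ] TangentSpace (𝓡 r) z →L[ℝ] ℝ)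
    (lam : ∀ p : N, TangentSpace (𝓡 n) p →L[ℝ] GroupLieAlgebra (𝓡 r) H) {x : N × H}
    {y : EuclideanSpace ℝ (Fin n) × EuclideanSpace ℝ (Fin r)}
    (hy : y ∈ (extChartAt ((𝓡 n).prod (𝓡 r)) x).target) :
    inChart ((𝓡 n).prod (𝓡 r)) (bundleMetric h k lam) x y =
      (sumMetric (inChart (𝓡 n) h x.1)
        (k 1 : EuclideanSpace ℝ (Fin r) →L[ℝ] EuclideanSpace ℝ (Fin r) →L[ℝ] ℝ) y).bilinearComp
      (bundleFrame (oneFormInChart (𝓡 n) (F := EuclideanSpace ℝ (Fin r)) lam x.1)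
        (oneFormInChart (𝓡 r) (maurerCartan (𝓡 r)) x.2) y)
      (bundleFrame (oneFormInChart (𝓡 n) (F := EuclideanSpace ℝ (Fin r)) lam x.1)
        (oneFormInChart (𝓡 r) (maurerCartan (𝓡 r)) x.2) y) := by
  refine ContinuousLinearMap.ext fun u => ContinuousLinearMap.ext fun v => ?_
  let b : N × H → EuclideanSpace ℝ (Fin n) × EuclideanSpace ℝ (Fin r) →L[ℝ]
    EuclideanSpace ℝ (Fin n) × EuclideanSpace ℝ (Fin r) →L[ℝ] ℝ := bundleMetric h k lam
  let h₀ : N → EuclideanSpace ℝ (Fin n) →L[ℝ] EuclideanSpace ℝ (Fin n) →L[ℝ] ℝ := h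
  let k₁ : EuclideanSpace ℝ (Fin r) →L[ℝ] EuclideanSpace ℝ (Fin r) →L[ℝ] ℝ := k 1
  let l₀ : N → EuclideanSpace ℝ (Fin n) →L[ℝ] EuclideanSpace ℝ (Fin r) := lam
  let m₀ : H → EuclideanSpace ℝ (Fin r) →L[ℝ] EuclideanSpace ℝ (Fin r) := maurerCartan (𝓡 r)
  have hb : ∀ q ξ η, b q ξ η = h₀ q.1 ξ.1 η.1 +
      k₁ (l₀ q.1 ξ.1 + m₀ q.2 ξ.2) (l₀ q.1 η.1 + m₀ q.2 η.2) := by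
    intro q ξ η
    refine (bundleMetric_apply h k lam q ξ η).trans ?_
    unfold connectionForm
    rw [mfderiv_fst, mfderiv_snd]
    rfl
  have hq : (extChartAt ((𝓡 n).prod (𝓡 r)) x).symm y =
      ((extChartAt (𝓡 n) x.1).symm y.1, (extChartAt (𝓡 r) x.2).symm y.2) := by
    rw [extChartAt_prod]; rfl
  have key : ∀ (q q' : N × H) (ξ ξ' η η' : EuclideanSpace ℝ (Fin n) × EuclideanSpace ℝ (Fin r)),
      q = q' → ξ = ξ' → η = η' → b q ξ η = b q' ξ' η' := by
    rintro q _ ξ _ η _ rfl rfl rfl; rfl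
  exact (key _ _ _ _ _ _ hq (mfderiv_extChartAt_symm_prod hy u)
    (mfderiv_extChartAt_symm_prod hy v)).trans (hb _ _ _)

end ProductChart

/-! ### The norm of the exterior derivative of a 1-form on a surface -/

section SurfaceForms

open scoped Topology

set_option maxSynthPendingDepth 3
set_option linter.unusedSectionVars false

variable {N : Type*} [TopologicalSpace N] [ChartedSpace (EuclideanSpace ℝ (Fin 2)) N]
  [IsManifold (𝓡 2) ∞ N]

/-- The squared norm of the exterior derivative of a 1-form on a surface. -/
noncomputable def curlNormSq (h : ∀ p : N, TangentSpace (𝓡 2) p →L[ℝ] TangentSpace (𝓡 2) p →L[ℝ] ℝ)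
    (β : ∀ p : N, TangentSpace (𝓡 2) p →L[ℝ] ℝ) (p : N) : ℝ :=
  planeFormNormSq (inChart (𝓡 2) h p (extChartAt (𝓡 2) p p))
    (oneFormCurl (oneFormInChart (𝓡 2) β p) (extChartAt (𝓡 2) p p))

variable {h : ∀ p : N, TangentSpace (𝓡 2) p →L[ℝ] TangentSpace (𝓡 2) p →L[ℝ] ℝ}
  {β β' : ∀ p : N, TangentSpace (𝓡 2) p →L[ℝ] ℝ} {f : N ≃ₘ^∞⟮𝓡 2, 𝓡 2⟯ N}

theorem oneFormCurl_skew {E W : Type*} [NormedAddCommGroup E] [NormedSpace ℝ E]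
    [NormedAddCommGroup W] [NormedSpace ℝ W] (α : E → E →L[ℝ] W) (x u v : E) :
    oneFormCurl α x u v = - oneFormCurl α x v u := by
  rw [oneFormCurl_apply, oneFormCurl_apply, neg_sub]

/-- The differential of the isometry carries an orthonormal basis to an orthonormal basis, and
exterior derivatives commute with pullback. The target chart is arbitrary, so `f = id` gives chart
independence. -/
theorem IsRiemannianIsometry.curlNormSq_eq (hf : IsRiemannianIsometry (𝓡 2) h f)
    (hh : IsMetricInCharts (𝓡 2) h)
    (hβ : ∀ x : N, ∀ y ∈ (extChartAt (𝓡 2) x).target,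
      ContDiffAt ℝ ∞ (oneFormInChart (𝓡 2) β x) y)
    (hβ' : ∀ p X, β' p X = β (f p) (mfderiv (𝓡 2) (𝓡 2) f p X)) {p x : N}
    (hp : f p ∈ (extChartAt (𝓡 2) x).source) :
    curlNormSq h β' p = planeFormNormSq (inChart (𝓡 2) h x (extChartAt (𝓡 2) x (f p)))
      (oneFormCurl (oneFormInChart (𝓡 2) β x) (extChartAt (𝓡 2) x (f p))) := by
  have hl : (extChartAt (𝓡 2) p).symm (extChartAt (𝓡 2) p p) = p := extChartAt_to_inv p
  set y := extChartAt (𝓡 2) p p with hy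
  have hyt : y ∈ (extChartAt (𝓡 2) p).target := mem_extChartAt_target p
  have hys : f ((extChartAt (𝓡 2) p).symm y) ∈ (extChartAt (𝓡 2) x).source := by rwa [hl]
  have hΨ : mapInCharts (𝓡 2) f p x y = extChartAt (𝓡 2) x (f p) := by
    rw [mapInCharts, Function.comp_apply, Function.comp_apply, hl]
  have hΨt := mapInCharts_mem_target hys
  have hm := hh p y hyt
  obtain ⟨e, he⟩ := exists_orthonormal_basis hm.symm hm.pos finrank_euclideanSpace_fin
  have hinj := injective_fderiv_mapInCharts hyt hys
  let L := LinearEquiv.ofInjectiveEndo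
    (fderiv ℝ (mapInCharts (𝓡 2) f p x) y).toLinearMap hinj
  have hL : ∀ v, L v = fderiv ℝ (mapInCharts (𝓡 2) f p x) y v := fun v => rfl
  have he' : ∀ i j, inChart (𝓡 2) h x (extChartAt (𝓡 2) x (f p)) (e.map L i) (e.map L j) =
      if i = j then 1 else 0 := by
    intro i j
    rw [← he i j, hf.inChart_eq hyt hys, hΨ, ContinuousLinearMap.bilinearComp_apply]
    rfl
  rw [curlNormSq, (planeFormNormSq_eq (oneFormCurl_skew _ _) he).2,
    (planeFormNormSq_eq (oneFormCurl_skew _ _) he').2,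
    oneFormCurl_comp (((hβ x _ hΨt)).differentiableAt (by simp)) (contDiffAt_mapInCharts hyt hys)
      ((eventually_mapInCharts hyt hys).mono fun z hz => oneFormInChart_comp hβ' hz.1 hz.2), hΨ]
  rfl

theorem IsRiemannianIsometry.curlNormSq_comp (hf : IsRiemannianIsometry (𝓡 2) h f)
    (hh : IsMetricInCharts (𝓡 2) h)
    (hβ : ∀ x : N, ∀ y ∈ (extChartAt (𝓡 2) x).target,
      ContDiffAt ℝ ∞ (oneFormInChart (𝓡 2) β x) y)
    (hβ' : ∀ p X, β' p X = β (f p) (mfderiv (𝓡 2) (𝓡 2) f p X)) (p : N) :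
    curlNormSq h β' p = curlNormSq h β (f p) :=
  hf.curlNormSq_eq hh hβ hβ' (mem_extChartAt_source (f p))

theorem continuous_curlNormSq (hh : IsMetricInCharts (𝓡 2) h)
    (hβ : ∀ x : N, ∀ y ∈ (extChartAt (𝓡 2) x).target,
      ContDiffAt ℝ ∞ (oneFormInChart (𝓡 2) β x) y) : Continuous (curlNormSq h β) := by
  rw [continuous_iff_continuousAt]
  intro p
  have hyt := mem_extChartAt_target (I := 𝓡 2) p
  have hm := hh p _ hyt
  obtain ⟨e, he⟩ := exists_orthonormal_basis hm.symm hm.pos finrank_euclideanSpace_fin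
  have hne := (planeFormNormSq_eq (oneFormCurl_skew (oneFormInChart (𝓡 2) β p)
    (extChartAt (𝓡 2) p p)) he).1
  have hc := hm.smooth.continuousAt
  have hd := (contDiffAt_oneFormCurl (hβ p _ hyt)).continuousAt
  have key : ContinuousAt (fun y => planeFormNormSq (inChart (𝓡 2) h p y)
      (oneFormCurl (oneFormInChart (𝓡 2) β p) y)) (extChartAt (𝓡 2) p p) := by
    unfold planeFormNormSq
    have hci : ∀ u v, ContinuousAt (fun y => inChart (𝓡 2) h p y u v) (extChartAt (𝓡 2) p p) :=
      fun u v => (hc.clm_apply continuousAt_const).clm_apply continuousAt_const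
    exact (((hd.clm_apply continuousAt_const).clm_apply continuousAt_const).pow 2).div
      (((hci _ _).mul (hci _ _)).sub ((hci _ _).pow 2)) hne
  have h1 := ContinuousAt.comp (f := extChartAt (𝓡 2) p) (x := p) key (continuousAt_extChartAt p)
  refine h1.congr ?_
  filter_upwards [extChartAt_source_mem_nhds (I := 𝓡 2) p] with q hq
  refine ((isRiemannianIsometry_refl h).curlNormSq_eq hh hβ (fun p X => ?_) hq).symm
  have hid : mfderiv (𝓡 2) (𝓡 2) (Diffeomorph.refl (𝓡 2) N ∞) p = ContinuousLinearMap.id ℝ _ :=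
    mfderiv_id
  rw [hid]
  rfl

end SurfaceForms

/-! ### Scalar curvature of `g_λ` -/

section BundleMetric

open scoped Topology

set_option maxSynthPendingDepth 3
set_option linter.unusedSectionVars false

variable {n r : ℕ}
  {N : Type*} [TopologicalSpace N] [ChartedSpace (EuclideanSpace ℝ (Fin n)) N]
  [IsManifold (𝓡 n) ∞ N]
  {H : Type*} [TopologicalSpace H] [ChartedSpace (EuclideanSpace ℝ (Fin r)) H] [CommGroup H]
  [LieGroup (𝓡 r) ∞ H]
  (h : ContMDiffRiemannianMetric (𝓡 n) ∞ (EuclideanSpace ℝ (Fin n))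
      (fun p : N => TangentSpace (𝓡 n) p))
  (k : ContMDiffRiemannianMetric (𝓡 r) ∞ (EuclideanSpace ℝ (Fin r))
      (fun z : H => TangentSpace (𝓡 r) z))

/-- The scalar product on the Lie algebra. -/
noncomputable def lieAlgebraMetric :
    EuclideanSpace ℝ (Fin r) →L[ℝ] EuclideanSpace ℝ (Fin r) →L[ℝ] ℝ := k.inner 1

theorem lieAlgebraMetric_symm (a b : EuclideanSpace ℝ (Fin r)) :
    lieAlgebraMetric k a b = lieAlgebraMetric k b a := k.symm 1 a b

theorem lieAlgebraMetric_pos (a : EuclideanSpace ℝ (Fin r)) (ha : a ≠ 0) :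
    0 < lieAlgebraMetric k a a := k.pos 1 a ha

variable {lam : ∀ p : N, TangentSpace (𝓡 n) p →L[ℝ] GroupLieAlgebra (𝓡 r) H}

theorem isBundlePoint_inChart (hlam : IsSmoothOneForm (𝓡 n) (F := EuclideanSpace ℝ (Fin r)) lam)
    {x : N × H} {y : EuclideanSpace ℝ (Fin n) × EuclideanSpace ℝ (Fin r)}
    (hy : y ∈ (extChartAt ((𝓡 n).prod (𝓡 r)) x).target) :
    IsBundlePoint (inChart (𝓡 n) h.inner x.1) (lieAlgebraMetric k)
      (oneFormInChart (𝓡 n) (F := EuclideanSpace ℝ (Fin r)) lam x.1)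
      (oneFormInChart (𝓡 r) (maurerCartan (𝓡 r)) x.2) y := by
  rw [mem_extChartAt_target_prod] at hy
  exact {
    base := h.isMetricInCharts x.1 y.1 hy.1
    symm := lieAlgebraMetric_symm k
    pos := lieAlgebraMetric_pos k
    smooth_form := hlam.contDiffAt_oneFormInChart hy.1
    smooth_fiber := contDiffAt_oneFormInChart_maurerCartan hy.2
    injective_fiber := oneFormInChart_maurerCartan_injective hy.2
    closed_fiber := fderiv_oneFormInChart_maurerCartan_symm hy.2 }

theorem isMetricInCharts_bundleMetric
    (hlam : IsSmoothOneForm (𝓡 n) (F := EuclideanSpace ℝ (Fin r)) lam) :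
    IsMetricInCharts ((𝓡 n).prod (𝓡 r)) (bundleMetric h.inner k.inner lam) := by
  intro x y hy
  refine (isBundlePoint_inChart h k hlam hy).isMetricPoint.congr ?_
  have : IsManifold (𝓡 r) ∞ H := LieGroup.toContMDiffMul.toIsManifold
  filter_upwards [(isOpen_extChartAt_target (I := (𝓡 n).prod (𝓡 r)) x).mem_nhds hy] with z hz
  exact inChart_bundleMetric h.inner k.inner lam hz

/-- The fiber form has disappeared from the local curvature formula, which is why the scalar
curvature is a function on the base. -/
theorem scalarCurvature_bundleMetric
    (hlam : IsSmoothOneForm (𝓡 n) (F := EuclideanSpace ℝ (Fin r)) lam) (x : N × H)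
    {ι : Type*} [Fintype ι] [DecidableEq ι] (f : Module.Basis ι ℝ (EuclideanSpace ℝ (Fin n)))
    (hf : ∀ i j, inChart (𝓡 n) h.inner x.1 (extChartAt (𝓡 n) x.1 x.1) (f i) (f j) =
      if i = j then 1 else 0) :
    scalarCurvature ((𝓡 n).prod (𝓡 r)) (bundleMetric h.inner k.inner lam) x =
      scalarCurvature (𝓡 n) h.inner x.1 - 1 / 4 * ∑ i, ∑ j, lieAlgebraMetric k
        (oneFormCurl (oneFormInChart (𝓡 n) (F := EuclideanSpace ℝ (Fin r)) lam x.1)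
          (extChartAt (𝓡 n) x.1 x.1) (f i) (f j))
        (oneFormCurl (oneFormInChart (𝓡 n) (F := EuclideanSpace ℝ (Fin r)) lam x.1)
          (extChartAt (𝓡 n) x.1 x.1) (f i) (f j)) := by
  have hx := mem_extChartAt_target (I := (𝓡 n).prod (𝓡 r)) x
  have hnhds := (isOpen_extChartAt_target (I := (𝓡 n).prod (𝓡 r)) x).mem_nhds hx
  have hfst : (extChartAt ((𝓡 n).prod (𝓡 r)) x x).1 = extChartAt (𝓡 n) x.1 x.1 := by
    rw [extChartAt_prod]; rfl
  unfold scalarCurvature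
  rw [scalarCurvatureOn_congr (G' := fun z => (sumMetric (inChart (𝓡 n) h.inner x.1)
      (lieAlgebraMetric k) z).bilinearComp
      (bundleFrame (oneFormInChart (𝓡 n) (F := EuclideanSpace ℝ (Fin r)) lam x.1)
        (oneFormInChart (𝓡 r) (maurerCartan (𝓡 r)) x.2) z)
      (bundleFrame (oneFormInChart (𝓡 n) (F := EuclideanSpace ℝ (Fin r)) lam x.1)
        (oneFormInChart (𝓡 r) (maurerCartan (𝓡 r)) x.2) z))
    (by filter_upwards [hnhds] with z hz using inChart_bundleMetric h.inner k.inner lam hz)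
    ((isMetricInCharts_bundleMetric h k hlam).eventually hx),
    IsBundlePoint.scalarCurvatureOn_bundle
      (by filter_upwards [hnhds] with z hz using isBundlePoint_inChart h k hlam hz) f
      (by rw [hfst]; exact hf), hfst]

end BundleMetric

/-! ### Field strength over a surface -/

section SurfaceBundle

set_option maxSynthPendingDepth 3
set_option linter.unusedSectionVars false

variable {r : ℕ}
  {N : Type*} [TopologicalSpace N] [ChartedSpace (EuclideanSpace ℝ (Fin 2)) N]
  [IsManifold (𝓡 2) ∞ N]
  {H : Type*} [TopologicalSpace H] [ChartedSpace (EuclideanSpace ℝ (Fin r)) H] [CommGroup H]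
  [LieGroup (𝓡 r) ∞ H]
  (h : ContMDiffRiemannianMetric (𝓡 2) ∞ (EuclideanSpace ℝ (Fin 2))
      (fun p : N => TangentSpace (𝓡 2) p))
  (k : ContMDiffRiemannianMetric (𝓡 r) ∞ (EuclideanSpace ℝ (Fin r))
      (fun z : H => TangentSpace (𝓡 r) z))
  {lam : ∀ p : N, TangentSpace (𝓡 2) p →L[ℝ] GroupLieAlgebra (𝓡 r) H}

/-- The real-valued 1-form `⟨λ(·), Z⟩`. -/
noncomputable def formComponent (lam : ∀ p : N, TangentSpace (𝓡 2) p →L[ℝ] GroupLieAlgebra (𝓡 r) H)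
    (Z : EuclideanSpace ℝ (Fin r)) (p : N) : TangentSpace (𝓡 2) p →L[ℝ] ℝ :=
  let l : TangentSpace (𝓡 2) p →L[ℝ] EuclideanSpace ℝ (Fin r) := lam p
  (lieAlgebraMetric k).flip Z ∘L l

theorem oneFormInChart_formComponent (Z : EuclideanSpace ℝ (Fin r)) (x : N) :
    oneFormInChart (𝓡 2) (formComponent k lam Z) x = fun y => (lieAlgebraMetric k).flip Z ∘L
      oneFormInChart (𝓡 2) (F := EuclideanSpace ℝ (Fin r)) lam x y := rfl

theorem contDiffAt_oneFormInChart_formComponent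
    (hlam : IsSmoothOneForm (𝓡 2) (F := EuclideanSpace ℝ (Fin r)) lam)
    (Z : EuclideanSpace ℝ (Fin r)) (x : N) (y) (hy : y ∈ (extChartAt (𝓡 2) x).target) :
    ContDiffAt ℝ ∞ (oneFormInChart (𝓡 2) (formComponent k lam Z) x) y := by
  rw [oneFormInChart_formComponent]
  exact contDiffAt_const.clm_comp (hlam.contDiffAt_oneFormInChart hy)

/-- The scalar curvature of a bundle metric over a surface, in terms of a vector field-strength
`v` whose components are, up to sign, the functions `*dλ_Z`. -/
theorem exists_fieldStrength (hlam : IsSmoothOneForm (𝓡 2) (F := EuclideanSpace ℝ (Fin r)) lam) :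
    ∃ v : N → EuclideanSpace ℝ (Fin r),
      (∀ x : N × H, scalarCurvature ((𝓡 2).prod (𝓡 r)) (bundleMetric h.inner k.inner lam) x =
        scalarCurvature (𝓡 2) h.inner x.1
          - 1 / 2 * lieAlgebraMetric k (v x.1) (v x.1)) ∧
      ∀ Z p, curlNormSq h.inner (formComponent k lam Z) p = lieAlgebraMetric k (v p) Z ^ 2 := by
  have hb : ∀ p : N, ∃ e : Module.Basis (Fin 2) ℝ (EuclideanSpace ℝ (Fin 2)), ∀ i j,
      inChart (𝓡 2) h.inner p (extChartAt (𝓡 2) p p) (e i) (e j) = if i = j then 1 else 0 := by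
    intro p
    have hm := h.isMetricInCharts p _ (mem_extChartAt_target p)
    exact exists_orthonormal_basis hm.symm hm.pos finrank_euclideanSpace_fin
  -- The bases are chosen point by point without any continuity, so `v` may jump in sign; only
  -- expressions quadratic in `v` are used.
  choose e he using hb
  refine ⟨fun p => oneFormCurl (oneFormInChart (𝓡 2) (F := EuclideanSpace ℝ (Fin r)) lam p)
    (extChartAt (𝓡 2) p p) (e p 0) (e p 1), fun x => ?_, fun Z p => ?_⟩
  · rw [scalarCurvature_bundleMetric h k hlam x (e x.1) (he x.1)]
    have hz : ∀ a, oneFormCurl (oneFormInChart (𝓡 2) (F := EuclideanSpace ℝ (Fin r)) lam x.1)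
      (extChartAt (𝓡 2) x.1 x.1) a a = 0 := fun a => by rw [oneFormCurl_apply, sub_self]
    -- Of the four index pairs two vanish and two agree, which turns `1/4` into `1/2`.
    simp only [Fin.sum_univ_two, hz, map_zero]
    rw [oneFormCurl_skew _ _ (e x.1 1) (e x.1 0)]
    simp only [map_neg, neg_apply]
    ring
  · rw [curlNormSq, (planeFormNormSq_eq (oneFormCurl_skew _ _) (he p)).2,
      oneFormInChart_formComponent, oneFormCurl_clm_comp
      ((hlam.contDiffAt_oneFormInChart (mem_extChartAt_target p)).differentiableAt (by simp))]
    rfl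

end SurfaceBundle

/-! ### Riemannian density -/

section Density

open scoped Topology

set_option maxSynthPendingDepth 3

variable {V : Type*} [NormedAddCommGroup V] [NormedSpace ℝ V] [FiniteDimensional ℝ V]

/-- The Gram matrix becomes `Aᵀ b A`. The density depends on the form at one point only, hence the
constant field and the free point `z`. -/
theorem volumeDensity_bilinearComp (G : V → V →L[ℝ] V →L[ℝ] ℝ) (y z : V) (b : V →L[ℝ] V →L[ℝ] ℝ)
    (A : V →L[ℝ] V) (h : G y = b.bilinearComp A A) :
    volumeDensity G y = |A.det| * volumeDensity (fun _ => b) z := by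
  have key : (Matrix.of fun i j => G y (Module.finBasis ℝ V i) (Module.finBasis ℝ V j)) =
      (LinearMap.toMatrix (Module.finBasis ℝ V) (Module.finBasis ℝ V) A.toLinearMap).transpose *
      (Matrix.of fun i j => b (Module.finBasis ℝ V i) (Module.finBasis ℝ V j)) *
      LinearMap.toMatrix (Module.finBasis ℝ V) (Module.finBasis ℝ V) A.toLinearMap := by
    ext i j
    rw [Matrix.of_apply, h, ContinuousLinearMap.bilinearComp_apply]
    have hA : ∀ j, A (Module.finBasis ℝ V j) = ∑ l, LinearMap.toMatrix (Module.finBasis ℝ V)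
        (Module.finBasis ℝ V) A.toLinearMap l j • Module.finBasis ℝ V l := by
      intro j
      conv_lhs => rw [← (Module.finBasis ℝ V).sum_repr (A (Module.finBasis ℝ V j))]
      simp only [LinearMap.toMatrix_apply]
      rfl
    rw [hA i, hA j]
    simp only [Matrix.mul_apply, map_sum, map_smul, sum_apply, smul_apply, smul_eq_mul,
      Matrix.transpose_apply, Matrix.of_apply, Finset.sum_mul, Finset.mul_sum]
    refine Finset.sum_congr rfl fun a _ => Finset.sum_congr rfl fun c _ => ?_
    ring
  unfold volumeDensity
  rw [key, Matrix.det_mul, Matrix.det_mul, Matrix.det_transpose, LinearMap.det_toMatrix,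
    mul_right_comm, abs_mul, ← sq, Real.sqrt_mul (abs_nonneg _), abs_pow, Real.sqrt_sq (abs_nonneg _)]

theorem IsMetricPoint.volumeDensity_pos {G : V → V →L[ℝ] V →L[ℝ] ℝ} {y : V}
    (hG : IsMetricPoint G y) : 0 < volumeDensity G y := by
  refine Real.sqrt_pos.2 (abs_pos.2 fun h => ?_)
  obtain ⟨v, hv, hv0⟩ := Matrix.exists_mulVec_eq_zero_iff.2 h
  have hw : ∑ i, v i • Module.finBasis ℝ V i ≠ 0 := by
    intro h0
    exact hv (funext fun i => Fintype.linearIndependent_iff.1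
      (Module.finBasis ℝ V).linearIndependent v h0 i)
  refine (hG.pos _ hw).ne' ?_
  have h1 : ∀ i, G y (Module.finBasis ℝ V i) (∑ j, v j • Module.finBasis ℝ V j) = 0 := by
    intro i
    have := congrFun hv0 i
    simpa [Matrix.mulVec, dotProduct, mul_comm] using this
  rw [map_sum (G y), sum_apply]
  refine Finset.sum_eq_zero fun i _ => ?_
  rw [map_smul, smul_apply, h1, smul_zero]

theorem continuousAt_volumeDensity {G : V → V →L[ℝ] V →L[ℝ] ℝ} {y : V}
    (hG : ContinuousAt G y) : ContinuousAt (volumeDensity G) y := by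
  unfold volumeDensity
  refine (Real.continuous_sqrt.continuousAt.comp (continuous_abs.continuousAt.comp ?_))
  simp only [Matrix.det_apply]
  refine tendsto_finsetSum _ fun s _ => ContinuousAt.const_smul ?_ _
  refine tendsto_finsetProd _ fun i _ => ?_
  exact ((hG.clm_apply continuousAt_const).clm_apply continuousAt_const)

end Density

/-! ### The Riemannian measure and its invariance -/

section Volume

open scoped Topology

set_option maxSynthPendingDepth 3
set_option linter.unusedSectionVars false

variable {V : Type*} [NormedAddCommGroup V] [NormedSpace ℝ V] [FiniteDimensional ℝ V]
  [MeasurableSpace V] [BorelSpace V]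
  {B : Type*} [TopologicalSpace B] {I : ModelWithCorners ℝ V B} [I.Boundaryless]
  {M : Type*} [TopologicalSpace M] [ChartedSpace B M] [IsManifold I ∞ M]
  [MeasurableSpace M] [BorelSpace M]
  {g g' : ∀ p : M, TangentSpace I p →L[ℝ] TangentSpace I p →L[ℝ] ℝ}
  {f : M ≃ₘ^∞⟮I, I⟯ M} {x x' : M} {A : Set M}

theorem measurableSet_preimage_extChartAt_symm (x : M) (hA : MeasurableSet A) :
    MeasurableSet ((extChartAt I x).symm ⁻¹' A ∩ (extChartAt I x).target) := by
  have h1 : Continuous ((extChartAt I x).target.domRestrict (extChartAt I x).symm) :=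
    (continuousOn_extChartAt_symm x).domRestrict
  have h2 := (MeasurableEmbedding.subtype_coe
    (isOpen_extChartAt_target (I := I) x).measurableSet).measurableSet_image.2 (h1.measurable hA)
  convert h2 using 1
  ext y
  constructor
  · rintro ⟨h1, h2⟩
    exact ⟨⟨y, h2⟩, h1, rfl⟩
  · rintro ⟨z, h1, rfl⟩
    exact ⟨h1, z.2⟩

theorem chartVolume_apply (g : ∀ p : M, TangentSpace I p →L[ℝ] TangentSpace I p →L[ℝ] ℝ) (x : M)
    (hA : MeasurableSet A) :
    chartVolume I g x A = ∫⁻ y in (extChartAt I x).symm ⁻¹' A ∩ (extChartAt I x).target,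
      ENNReal.ofReal (volumeDensity (inChart I g x) y) ∂(Module.finBasis ℝ V).addHaar := by
  have ht := (isOpen_extChartAt_target (I := I) x).measurableSet
  rw [chartVolume, Measure.map_apply_of_aemeasurable _ hA, withDensity_apply',
    Measure.restrict_restrict' ht]
  exact ((continuousOn_extChartAt_symm x).aemeasurable ht).mono_ac
    (withDensity_absolutelyContinuous _ _)

theorem chartVolume_congr (h : ∀ y ∈ (extChartAt I x).target,
    volumeDensity (inChart I g x) y = volumeDensity (inChart I g' x) y) :
    chartVolume I g x = chartVolume I g' x := by
  unfold chartVolume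
  congr 1
  refine withDensity_congr_ae ?_
  filter_upwards [ae_restrict_mem (isOpen_extChartAt_target (I := I) x).measurableSet] with y hy
  rw [h y hy]

/-- The change of variables formula for the chart measures, under an isometry. -/
theorem IsRiemannianIsometry.chartVolume_preimage (hf : IsRiemannianIsometry I g f)
    (hA : MeasurableSet A) (hAs : A ⊆ (extChartAt I x').source) :
    chartVolume I g x (f ⁻¹' A) = chartVolume I g x' (A ∩ f '' (extChartAt I x).source) := by
  have hfm : Measurable f := f.continuous.measurable
  have hfi : MeasurableSet (f '' (extChartAt I x).source) := by
    have := f.toHomeomorph.isOpenMap _ (isOpen_extChartAt_source (I := I) x)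
    exact this.measurableSet
  rw [chartVolume_apply g x (hfm hA), chartVolume_apply g x' (hA.inter hfi)]
  set D := (extChartAt I x).symm ⁻¹' (f ⁻¹' A) ∩ (extChartAt I x).target with hD
  have hDm : MeasurableSet D := measurableSet_preimage_extChartAt_symm x (hfm hA)
  have hDs : ∀ y ∈ D, f ((extChartAt I x).symm y) ∈ (extChartAt I x').source :=
    fun y hy => hAs hy.1
  -- The transition map carries one domain of integration onto the other, so the change of variables
  -- leaves no remainder.
  have himg : mapInCharts I f x x' '' D = (extChartAt I x').symm ⁻¹'
      (A ∩ f '' (extChartAt I x).source) ∩ (extChartAt I x').target := by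
    ext z
    constructor
    · rintro ⟨y, hy, rfl⟩
      refine ⟨?_, mapInCharts_mem_target (hDs y hy)⟩
      rw [mem_preimage, extChartAt_symm_mapInCharts (hDs y hy)]
      exact ⟨hy.1, mem_image_of_mem _ ((extChartAt I x).map_target hy.2)⟩
    · rintro ⟨⟨hz1, q, hq, hqz⟩, hz2⟩
      have hl := (extChartAt I x).left_inv hq
      refine ⟨extChartAt I x q, ⟨?_, (extChartAt I x).map_source hq⟩, ?_⟩
      · rw [mem_preimage, mem_preimage, hl, hqz]
        exact hz1
      · rw [mapInCharts, Function.comp_apply, Function.comp_apply, hl, hqz]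
        exact (extChartAt I x').right_inv hz2
  have hinj : InjOn (mapInCharts I f x x') D := by
    intro y hy z hz hyz
    have h1 := extChartAt_symm_mapInCharts (hDs y hy)
    have h2 := extChartAt_symm_mapInCharts (hDs z hz)
    rw [hyz, h2] at h1
    exact (extChartAt I x).symm.injOn hy.2 hz.2 (f.injective h1.symm)
  rw [← himg, lintegral_image_eq_lintegral_abs_det_fderiv_mul _ hDm (fun y hy =>
    ((contDiffAt_mapInCharts hy.2 (hDs y hy)).differentiableAt
      (by simp)).hasFDerivAt.hasFDerivWithinAt) hinj]
  refine setLIntegral_congr_fun hDm fun y hy => ?_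
  rw [← ENNReal.ofReal_mul (abs_nonneg _),
    volumeDensity_bilinearComp _ y (mapInCharts I f x x' y) _ _ (hf.inChart_eq hy.2 (hDs y hy))]
  rfl

/-- The case `f = id` of the change of variables: the chart at `x` sees a part of `A`, the chart at
`x'` all of it. -/
theorem chartVolume_le_of_subset (hA : MeasurableSet A) (hAs : A ⊆ (extChartAt I x').source) :
    chartVolume I g x A ≤ chartVolume I g x' A := by
  have := (isRiemannianIsometry_refl g).chartVolume_preimage (x := x) hA hAs
  exact this.trans_le (measure_mono inter_subset_left)

/-- A supremum of measures is hard to evaluate directly. It is bounded by any measure above all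
`chartVolume`s; here this is the one at `x'` plus the supremum itself restricted to the complement
of the chart domain, and the second summand vanishes on `A`. -/
theorem riemannianVolume_apply_of_subset (hA : MeasurableSet A)
    (hAs : A ⊆ (extChartAt I x').source) : riemannianVolume I g A = chartVolume I g x' A := by
  refine le_antisymm ?_ (le_iSup (chartVolume I g) x' A)
  have hs := (isOpen_extChartAt_source (I := I) x').measurableSet
  have : riemannianVolume I g ≤ chartVolume I g x' +
      (riemannianVolume I g).restrict (extChartAt I x').sourceᶜ := by
    refine iSup_le fun x => Measure.le_iff.2 fun C hC => ?_
    rw [← measure_inter_add_sdiff C hs, Measure.add_apply, Measure.restrict_apply hC]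
    refine add_le_add ?_ (le_iSup (chartVolume I g) x _)
    exact (chartVolume_le_of_subset (hC.inter hs) inter_subset_right).trans
      (measure_mono inter_subset_left)
  refine (this A).trans_eq ?_
  rw [Measure.add_apply, Measure.restrict_apply hA, ← sdiff_eq, sdiff_eq_empty.2 hAs, measure_empty,
    add_zero]

/-- Isometries preserve the Riemannian measure. -/
theorem IsRiemannianIsometry.map_riemannianVolume [CompactSpace M]
    (hf : IsRiemannianIsometry I g f) : (riemannianVolume I g).map f = riemannianVolume I g := by
  have hfm : Measurable f := f.continuous.measurable
  obtain ⟨s, hs, hsU⟩ := countable_cover_nhds_of_sigmaCompact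
    (fun x : M => extChartAt_source_mem_nhds (I := I) x)
  have : Countable s := hs.to_subtype
  -- On each of these countably many pieces both a set and its preimage lie in a single chart.
  have hcov : ⋃ i : s × s, (extChartAt I (i.1 : M)).source ∩
      f '' (extChartAt I (i.2 : M)).source = univ := by
    rw [eq_univ_iff_forall] at hsU ⊢
    intro p
    obtain ⟨a, ha, hpa⟩ := mem_iUnion₂.1 (hsU p)
    obtain ⟨b, hb, hpb⟩ := mem_iUnion₂.1 (hsU (f.symm p))
    exact mem_iUnion.2 ⟨(⟨a, ha⟩, ⟨b, hb⟩), hpa, _, hpb, f.apply_symm_apply p⟩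
  refine Measure.ext_of_iUnion_eq_univ hcov fun i => ?_
  ext A hA
  have hfi : MeasurableSet (f '' (extChartAt I (i.2 : M)).source) := by
    have := f.toHomeomorph.isOpenMap _ (isOpen_extChartAt_source (I := I) (i.2 : M))
    exact this.measurableSet
  have hm := (isOpen_extChartAt_source (I := I) (i.1 : M)).measurableSet.inter hfi
  rw [Measure.restrict_apply hA, Measure.restrict_apply hA, Measure.map_apply hfm (hA.inter hm)]
  set C := A ∩ ((extChartAt I (i.1 : M)).source ∩ f '' (extChartAt I (i.2 : M)).source)
  have hC : MeasurableSet C := hA.inter hm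
  have h1 : C ⊆ (extChartAt I (i.1 : M)).source := fun p hp => hp.2.1
  have h2 : C ⊆ f '' (extChartAt I (i.2 : M)).source := fun p hp => hp.2.2
  have h3 : f ⁻¹' C ⊆ (extChartAt I (i.2 : M)).source := by
    intro p hp
    obtain ⟨q, hq, hqp⟩ := h2 hp
    rwa [← f.injective hqp]
  rw [riemannianVolume_apply_of_subset hC h1, riemannianVolume_apply_of_subset (hfm hC) h3,
    hf.chartVolume_preimage hC h1, inter_eq_self_of_subset_left h2]

/-- The density is bounded near each point, so the measure is locally finite, and the manifold is
compact. -/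
theorem IsMetricInCharts.isFiniteMeasure_riemannianVolume [CompactSpace M]
    (hg : IsMetricInCharts I g) : IsFiniteMeasure (riemannianVolume I g) := by
  have : IsLocallyFiniteMeasure (riemannianVolume I g) := by
    refine ⟨fun p => ?_⟩
    have hyt := mem_extChartAt_target (I := I) p
    have hc := continuousAt_volumeDensity (hg p _ hyt).smooth.continuousAt
    obtain ⟨U, hU, hUf⟩ := (Module.finBasis ℝ V).addHaar.finiteAt_nhds (extChartAt I p p)
    obtain ⟨W, hW, hWo, hpW⟩ := mem_nhds_iff.1 (Filter.inter_mem hU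
      (hc.eventually (Iio_mem_nhds (lt_add_one _))))
    have hop := (continuousOn_extChartAt (I := I) p).isOpen_inter_preimage
      (isOpen_extChartAt_source p) hWo
    refine ⟨_, hop.mem_nhds ⟨mem_extChartAt_source p, hpW⟩, ?_⟩
    rw [riemannianVolume_apply_of_subset hop.measurableSet inter_subset_left,
      chartVolume_apply _ _ hop.measurableSet]
    have hsub : (extChartAt I p).symm ⁻¹' ((extChartAt I p).source ∩ extChartAt I p ⁻¹' W) ∩
        (extChartAt I p).target ⊆ W := by
      rintro y ⟨⟨-, hy⟩, hy2⟩
      rwa [mem_preimage, (extChartAt I p).right_inv hy2] at hy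
    refine (lintegral_mono_set hsub).trans_lt ?_
    refine (setLIntegral_mono' hWo.measurableSet (g := fun _ => ENNReal.ofReal
      (volumeDensity (inChart I g p) (extChartAt I p p) + 1)) fun y hy =>
        ENNReal.ofReal_le_ofReal (hW hy).2.le).trans_lt ?_
    rw [setLIntegral_const]
    exact ENNReal.mul_lt_top ENNReal.ofReal_lt_top
      ((measure_mono fun y hy => (hW hy).1).trans_lt hUf)
  infer_instance

theorem IsMetricInCharts.isOpenPosMeasure_riemannianVolume
    (hg : IsMetricInCharts I g) : (riemannianVolume I g).IsOpenPosMeasure := by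
  refine ⟨fun U hU ⟨p, hp⟩ h0 => ?_⟩
  have hyt := mem_extChartAt_target (I := I) p
  have hG := hg p _ hyt
  have hpos := hG.volumeDensity_pos
  have hc := continuousAt_volumeDensity hG.smooth.continuousAt
  have hd : (extChartAt I p).symm ⁻¹' U ∈ 𝓝 (extChartAt I p p) := by
    refine (contMDiffAt_extChartAt_symm hyt).continuousAt.preimage_mem_nhds ?_
    rw [extChartAt_to_inv]
    exact hU.mem_nhds hp
  obtain ⟨W, hW, hWo, hpW⟩ := mem_nhds_iff.1 (Filter.inter_mem (Filter.inter_mem hd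
    ((isOpen_extChartAt_target (I := I) p).mem_nhds hyt))
      (hc.eventually (lt_mem_nhds (half_lt_self hpos))))
  have h1 : chartVolume I g p U = 0 := le_antisymm
    ((le_iSup (chartVolume I g) p U).trans_eq h0) zero_le
  rw [chartVolume_apply _ _ hU.measurableSet] at h1
  have h2 : ∫⁻ y in W, ENNReal.ofReal
      (volumeDensity (inChart I g p) (extChartAt I p p) / 2) ∂(Module.finBasis ℝ V).addHaar ≤ 0 :=
    ((setLIntegral_mono' hWo.measurableSet fun y hy =>
        ENNReal.ofReal_le_ofReal (le_of_lt (hW hy).2)).trans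
      (lintegral_mono_set fun y hy => (hW hy).1)).trans_eq h1
  rw [setLIntegral_const, nonpos_iff_eq_zero, mul_eq_zero, ENNReal.ofReal_eq_zero] at h2
  rcases h2 with h2 | h2
  · linarith
  · exact hWo.measure_ne_zero _ ⟨_, hpW⟩ h2

end Volume

/-! ### Determinant of a shear -/

section Shear

variable {E F : Type*} [NormedAddCommGroup E] [NormedSpace ℝ E]
  [NormedAddCommGroup F] [NormedSpace ℝ F]

/-- The reflection `D` of the second factor conjugates the shear to its inverse. Multiplicativity of
the determinant then forces its square to be one, with no block matrices. -/
theorem abs_det_shear (a : E →L[ℝ] F) :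
    |((ContinuousLinearMap.fst ℝ E F).prod (a.coprod (ContinuousLinearMap.id ℝ F))).det| = 1 := by
  set S : (E →L[ℝ] F) → (E × F →L[ℝ] E × F) := fun a =>
    (ContinuousLinearMap.fst ℝ E F).prod (a.coprod (ContinuousLinearMap.id ℝ F)) with hS
  set D : E × F →L[ℝ] E × F := (ContinuousLinearMap.fst ℝ E F).prod
    (-ContinuousLinearMap.snd ℝ E F) with hD
  have hmul : ∀ P Q : E × F →L[ℝ] E × F, (P * Q).det = P.det * Q.det := fun P Q => by
    change LinearMap.det ((P * Q : E × F →L[ℝ] E × F) : E × F →ₗ[ℝ] E × F) = _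
    rw [ContinuousLinearMap.toLinearMap_mul, map_mul]
  have hone : (1 : E × F →L[ℝ] E × F).det = 1 := by
    change LinearMap.det ((1 : E × F →L[ℝ] E × F) : E × F →ₗ[ℝ] E × F) = _
    rw [ContinuousLinearMap.toLinearMap_one, map_one]
  have h1 : D * D = 1 := by
    ext v <;> simp [hD]
  have h2 : S a * (D * S a * D) = 1 := by
    ext v <;> simp [hD, hS]
  have h1' := congrArg ContinuousLinearMap.det h1
  have h2' := congrArg ContinuousLinearMap.det h2
  simp only [hmul, hone] at h1' h2'
  have h3 : (S a).det ^ 2 = 1 := by linear_combination h2' - (S a).det ^ 2 * h1'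
  change |(S a).det| = 1
  exact (pow_eq_one_iff_of_nonneg (abs_nonneg _) two_ne_zero).1 (by rw [sq_abs, h3])

end Shear

/-! ### The volume of `g_λ` -/

section BundleVolume

open scoped Topology

set_option maxSynthPendingDepth 3
set_option linter.unusedSectionVars false

variable {n r : ℕ}
  {N : Type*} [TopologicalSpace N] [ChartedSpace (EuclideanSpace ℝ (Fin n)) N]
  [IsManifold (𝓡 n) ∞ N]
  {H : Type*} [TopologicalSpace H] [ChartedSpace (EuclideanSpace ℝ (Fin r)) H] [CommGroup H]
  [LieGroup (𝓡 r) ∞ H]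
  (h : ∀ p : N, TangentSpace (𝓡 n) p →L[ℝ] TangentSpace (𝓡 n) p →L[ℝ] ℝ)
  (k : ∀ z : H, TangentSpace (𝓡 r) z →L[ℝ] TangentSpace (𝓡 r) z →L[ℝ] ℝ)
  (lam lam' : ∀ p : N, TangentSpace (𝓡 n) p →L[ℝ] GroupLieAlgebra (𝓡 r) H)

/-- The coframe of `α` is the coframe of `0` followed by a shear. -/
theorem abs_det_bundleFrame {E F : Type*} [NormedAddCommGroup E] [NormedSpace ℝ E]
    [NormedAddCommGroup F] [NormedSpace ℝ F]
    (α : E → E →L[ℝ] F) (θ : F → F →L[ℝ] F) (y : E × F) :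
    |(bundleFrame α θ y).det| = |(bundleFrame 0 θ y).det| := by
  have h1 : bundleFrame α θ y = ((ContinuousLinearMap.fst ℝ E F).prod
      ((α y.1).coprod (ContinuousLinearMap.id ℝ F))) * bundleFrame 0 θ y := by
    ext v <;> simp [bundleFrame_apply]
  have h2 : ∀ P Q : E × F →L[ℝ] E × F, (P * Q).det = P.det * Q.det := fun P Q => by
    change LinearMap.det ((P * Q : E × F →L[ℝ] E × F) : E × F →ₗ[ℝ] E × F) = _
    rw [ContinuousLinearMap.toLinearMap_mul, map_mul]
  rw [h1, h2, abs_mul, abs_det_shear, one_mul]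

/-- The Riemannian measure of `g_λ` does not depend on `λ`. -/
theorem riemannianVolume_bundleMetric_eq [MeasurableSpace N] [MeasurableSpace H]
    [BorelSpace (N × H)] :
    riemannianVolume ((𝓡 n).prod (𝓡 r)) (bundleMetric h k lam) =
      riemannianVolume ((𝓡 n).prod (𝓡 r)) (bundleMetric h k lam') := by
  have : IsManifold (𝓡 r) ∞ H := LieGroup.toContMDiffMul.toIsManifold
  refine iSup_congr fun x => chartVolume_congr fun y hy => ?_
  rw [volumeDensity_bilinearComp _ y y _ _ (inChart_bundleMetric h k lam hy),
    volumeDensity_bilinearComp _ y y _ _ (inChart_bundleMetric h k lam' hy),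
    abs_det_bundleFrame, ← abs_det_bundleFrame (oneFormInChart (𝓡 n) lam' x.1)]

theorem connectionForm_zero_apply (q : N × H) (ξ : TangentSpace ((𝓡 n).prod (𝓡 r)) q) :
    connectionForm (0 : ∀ p : N, TangentSpace (𝓡 n) p →L[ℝ] GroupLieAlgebra (𝓡 r) H) q ξ =
      maurerCartan (𝓡 r) q.2
        (mfderiv ((𝓡 n).prod (𝓡 r)) (𝓡 r) (Prod.snd : N × H → H) q ξ) :=
  zero_add (_ : EuclideanSpace ℝ (Fin r))

/-- `f × id` need not be an isometry of `g_λ`, but it is one of the product metric `λ = 0`, which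
has the same volume. -/
theorem IsRiemannianIsometry.prodCongr_refl {f : N ≃ₘ^∞⟮𝓡 n, 𝓡 n⟯ N}
    (hf : IsRiemannianIsometry (𝓡 n) h f) :
    IsRiemannianIsometry ((𝓡 n).prod (𝓡 r)) (bundleMetric h k
      (0 : ∀ p : N, TangentSpace (𝓡 n) p →L[ℝ] GroupLieAlgebra (𝓡 r) H))
      (f.prodCongr (Diffeomorph.refl (𝓡 r) H ∞)) := by
  have : IsManifold (𝓡 r) ∞ H := LieGroup.toContMDiffMul.toIsManifold
  intro q X Y
  set F := f.prodCongr (Diffeomorph.refl (𝓡 r) H ∞)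
  have hF : MDifferentiableAt ((𝓡 n).prod (𝓡 r)) ((𝓡 n).prod (𝓡 r)) F q :=
    (F.contMDiff q).mdifferentiableAt (by simp)
  have h1 : ∀ X : TangentSpace ((𝓡 n).prod (𝓡 r)) q,
      mfderiv ((𝓡 n).prod (𝓡 r)) (𝓡 n) (Prod.fst : N × H → N) (F q)
        (mfderiv ((𝓡 n).prod (𝓡 r)) ((𝓡 n).prod (𝓡 r)) F q X) =
      mfderiv (𝓡 n) (𝓡 n) f q.1 (mfderiv ((𝓡 n).prod (𝓡 r)) (𝓡 n) (Prod.fst : N × H → N) q X) := by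
    intro X
    exact (mfderiv_comp_apply q mdifferentiableAt_fst hF X).symm.trans
      (mfderiv_comp_apply q ((f.contMDiff q.1).mdifferentiableAt (by simp))
        mdifferentiableAt_fst X)
  have h2 : ∀ X : TangentSpace ((𝓡 n).prod (𝓡 r)) q,
      mfderiv ((𝓡 n).prod (𝓡 r)) (𝓡 r) (Prod.snd : N × H → H) (F q)
        (mfderiv ((𝓡 n).prod (𝓡 r)) ((𝓡 n).prod (𝓡 r)) F q X) =
      mfderiv ((𝓡 n).prod (𝓡 r)) (𝓡 r) (Prod.snd : N × H → H) q X :=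
    fun X => (mfderiv_comp_apply q mdifferentiableAt_snd hF X).symm
  rw [bundleMetric_apply, bundleMetric_apply, connectionForm_zero_apply, connectionForm_zero_apply,
    connectionForm_zero_apply, connectionForm_zero_apply, h1, h1, h2, h2]
  congr 1
  exact hf q.1 _ _

/-- The isometries of the base preserve the Riemannian measure of the total space. -/
theorem IsRiemannianIsometry.map_riemannianVolume_bundleMetric [CompactSpace N] [CompactSpace H]
    [MeasurableSpace N] [MeasurableSpace H] [BorelSpace (N × H)] {f : N ≃ₘ^∞⟮𝓡 n, 𝓡 n⟯ N}
    (hf : IsRiemannianIsometry (𝓡 n) h f) :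
    (riemannianVolume ((𝓡 n).prod (𝓡 r)) (bundleMetric h k lam)).map (Prod.map f id) =
      riemannianVolume ((𝓡 n).prod (𝓡 r)) (bundleMetric h k lam) := by
  have : IsManifold (𝓡 r) ∞ H := LieGroup.toContMDiffMul.toIsManifold
  rw [riemannianVolume_bundleMetric_eq h k lam 0]
  exact (IsRiemannianIsometry.prodCongr_refl h k hf).map_riemannianVolume

end BundleVolume

/-! ### Averaging powers of linear forms over directions -/

section Averaging

open scoped Topology RealInnerProductSpace

variable {E : Type*} [NormedAddCommGroup E]

/-- A radial weight with compact support. -/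
noncomputable def radialWeight (c : E) : ℝ := max 0 (1 - ‖c‖)

theorem continuous_radialWeight : Continuous (radialWeight : E → ℝ) :=
  continuous_const.max (continuous_const.sub continuous_norm)

theorem radialWeight_nonneg (c : E) : 0 ≤ radialWeight c := le_max_left _ _

theorem radialWeight_eq_zero {c : E} (hc : c ∉ Metric.closedBall (0 : E) 1) :
    radialWeight c = 0 := by
  rw [mem_closedBall_zero_iff, not_le] at hc
  exact max_eq_left (by linarith)

variable [InnerProductSpace ℝ E] [FiniteDimensional ℝ E]

theorem hasCompactSupport_radialWeight_mul (m : E → ℝ) :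
    HasCompactSupport fun c : E => radialWeight c * m c :=
  HasCompactSupport.intro (isCompact_closedBall (0 : E) 1) fun c hc => by
    rw [radialWeight_eq_zero hc, zero_mul]

variable [MeasurableSpace E] [BorelSpace E]

theorem integral_radialWeight_inner_pow_map (T : E ≃ₗᵢ[ℝ] E) (w : E) (m : ℕ) :
    ∫ c, radialWeight c * ⟪T w, c⟫ ^ m = ∫ c, radialWeight c * ⟪w, c⟫ ^ m := by
  rw [← T.measurePreserving.integral_comp T.toHomeomorph.measurableEmbedding]
  simp [radialWeight]

/-- A reflection carries `‖w‖ • e` to `w` and preserves weight and measure; the factor `‖w‖ ^ m`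
then comes out by homogeneity. -/
theorem integral_radialWeight_inner_pow {e : E} (he : ‖e‖ = 1) (w : E) (m : ℕ) :
    ∫ c, radialWeight c * ⟪w, c⟫ ^ m = ‖w‖ ^ m * ∫ c, radialWeight c * ⟪e, c⟫ ^ m := by
  have hn : ‖‖w‖ • e‖ = ‖w‖ := by rw [norm_smul, he, norm_norm, mul_one]
  have h1 := integral_radialWeight_inner_pow_map
    (Submodule.reflection (ℝ ∙ (‖w‖ • e - w))ᗮ) (‖w‖ • e) m
  rw [Submodule.reflection_sub hn] at h1
  rw [h1, ← integral_const_mul]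
  congr 1 with c
  rw [inner_smul_left, mul_pow]
  simp
  ring

theorem integral_radialWeight_inner_pow_pos {e : E} (he : ‖e‖ = 1) (b : ℕ) :
    0 < ∫ c, radialWeight c * ⟪e, c⟫ ^ (2 * b) := by
  have hpos : radialWeight ((1 / 2 : ℝ) • e) * ⟪e, (1 / 2 : ℝ) • e⟫ ^ (2 * b) ≠ 0 := by
    rw [radialWeight, inner_smul_right, real_inner_self_eq_norm_sq, norm_smul, he]
    norm_num
  refine Continuous.integral_pos_of_hasCompactSupport_nonneg_nonzero
    (continuous_radialWeight.mul (by fun_prop)) (hasCompactSupport_radialWeight_mul _)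
    (fun c => mul_nonneg (radialWeight_nonneg c) ?_) hpos
  rw [pow_mul]
  positivity

end Averaging

/-! ### Moments, ranges and the averaging argument -/

section Moments

open scoped Topology RealInnerProductSpace

variable {X : Type*} [TopologicalSpace X] {r : ℕ}

/-- Since `w` is controlled only up to sign, continuity is assumed for squared components alone.
Polarization makes the products `w i * w j` continuous, and joint continuity follows. -/
theorem continuous_inner_sq {w : X → EuclideanSpace ℝ (Fin r)}
    (hw : ∀ c, Continuous fun p => ⟪w p, c⟫ ^ 2) :
    Continuous fun q : X × EuclideanSpace ℝ (Fin r) => ⟪w q.1, q.2⟫ ^ 2 := by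
  have h1 : ∀ i j, Continuous fun p => w p i * w p j := by
    intro i j
    have h2 : (fun p => w p i * w p j) = fun p =>
        (⟪w p, EuclideanSpace.single i 1 + EuclideanSpace.single j 1⟫ ^ 2 -
          ⟪w p, EuclideanSpace.single i 1⟫ ^ 2 - ⟪w p, EuclideanSpace.single j 1⟫ ^ 2) / 2 := by
      funext p
      simp only [inner_add_right, EuclideanSpace.inner_single_right, one_mul]
      simp
      ring
    rw [h2]
    exact (((hw _).sub (hw _)).sub (hw _)).div_const 2
  have h3 : (fun q : X × EuclideanSpace ℝ (Fin r) => ⟪w q.1, q.2⟫ ^ 2) =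
      fun q => ∑ i, ∑ j, (w q.1 i * w q.1 j) * (q.2 i * q.2 j) := by
    funext q
    rw [PiLp.inner_apply, sq, Finset.sum_mul_sum]
    refine Finset.sum_congr rfl fun i _ => Finset.sum_congr rfl fun j _ => ?_
    simp
    ring
  rw [h3]
  refine continuous_finsetSum _ fun i _ => continuous_finsetSum _ fun j _ => ?_
  exact ((h1 i j).comp continuous_fst).mul (by fun_prop)

theorem continuous_norm_sq_of_inner_sq {w : X → EuclideanSpace ℝ (Fin r)}
    (hw : ∀ c, Continuous fun p => ⟪w p, c⟫ ^ 2) : Continuous fun p => ‖w p‖ ^ 2 := by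
  have : (fun p => ‖w p‖ ^ 2) = fun p => ∑ i, ⟪w p, EuclideanSpace.single i 1⟫ ^ 2 := by
    funext p
    rw [EuclideanSpace.norm_sq_eq]
    simp [EuclideanSpace.inner_single_right]
  rw [this]
  exact continuous_finsetSum _ fun i _ => hw _

variable [CompactSpace X] [MeasurableSpace X] [BorelSpace X]
  {μ : Measure X} [IsFiniteMeasure μ]

theorem Continuous.integrable_of_compactSpace {φ : X → ℝ} (hφ : Continuous φ) : Integrable φ μ :=
  hφ.integrable_of_hasCompactSupport (HasCompactSupport.of_compactSpace φ)

/-- Weierstrass approximation on an interval containing both compact ranges. -/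
theorem integral_comp_eq_of_integral_pow_eq {s s' : X → ℝ} (hs : Continuous s)
    (hs' : Continuous s') (h : ∀ j : ℕ, ∫ p, s p ^ j ∂μ = ∫ p, s' p ^ j ∂μ) {φ : ℝ → ℝ}
    (hφ : Continuous φ) : ∫ p, φ (s p) ∂μ = ∫ p, φ (s' p) ∂μ := by
  have hP : ∀ P : Polynomial ℝ, ∫ p, P.eval (s p) ∂μ = ∫ p, P.eval (s' p) ∂μ := by
    intro P
    simp only [Polynomial.eval_eq_sum_range]
    have hi : ∀ s : X → ℝ, Continuous s → ∀ i, Integrable (fun p => P.coeff i * s p ^ i) μ :=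
      fun s hs i => (continuous_const.mul (hs.pow i)).integrable_of_compactSpace
    rw [integral_finsetSum _ fun i _ => hi s hs i, integral_finsetSum _ fun i _ => hi s' hs' i]
    simp only [integral_const_mul, h]
  obtain ⟨R, hR⟩ := ((isCompact_range hs).union (isCompact_range hs')).isBounded.subset_closedBall 0
  rw [Real.closedBall_eq_Icc, zero_sub, zero_add] at hR
  have bound : ∀ s : X → ℝ, Continuous s → (∀ p, s p ∈ Icc (-R) R) → ∀ ε > 0, ∀ P : Polynomial ℝ,
      (∀ x ∈ Icc (-R) R, |P.eval x - φ x| < ε) →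
      |∫ p, P.eval (s p) ∂μ - ∫ p, φ (s p) ∂μ| ≤ ε * μ.real univ := by
    intro s hs hsR ε hε P hPε
    have hi : Integrable (fun p => P.eval (s p)) μ :=
      (P.continuous.comp hs).integrable_of_compactSpace
    have hi' : Integrable (fun p => φ (s p)) μ := (hφ.comp hs).integrable_of_compactSpace
    rw [← integral_sub hi hi', ← Real.norm_eq_abs]
    exact norm_integral_le_of_norm_le_const (Filter.Eventually.of_forall fun p =>
      (hPε _ (hsR p)).le)
  refine eq_of_forall_dist_le fun ε hε => ?_
  -- The summand `1` covers the case of zero total mass.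
  have hμ : 0 < 2 * (μ.real univ + 1) := by positivity
  obtain ⟨P, hPε⟩ := exists_polynomial_near_of_continuousOn (-R) R φ hφ.continuousOn
    (ε / (2 * (μ.real univ + 1))) (by positivity)
  have h1 := bound s hs (fun p => hR (Or.inl ⟨p, rfl⟩)) _ (by positivity) P hPε
  have h2 := bound s' hs' (fun p => hR (Or.inr ⟨p, rfl⟩)) _ (by positivity) P hPε
  rw [hP P] at h1
  have h3 : ε / (2 * (μ.real univ + 1)) * μ.real univ ≤ ε / 2 := by
    rw [div_mul_eq_mul_div, div_le_div_iff₀ hμ two_pos]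
    nlinarith [measureReal_nonneg (μ := μ) (s := univ)]
  rw [Real.dist_eq, abs_sub_le_iff]
  rw [abs_sub_le_iff] at h1 h2
  constructor <;> linarith [h1.1, h1.2, h2.1, h2.2]

/-- If `s p` were missing from the closed range of `s'`, a tent function at `s p` would vanish along
`s'` but have a positive integral along `s`. -/
theorem range_subset_of_integral_pow_eq [μ.IsOpenPosMeasure] {s s' : X → ℝ} (hs : Continuous s)
    (hs' : Continuous s') (h : ∀ j : ℕ, ∫ p, s p ^ j ∂μ = ∫ p, s' p ^ j ∂μ) :
    range s ⊆ range s' := by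
  rintro _ ⟨p, rfl⟩
  by_contra hp
  obtain ⟨ε, hε, hball⟩ := Metric.isOpen_iff.1 (isCompact_range hs').isClosed.isOpen_compl _ hp
  have hφ : Continuous fun u : ℝ => max 0 (ε - |u - s p|) := by fun_prop
  have h1 := integral_comp_eq_of_integral_pow_eq hs hs' h hφ
  have h2 : ∀ q, max 0 (ε - |s' q - s p|) = 0 := by
    intro q
    refine max_eq_left ?_
    by_contra hq
    refine hball (a := s' q) ?_ ⟨q, rfl⟩
    rw [Metric.mem_ball, Real.dist_eq]
    linarith
  simp only [h2, integral_zero] at h1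
  refine (Continuous.integral_pos_of_hasCompactSupport_nonneg_nonzero (μ := μ) (hφ.comp hs)
    (HasCompactSupport.of_compactSpace _) (fun q => le_max_left _ _) (x := p) ?_).ne' h1
  simp [hε.ne', hε.le]

theorem range_eq_of_integral_pow_eq [μ.IsOpenPosMeasure] {s s' : X → ℝ} (hs : Continuous s)
    (hs' : Continuous s') (h : ∀ j : ℕ, ∫ p, s p ^ j ∂μ = ∫ p, s' p ^ j ∂μ) :
    range s = range s' :=
  (range_subset_of_integral_pow_eq hs hs' h).antisymm
    (range_subset_of_integral_pow_eq hs' hs fun j => (h j).symm)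

variable [R1Space X]

/-- Fubini, with the radial weight supplying the compact support in the direction variable. -/
theorem integral_mul_norm_pow_average {φ : X → ℝ} (hφ : Continuous φ)
    {w : X → EuclideanSpace ℝ (Fin r)} (hw : ∀ c, Continuous fun p => ⟪w p, c⟫ ^ 2)
    {e : EuclideanSpace ℝ (Fin r)} (he : ‖e‖ = 1) (b : ℕ) :
    (∫ p, φ p * (‖w p‖ ^ 2) ^ b ∂μ) * ∫ c, radialWeight c * ⟪e, c⟫ ^ (2 * b) =
      ∫ c, radialWeight c * ∫ p, φ p * (⟪w p, c⟫ ^ 2) ^ b ∂μ := by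
  have h1 : ∀ c, radialWeight c * ∫ p, φ p * (⟪w p, c⟫ ^ 2) ^ b ∂μ =
      ∫ p, radialWeight c * (φ p * (⟪w p, c⟫ ^ 2) ^ b) ∂μ := fun c => (integral_const_mul _ _).symm
  simp only [h1]
  rw [← integral_mul_const]
  have h2 : ∀ p, φ p * (‖w p‖ ^ 2) ^ b * ∫ c, radialWeight c * ⟪e, c⟫ ^ (2 * b) =
      ∫ c, radialWeight c * (φ p * (⟪w p, c⟫ ^ 2) ^ b) := by
    intro p
    rw [mul_assoc, ← pow_mul, ← integral_radialWeight_inner_pow he, ← integral_const_mul]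
    congr 1 with c
    rw [← pow_mul]
    ring
  simp only [h2]
  refine integral_integral_swap_of_hasCompactSupport
    (f := fun p c => radialWeight c * (φ p * (⟪w p, c⟫ ^ 2) ^ b)) ?_ ?_
  · exact (continuous_radialWeight.comp continuous_snd).mul
      ((hφ.comp continuous_fst).mul ((continuous_inner_sq hw).pow b))
  · refine HasCompactSupport.intro (isCompact_univ.prod
      (isCompact_closedBall (0 : EuclideanSpace ℝ (Fin r)) 1)) fun q hq => ?_
    have : q.2 ∉ Metric.closedBall (0 : EuclideanSpace ℝ (Fin r)) 1 := fun h => hq ⟨mem_univ _, h⟩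
    exact mul_eq_zero_of_left (radialWeight_eq_zero this) _

/-- If the squared components of `w` and `w'` in every direction are related by transformations
which preserve `μ` and `K`, then the mixed moments of `K` and the norms are equal. -/
theorem integral_pow_mul_norm_pow_eq {K : X → ℝ} (hK : Continuous K)
    {w w' : X → EuclideanSpace ℝ (Fin r)} (hw : ∀ c, Continuous fun p => ⟪w p, c⟫ ^ 2)
    (hw' : ∀ c, Continuous fun p => ⟪w' p, c⟫ ^ 2)
    (hF : ∀ c, ∃ F : X → X, Continuous F ∧ μ.map F = μ ∧ (∀ p, K (F p) = K p) ∧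
      ∀ p, ⟪w' p, c⟫ ^ 2 = ⟪w (F p), c⟫ ^ 2) (a b : ℕ) :
    ∫ p, K p ^ a * (‖w p‖ ^ 2) ^ b ∂μ = ∫ p, K p ^ a * (‖w' p‖ ^ 2) ^ b ∂μ := by
  -- For `r = 0` there is no unit vector `e` to normalize with.
  rcases subsingleton_or_nontrivial (EuclideanSpace ℝ (Fin r)) with hs | hs
  · rw [Subsingleton.elim w w']
  · obtain ⟨e, he⟩ := exists_norm_eq (EuclideanSpace ℝ (Fin r)) zero_le_one
    refine mul_right_cancel₀ (integral_radialWeight_inner_pow_pos he b).ne' ?_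
    rw [integral_mul_norm_pow_average (φ := fun p => K p ^ a) (hK.pow a) hw he,
      integral_mul_norm_pow_average (φ := fun p => K p ^ a) (hK.pow a) hw' he]
    congr 1 with c
    congr 1
    -- `F` may vary with `c` without any regularity: only the value of the inner integral at each
    -- `c` is compared.
    obtain ⟨F, hFc, hFμ, hFK, hFw⟩ := hF c
    have h1 := integral_map (μ := μ) hFc.measurable.aemeasurable
      (f := fun p => K p ^ a * (⟪w p, c⟫ ^ 2) ^ b)
      ((hK.pow a).mul ((hw c).pow b)).aestronglyMeasurable
    rw [hFμ] at h1
    rw [h1]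
    simp only [hFK, hFw]

/-- The binomial formula reduces the powers to the mixed moments. -/
theorem integral_sub_norm_sq_pow_eq {K : X → ℝ} (hK : Continuous K)
    {w w' : X → EuclideanSpace ℝ (Fin r)} (hw : ∀ c, Continuous fun p => ⟪w p, c⟫ ^ 2)
    (hw' : ∀ c, Continuous fun p => ⟪w' p, c⟫ ^ 2)
    (hF : ∀ c, ∃ F : X → X, Continuous F ∧ μ.map F = μ ∧ (∀ p, K (F p) = K p) ∧
      ∀ p, ⟪w' p, c⟫ ^ 2 = ⟪w (F p), c⟫ ^ 2) (t : ℝ) (j : ℕ) :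
    ∫ p, (K p - t * ‖w p‖ ^ 2) ^ j ∂μ = ∫ p, (K p - t * ‖w' p‖ ^ 2) ^ j ∂μ := by
  have key : ∀ w : X → EuclideanSpace ℝ (Fin r), (∀ c, Continuous fun p => ⟪w p, c⟫ ^ 2) →
      ∫ p, (K p - t * ‖w p‖ ^ 2) ^ j ∂μ = ∑ a ∈ Finset.range (j + 1),
        ((-t) ^ (j - a) * (j.choose a : ℝ)) * ∫ p, K p ^ a * (‖w p‖ ^ 2) ^ (j - a) ∂μ := by
    intro w hw
    simp only [← integral_const_mul]
    rw [← integral_finsetSum]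
    · congr 1 with p
      rw [sub_eq_add_neg, add_pow]
      refine Finset.sum_congr rfl fun a _ => ?_
      rw [← neg_mul, mul_pow]
      ring
    · intro a _
      exact (continuous_const.mul ((hK.pow a).mul
        ((continuous_norm_sq_of_inner_sq hw).pow _))).integrable_of_compactSpace
  rw [key w hw, key w' hw']
  refine Finset.sum_congr rfl fun a _ => ?_
  rw [integral_pow_mul_norm_pow_eq hK hw hw' hF]

end Moments

/-! ### Orthonormal coordinates on the Lie algebra -/

section Coordinates

open scoped RealInnerProductSpace

/-- Coordinates with respect to an orthonormal basis of a scalar product. -/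
theorem exists_orthonormal_coordinates {r : ℕ}
    {b : EuclideanSpace ℝ (Fin r) →L[ℝ] EuclideanSpace ℝ (Fin r) →L[ℝ] ℝ}
    (hs : ∀ u v, b u v = b v u) (hp : ∀ v, v ≠ 0 → 0 < b v v) :
    ∃ L Z : EuclideanSpace ℝ (Fin r) → EuclideanSpace ℝ (Fin r),
      (∀ v, ‖L v‖ ^ 2 = b v v) ∧ ∀ v c, ⟪L v, c⟫ = b v (Z c) := by
  obtain ⟨e, he⟩ := exists_orthonormal_basis hs hp finrank_euclideanSpace_fin
  refine ⟨fun v => WithLp.toLp 2 fun i => b v (e i), fun c => ∑ i, c i • e i, fun v => ?_,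
    fun v c => ?_⟩
  · rw [EuclideanSpace.norm_sq_eq, ← sum_sq_of_orthonormal e he v]
    simp
  · rw [PiLp.inner_apply, map_sum]
    simp

end Coordinates

/-! ### The theorem -/

section Main

open scoped RealInnerProductSpace

set_option maxSynthPendingDepth 3

theorem theorem2p11 {r : ℕ}
    -- the closed surface `(N, h)`
    {N : Type*} [TopologicalSpace N] [ChartedSpace (EuclideanSpace ℝ (Fin 2)) N]
    [IsManifold (𝓡 2) ∞ N] [CompactSpace N] [T2Space N] [MeasurableSpace N] [BorelSpace N]
    (h : ContMDiffRiemannianMetric (𝓡 2) ∞ (EuclideanSpace ℝ (Fin 2))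
      (fun p : N => TangentSpace (𝓡 2) p))
    -- the torus `H` with its invariant metric `k`
    {H : Type*} [TopologicalSpace H] [ChartedSpace (EuclideanSpace ℝ (Fin r)) H] [CommGroup H]
    [LieGroup (𝓡 r) ∞ H] [CompactSpace H] [T2Space H] [ConnectedSpace H]
    [MeasurableSpace H] [BorelSpace H]
    (k : ContMDiffRiemannianMetric (𝓡 r) ∞ (EuclideanSpace ℝ (Fin r))
      (fun z : H => TangentSpace (𝓡 r) z))
    (hk : IsLeftInvariantMetric (𝓡 r) k.inner)
    -- the two smooth 1-forms on `N` with values in the Lie algebra of `H`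
    (lam lam' : ∀ p : N, TangentSpace (𝓡 2) p →L[ℝ] GroupLieAlgebra (𝓡 r) H)
    (hlam : IsSmoothOneForm (𝓡 2) (F := EuclideanSpace ℝ (Fin r)) lam)
    (hlam' : IsSmoothOneForm (𝓡 2) (F := EuclideanSpace ℝ (Fin r)) lam')
    -- for every `Z` in the Lie algebra, `λ'_Z` is the pullback of `λ_Z` by some isometry
    (hiso : ∀ Z : GroupLieAlgebra (𝓡 r) H, ∃ f : N ≃ₘ^∞⟮𝓡 2, 𝓡 2⟯ N,
      IsRiemannianIsometry (𝓡 2) h.inner f ∧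
      ∀ (p : N) (X : TangentSpace (𝓡 2) p),
        k.inner 1 (lam' p X) Z = k.inner 1 (lam (f p) (mfderiv (𝓡 2) (𝓡 2) f p X)) Z) :
    let I := (𝓡 2).prod (𝓡 r)
    let g : ∀ q : N × H, TangentSpace I q →L[ℝ] TangentSpace I q →L[ℝ] ℝ :=
      bundleMetric h.inner k.inner lam
    let g' : ∀ q : N × H, TangentSpace I q →L[ℝ] TangentSpace I q →L[ℝ] ℝ :=
      bundleMetric h.inner k.inner lam'
    (∀ j : ℕ,
      Integrable (fun q => scalarCurvature I g q ^ j) (riemannianVolume I g) ∧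
      Integrable (fun q => scalarCurvature I g' q ^ j) (riemannianVolume I g') ∧
      ∫ q, scalarCurvature I g q ^ j ∂(riemannianVolume I g) =
        ∫ q, scalarCurvature I g' q ^ j ∂(riemannianVolume I g')) ∧
    range (scalarCurvature I g) = range (scalarCurvature I g') := by 
  intro I g g'
  have : IsManifold (𝓡 r) ∞ H := LieGroup.toContMDiffMul.toIsManifold
  -- Second countability makes the product sigma-algebra on `N × H` the Borel one.
  have : SecondCountableTopology N :=
    ChartedSpace.secondCountable_of_sigmaCompact (EuclideanSpace ℝ (Fin 2)) N
  have : SecondCountableTopology H :=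
    ChartedSpace.secondCountable_of_sigmaCompact (EuclideanSpace ℝ (Fin r)) H
  have hg : IsMetricInCharts I g := isMetricInCharts_bundleMetric h k hlam
  have hg' : IsMetricInCharts I g' := isMetricInCharts_bundleMetric h k hlam'
  have hvol : riemannianVolume I g' = riemannianVolume I g :=
    riemannianVolume_bundleMetric_eq h.inner k.inner lam' lam
  have := hg.isFiniteMeasure_riemannianVolume
  have := hg.isOpenPosMeasure_riemannianVolume
  have hc := continuous_scalarCurvature hg
  have hc' := continuous_scalarCurvature hg'
  -- Both moments are taken against the same measure, as the volumes of `g` and `g'` coincide.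
  have hmom : ∀ j : ℕ, ∫ q, scalarCurvature I g q ^ j ∂(riemannianVolume I g) =
      ∫ q, scalarCurvature I g' q ^ j ∂(riemannianVolume I g) := by
    intro j
    obtain ⟨v, hv, hvc⟩ := exists_fieldStrength h k hlam
    obtain ⟨v', hv', hvc'⟩ := exists_fieldStrength h k hlam'
    obtain ⟨L, Z, hL, hLZ⟩ := exists_orthonormal_coordinates (lieAlgebraMetric_symm k)
      (lieAlgebraMetric_pos k)
    have hform : ∀ Z, Continuous (curlNormSq h.inner (formComponent k lam Z)) := fun Z =>
      continuous_curlNormSq h.isMetricInCharts (contDiffAt_oneFormInChart_formComponent k hlam Z)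
    have hform' : ∀ Z, Continuous (curlNormSq h.inner (formComponent k lam' Z)) := fun Z =>
      continuous_curlNormSq h.isMetricInCharts (contDiffAt_oneFormInChart_formComponent k hlam' Z)
    have key := integral_sub_norm_sq_pow_eq (μ := riemannianVolume I g)
      (K := fun q : N × H => scalarCurvature (𝓡 2) h.inner q.1)
      (w := fun q => L (v q.1)) (w' := fun q => L (v' q.1))
      ((continuous_scalarCurvature h.isMetricInCharts).comp continuous_fst)
      (fun c => by
        simp only [hLZ, ← hvc]
        exact (hform _).comp continuous_fst)
      (fun c => by
        simp only [hLZ, ← hvc']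
        exact (hform' _).comp continuous_fst)
      (fun c => by
        -- The Euclidean direction `c` corresponds to the Lie algebra element `Z c`, whose isometry
        -- acts on the base and trivially on the fiber.
        obtain ⟨f, hf, hfl⟩ := hiso (Z c)
        refine ⟨Prod.map f id, f.continuous.prodMap continuous_id,
          hf.map_riemannianVolume_bundleMetric h.inner k.inner lam,
          fun q => hf.scalarCurvature_comp h.isMetricInCharts q.1, fun q => ?_⟩
        rw [hLZ, hLZ, ← hvc, ← hvc']
        exact hf.curlNormSq_comp h.isMetricInCharts
          (contDiffAt_oneFormInChart_formComponent k hlam (Z c)) hfl q.1)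
      (1 / 2) j
    simp only [hL, ← hv, ← hv'] at key
    exact key
  refine ⟨fun j => ⟨(hc.pow j).integrable_of_compactSpace, ?_, ?_⟩,
    range_eq_of_integral_pow_eq hc hc' hmom⟩
  · rw [hvol]
    exact (hc'.pow j).integrable_of_compactSpace
  · rw [hvol]
    exact hmom j

end Main
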